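/- **Proposition (Discrete energy estimate and well-posedness of the HDG system).** Let $n\in\{2,3\}$ and let $\Omega\subset\mathbb R^n$ be open with $\operatorname{int}\overline\Omega=\Omega$. Put $\Gamma_D=\partial\Omega$. Let $\Omega_h$ be a finite mesh of $\Omega$: finitely many closed convex polytopes $K$ with non-empty, pairwise disjoint interiors and $\bigcup K=\overline\Omega$. Its interior faces are the $(n-1)$-dimensional intersections $K\cap K'$ of two different elements, and its boundary faces are the facets of elements that lie on $\Gamma_D$. The boundary of every element is assumed to be the union of the faces (interior and boundary) that it contains. Let $\mathcal E_h$ be the set of all faces, $h=\max_K\operatorname{diam}K$, and $\mathbf n$ the outward unit normal on $\partial K$. Let $\varphi\ge 0$ and $d$ be continuous on $\overline\Omega$ and locally Lipschitz on $\{x\in\Omega:\varphi(x)>0\}$, with $d=0$ where $\varphi=0$, and with $$\varphi^{-1/2}d,\qquad \varphi^{-1/2}\nabla d,\qquad \varphi^{-3/2}d\,\nabla\varphi\qquad\text{in } L^\infty(\Omega),$$ where these three coefficients are understood to be $0$ at points with $\varphi=0$. Let $0<C_1\le C_2$, and let $\tau$ be a measurable function on the skeleton with $C_1/h\le\tau\le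 C_2/h$. Fix $k\ge 0$. Let $\mathbf V_h$ and $V_h$ be the spaces of vector and scalar functions that are polynomials of degree at most $k$ on each element, and $\Lambda_h$ the space of functions on the skeleton that are polynomials of degree at most $k$ on each face. Traces of elements of $\mathbf V_h$, $V_h$ on $\partial K$ are taken from $K$. Write $(\cdot,\cdot)_{\Omega_h}=\sum_K(\cdot,\cdot)_{L^2(K)}$, write $\langle\cdot,\cdot\rangle_{\partial\Omega_h\setminus\Gamma_D}$ for the sum over all $K$ and all interior faces $e\subset\partial K$ of $\langle\cdot,\cdot\rangle_{L^2(e)}$, and $\langle\cdot,\cdot\rangle_{\mathcal E_h\setminus\Gamma_D}$ for the sum over the interior faces. The jump $[\![\cdot]\!]$ on an interior face is the sum of the values from the two adjacent elements, and $\|w\|^2_{S,\tau}=\langle|\tau|w,w\rangle_S$. For data $g_D,f,\tilde{\mathbf g}$ the HDG system reads: find $(\mathbf u,p,\hat p)\in\mathbf V_h\times V_h\times\Lambda_h$ such that for all $(\mathbf v,q,\hat q)\in\mathbf V_h\times V_h\times\Lambda_h$ $$(\mathbf u,\mathbf v)_{\Omega_h}-(\varphi^{-1/2}\nabla d\,p,\mathbf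 v)_{\Omega_h}-(\varphi^{-1/2}d\,p,\nabla\!\cdot\mathbf v)_{\Omega_h}+\langle\varphi^{-1/2}d\,\hat p,\mathbf v\cdot\mathbf n\rangle_{\partial\Omega_h\setminus\Gamma_D}=(d\tilde{\mathbf g},\mathbf v)_{\Omega_h}-\langle g_D,\varphi^{-1/2}d\,\mathbf v\cdot\mathbf n\rangle_{\Gamma_D},$$ $$(p,q)_{\Omega_h}+(\tfrac12\varphi^{-3/2}d\,\nabla\varphi\cdot\mathbf u,q)_{\Omega_h}-(\varphi^{-1/2}d\,\mathbf u,\nabla q)_{\Omega_h}+\langle\varphi^{-1/2}d\,\mathbf u\cdot\mathbf n+\tau(p-\hat p),q\rangle_{\partial\Omega_h\setminus\Gamma_D}+\langle\varphi^{-1/2}d\,\mathbf u\cdot\mathbf n+\tau p,q\rangle_{\Gamma_D}=(f,q)_{\Omega_h}+\langle\tau g_D,q\rangle_{\Gamma_D},$$ $$-\langle[\![\varphi^{-1/2}d\,\mathbf u\cdot\mathbf n+\tau(p-\hat p)]\!],\hat q\rangle_{\mathcal E_h\setminus\Gamma_D}+\langle\tau\hat p,\hat q\rangle_{\Gamma_D}=\langle\tau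 g_D,\hat q\rangle_{\Gamma_D}.$$ Let $a((\mathbf u,p,\hat p);(\mathbf v,q,\hat q))$ be the sum of the three left-hand sides. Then, for every $(\mathbf u,p,\hat p)\in\mathbf V_h\times V_h\times\Lambda_h$, $$a\big((\mathbf u,p,\hat p);(\mathbf u,p,\hat p)\big)=\|\mathbf u\|^2_{\Omega_h}+\|p\|^2_{\Omega_h}+\|\hat p\|^2_{\Gamma_D,\tau}+\|p\|^2_{\Gamma_D,\tau}+\|p-\hat p\|^2_{\partial\Omega_h\setminus\Gamma_D,\tau}.$$ Moreover, there is a constant $c>0$, depending only on $\varphi$, $d$, the mesh, $k$, $C_1$ and $C_2$, such that for all such $\tau$ and all data with $g_D\in L^2(\Gamma_D)$, $f\in L^2(\Omega)$ and $d\,\tilde{\mathbf g}\in L^2(\Omega)^n$, the HDG system has exactly one solution $(\mathbf u,p,\hat p)$, and it satisfies $$a\big((\mathbf u,p,\hat p);(\mathbf u,p,\hat p)\big)\le c\big(\|g_D\|^2_{\Gamma_D,\tau}+\|d\,\tilde{\mathbf g}\|^2_{\Omega_h}+\|f\|^2_{\Omega_h}\big)$$ and $$a\big((\mathbf u,p,\hat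 p);(\mathbf u,p,\hat p)\big)\le c\big(\|g_D\|^2_{\Gamma_D,\tau}+\|\tilde{\mathbf g}\|^2_{\Omega_h}+\|f\|^2_{\Omega_h}\big),$$ where the last right-hand side is $+\infty$ if $\tilde{\mathbf g}\notin L^2(\Omega)^n$. In particular the HDG system is well-posed: the solution exists, is unique, and depends continuously on the data. -/

import Mathlib

open MeasureTheory

open scoped MeasureTheory

noncomputable section

namespace HDG

/-- The ambient space `ℝⁿ` with its Euclidean norm. -/
abbrev Pt (n : ℕ) : Type := EuclideanSpace ℝ (Fin n)

/-! ### Meshes -/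

/-- `K` is a (closed, full-dimensional) convex polytope in `ℝⁿ`. -/
def IsCell {n : ℕ} (K : Set (Pt n)) : Prop :=
  (∃ s : Finset (Pt n), K = convexHull ℝ (s : Set (Pt n))) ∧ (interior K).Nonempty

/-- The affine dimension of `e` is `n - 1`. -/
def HasCodimOne {n : ℕ} (e : Set (Pt n)) : Prop :=
  Module.finrank ℝ (vectorSpan ℝ e) + 1 = n

/-- `e` is a facet of the convex polytope `K`: an exposed face of dimension `n - 1`. -/
def IsFacet {n : ℕ} (K e : Set (Pt n)) : Prop :=
  IsExposed ℝ K e ∧ HasCodimOne e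

/-- A finite mesh of `Ω` by non-overlapping convex polytopes, with its skeleton.
The two sets of faces are determined by the elements: the interior faces are the
`(n-1)`-dimensional intersections of two elements, and the boundary faces are the facets
of elements that lie on `∂Ω`. -/
structure Mesh (n : ℕ) (Ω : Set (Pt n)) where
  elements : Finset (Set (Pt n))
  isCell : ∀ K ∈ elements, IsCell K
  disjoint_interior : ∀ K ∈ elements, ∀ L ∈ elements, K ≠ L →
    Disjoint (interior K) (interior L)
  iUnion_eq : (⋃ K ∈ elements, K) = closure Ω
  interiorFaces : Finset (Set (Pt n))
  mem_interiorFaces : ∀ e, e ∈ interiorFaces ↔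
    ∃ K ∈ elements, ∃ L ∈ elements, K ≠ L ∧ e = K ∩ L ∧ HasCodimOne e
  boundaryFaces : Finset (Set (Pt n))
  mem_boundaryFaces : ∀ e, e ∈ boundaryFaces ↔
    ∃ K ∈ elements, IsFacet K e ∧ e ⊆ frontier Ω
  /-- The boundary of each element is made up of faces of the skeleton. -/
  frontier_subset : ∀ K ∈ elements, ∀ x ∈ frontier K,
    ∃ e, (e ∈ interiorFaces ∨ e ∈ boundaryFaces) ∧ e ⊆ K ∧ x ∈ e

namespace Mesh

variable {n : ℕ} {Ω : Set (Pt n)}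

/-- An element of the mesh. -/
abbrev Elem (T : Mesh n Ω) : Type := {K : Set (Pt n) // K ∈ T.elements}

open Classical in
/-- All faces of the skeleton. -/
def faces (T : Mesh n Ω) : Finset (Set (Pt n)) := T.interiorFaces ∪ T.boundaryFaces

/-- A face of the skeleton. -/
abbrev Face (T : Mesh n Ω) : Type := {e : Set (Pt n) // e ∈ T.faces}

/-- The mesh skeleton as a set of points. -/
def skeleton (T : Mesh n Ω) : Set (Pt n) := ⋃ e : T.Face, (e : Set (Pt n))

/-- The mesh size: the largest diameter of an element. -/
def h (T : Mesh n Ω) : ℝ := ⨆ K : T.Elem, Metric.diam (K : Set (Pt n))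

open Classical in
/-- The faces in the interior of the domain. -/
def inner (T : Mesh n Ω) : Finset T.Face :=
  Finset.univ.filter fun e => (e : Set (Pt n)) ∈ T.interiorFaces

open Classical in
/-- The faces on the Dirichlet boundary `Γ_D = ∂Ω`. -/
def outer (T : Mesh n Ω) : Finset T.Face :=
  Finset.univ.filter fun e => (e : Set (Pt n)) ∈ T.boundaryFaces

open Classical in
/-- The faces of `∂K` that do not lie on `Γ_D`. -/
def innerOf (T : Mesh n Ω) (K : T.Elem) : Finset T.Face :=
  T.inner.filter fun e => (e : Set (Pt n)) ⊆ K

open Classical in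
/-- The faces of `∂K` that lie on `Γ_D`. -/
def outerOf (T : Mesh n Ω) (K : T.Elem) : Finset T.Face :=
  T.outer.filter fun e => (e : Set (Pt n)) ⊆ K

open Classical in
/-- The elements that have `e` on their boundary. -/
def adjacent (T : Mesh n Ω) (e : T.Face) : Finset T.Elem :=
  Finset.univ.filter fun K => (e : Set (Pt n)) ⊆ K

end Mesh

/-- `ν` is the outward unit normal of the convex body `K` on `e ⊆ ∂K`. -/
def IsOutwardNormal {n : ℕ} (K e : Set (Pt n)) (ν : Pt n) : Prop :=
  ‖ν‖ = 1 ∧ ∀ x ∈ e, ∀ y ∈ K, inner ℝ ν (y - x) ≤ 0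

/-- The outward unit normal of the convex body `K` on the `(n-1)`-dimensional set `e ⊆ ∂K`
(there is exactly one when `e` is a face of an element `K` of a mesh). -/
def outwardNormal {n : ℕ} (K e : Set (Pt n)) : Pt n :=
  Classical.epsilon (IsOutwardNormal K e)

/-- The integral over a face with respect to surface measure. -/
def faceIntegral {n : ℕ} (e : Set (Pt n)) (w : Pt n → ℝ) : ℝ :=
  ∫ x in e, w x ∂(μHE[n - 1] : Measure (Pt n))

/-! ### Discrete spaces -/

/-- The value of a polynomial at a point. -/
def polyVal {n : ℕ} (p : MvPolynomial (Fin n) ℝ) (x : Pt n) : ℝ :=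
  MvPolynomial.eval (fun i => x i) p

/-- The gradient of a polynomial. -/
def polyGrad {n : ℕ} (p : MvPolynomial (Fin n) ℝ) (x : Pt n) : Pt n :=
  WithLp.toLp 2 fun i => polyVal (MvPolynomial.pderiv i p) x

/-- `𝒫ᵏ(K)` for a set `K` with interior points, where a polynomial function on `K` and its
polynomial are the same thing. -/
abbrev Poly (n k : ℕ) : Type := MvPolynomial.restrictTotalDegree (Fin n) ℝ k

/-- The value of a vector of polynomials. -/
def vecVal {n k : ℕ} (v : Fin n → Poly n k) (x : Pt n) : Pt n :=
  WithLp.toLp 2 fun i => polyVal (v i : MvPolynomial (Fin n) ℝ) x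

/-- The divergence of a vector of polynomials. -/
def vecDiv {n k : ℕ} (v : Fin n → Poly n k) (x : Pt n) : ℝ :=
  ∑ i, polyVal (MvPolynomial.pderiv i (v i : MvPolynomial (Fin n) ℝ)) x

open Classical in
/-- Restriction of polynomials to `e`, as functions extended by zero. -/
def restrictTo {n : ℕ} (e : Set (Pt n)) : MvPolynomial (Fin n) ℝ →ₗ[ℝ] (Pt n → ℝ) where
  toFun p := fun x => if x ∈ e then polyVal p x else 0
  map_add' p q := by
    funext x
    by_cases hx : x ∈ e <;> simp [hx, polyVal]
  map_smul' r p := by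
    funext x
    by_cases hx : x ∈ e <;> simp [hx, polyVal]

/-- `𝒫ᵏ(e)` for a face `e`: the functions on `e` (extended by zero) that are restrictions of
polynomials of degree at most `k`. -/
def facePoly {n : ℕ} (k : ℕ) (e : Set (Pt n)) : Submodule ℝ (Pt n → ℝ) :=
  (MvPolynomial.restrictTotalDegree (Fin n) ℝ k).map (restrictTo e)

/-- The space of discrete vector fields, broken over the elements. -/
abbrev VecSpace {n : ℕ} {Ω : Set (Pt n)} (T : Mesh n Ω) (k : ℕ) : Type :=
  T.Elem → Fin n → Poly n k

/-- The space of discrete scalar fields, broken over the elements. -/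
abbrev ScalSpace {n : ℕ} {Ω : Set (Pt n)} (T : Mesh n Ω) (k : ℕ) : Type :=
  T.Elem → Poly n k

/-- The space of discrete traces, broken over the faces of the skeleton. -/
abbrev TraceSpace {n : ℕ} {Ω : Set (Pt n)} (T : Mesh n Ω) (k : ℕ) : Type :=
  (e : T.Face) → facePoly k (e : Set (Pt n))

/-- The product space of the triples `(u, p, p̂)`. -/
@[ext]
structure Triple {n : ℕ} {Ω : Set (Pt n)} (T : Mesh n Ω) (k : ℕ) where
  u : VecSpace T k
  p : ScalSpace T k
  phat : TraceSpace T k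

/-! ### Coefficients -/

/-- `φ^{-1/2} d`. Here and below the negative power is `0` where `φ = 0` (this is
`Real.zero_rpow`), that is, all coefficients are `0` where the porosity vanishes. -/
def coefB {n : ℕ} (φ d : Pt n → ℝ) (x : Pt n) : ℝ := φ x ^ (-(1 / 2) : ℝ) * d x

/-- `φ^{-1/2} ∇d`. -/
def coefD {n : ℕ} (φ d : Pt n → ℝ) (x : Pt n) : Pt n := φ x ^ (-(1 / 2) : ℝ) • gradient d x

/-- `φ^{-3/2} d ∇φ`. -/
def coefP {n : ℕ} (φ d : Pt n → ℝ) (x : Pt n) : Pt n :=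
  (φ x ^ (-(3 / 2) : ℝ) * d x) • gradient φ x

/-- The standing assumptions on the porosity `φ ≥ 0` and on `d`: the three coefficients of the
scaled equations are essentially bounded, and `d = 0` where `φ = 0`. Continuity on the closure
makes the values on faces meaningful; local Lipschitz continuity where `φ > 0` makes the
gradients exist almost everywhere there and be the weak gradients. -/
structure IsAdmissible {n : ℕ} (Ω : Set (Pt n)) (φ d : Pt n → ℝ) : Prop where
  phi_nonneg : ∀ x ∈ closure Ω, 0 ≤ φ x
  phi_cont : ContinuousOn φ (closure Ω)
  d_cont : ContinuousOn d (closure Ω)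
  phi_lip : LocallyLipschitzOn {x | x ∈ Ω ∧ 0 < φ x} φ
  d_lip : LocallyLipschitzOn {x | x ∈ Ω ∧ 0 < φ x} d
  d_zero : ∀ x ∈ closure Ω, φ x = 0 → d x = 0
  coefB_bdd : MemLp (coefB φ d) ⊤ (volume.restrict Ω)
  coefD_bdd : MemLp (coefD φ d) ⊤ (volume.restrict Ω)
  coefP_bdd : MemLp (coefP φ d) ⊤ (volume.restrict Ω)

/-- The stabilization `τ` is a positive function on the skeleton of order `1/h`, with
constants `C₁` and `C₂`. -/
structure IsStabilization {n : ℕ} {Ω : Set (Pt n)} (T : Mesh n Ω) (C₁ C₂ : ℝ)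
    (τ : Pt n → ℝ) : Prop where
  meas : AEStronglyMeasurable τ ((μHE[n - 1] : Measure (Pt n)).restrict T.skeleton)
  lower : ∀ x ∈ T.skeleton, C₁ / T.h ≤ τ x
  upper : ∀ x ∈ T.skeleton, τ x ≤ C₂ / T.h

/-! ### The HDG system -/

section System

variable {n : ℕ} {Ω : Set (Pt n)} (T : Mesh n Ω) {k : ℕ}

/-- The left-hand side of the first equation of the HDG system (test function `v`). -/
def lhs1 (φ d : Pt n → ℝ) (X : Triple T k) (v : VecSpace T k) : ℝ :=
  (∑ K : T.Elem, ∫ x in (K : Set (Pt n)), inner ℝ (vecVal (X.u K) x) (vecVal (v K) x))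
  - (∑ K : T.Elem, ∫ x in (K : Set (Pt n)),
      polyVal (X.p K) x * inner ℝ (coefD φ d x) (vecVal (v K) x))
  - (∑ K : T.Elem, ∫ x in (K : Set (Pt n)),
      coefB φ d x * polyVal (X.p K) x * vecDiv (v K) x)
  + ∑ K : T.Elem, ∑ e ∈ T.innerOf K, faceIntegral (e : Set (Pt n)) fun x =>
      coefB φ d x * (X.phat e : Pt n → ℝ) x * inner ℝ (vecVal (v K) x) (outwardNormal K e)

/-- The right-hand side of the first equation of the HDG system. -/
def rhs1 (φ d gD : Pt n → ℝ) (g : Pt n → Pt n) (v : VecSpace T k) : ℝ :=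
  (∑ K : T.Elem, ∫ x in (K : Set (Pt n)), inner ℝ (d x • g x) (vecVal (v K) x))
  - ∑ K : T.Elem, ∑ e ∈ T.outerOf K, faceIntegral (e : Set (Pt n)) fun x =>
      gD x * (coefB φ d x * inner ℝ (vecVal (v K) x) (outwardNormal K e))

/-- The numerical flux `φ^{-1/2} d u · n + τ (p - p̂)` on the face `e` of the element `K`. -/
def flux (φ d τ : Pt n → ℝ) (X : Triple T k) (K : T.Elem) (e : T.Face) (x : Pt n) : ℝ :=
  coefB φ d x * inner ℝ (vecVal (X.u K) x) (outwardNormal K e)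
    + τ x * (polyVal (X.p K) x - (X.phat e : Pt n → ℝ) x)

/-- The left-hand side of the second equation of the HDG system (test function `q`). -/
def lhs2 (φ d τ : Pt n → ℝ) (X : Triple T k) (q : ScalSpace T k) : ℝ :=
  (∑ K : T.Elem, ∫ x in (K : Set (Pt n)), polyVal (X.p K) x * polyVal (q K) x)
  + (∑ K : T.Elem, ∫ x in (K : Set (Pt n)),
      (1 / 2 : ℝ) * inner ℝ (coefP φ d x) (vecVal (X.u K) x) * polyVal (q K) x)
  - (∑ K : T.Elem, ∫ x in (K : Set (Pt n)),
      coefB φ d x * inner ℝ (vecVal (X.u K) x) (polyGrad (q K : MvPolynomial (Fin n) ℝ) x))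
  + (∑ K : T.Elem, ∑ e ∈ T.innerOf K, faceIntegral (e : Set (Pt n)) fun x =>
      flux T φ d τ X K e x * polyVal (q K) x)
  + ∑ K : T.Elem, ∑ e ∈ T.outerOf K, faceIntegral (e : Set (Pt n)) fun x =>
      (coefB φ d x * inner ℝ (vecVal (X.u K) x) (outwardNormal K e)
        + τ x * polyVal (X.p K) x) * polyVal (q K) x

/-- The right-hand side of the second equation of the HDG system. -/
def rhs2 (τ gD f : Pt n → ℝ) (q : ScalSpace T k) : ℝ :=
  (∑ K : T.Elem, ∫ x in (K : Set (Pt n)), f x * polyVal (q K) x)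
  + ∑ K : T.Elem, ∑ e ∈ T.outerOf K, faceIntegral (e : Set (Pt n)) fun x =>
      τ x * gD x * polyVal (q K) x

/-- The left-hand side of the third equation of the HDG system (test function `μ`). The jump
of the flux is the sum of the fluxes out of the adjacent elements. -/
def lhs3 (φ d τ : Pt n → ℝ) (X : Triple T k) (μ : TraceSpace T k) : ℝ :=
  - (∑ e ∈ T.inner, faceIntegral (e : Set (Pt n)) fun x =>
      (∑ K ∈ T.adjacent e, flux T φ d τ X K e x) * (μ e : Pt n → ℝ) x)
  + ∑ e ∈ T.outer, faceIntegral (e : Set (Pt n)) fun x =>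
      τ x * (X.phat e : Pt n → ℝ) x * (μ e : Pt n → ℝ) x

/-- The right-hand side of the third equation of the HDG system. -/
def rhs3 (τ gD : Pt n → ℝ) (μ : TraceSpace T k) : ℝ :=
  ∑ e ∈ T.outer, faceIntegral (e : Set (Pt n)) fun x => τ x * gD x * (μ e : Pt n → ℝ) x

/-- The HDG bilinear form: the sum of the three left-hand sides. -/
def bilin (φ d τ : Pt n → ℝ) (X Y : Triple T k) : ℝ :=
  lhs1 T φ d X Y.u + lhs2 T φ d τ X Y.p + lhs3 T φ d τ X Y.phat

/-- `X` solves the HDG system. -/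
def IsSolution (φ d τ gD f : Pt n → ℝ) (g : Pt n → Pt n) (X : Triple T k) : Prop :=
  (∀ v : VecSpace T k, lhs1 T φ d X v = rhs1 T φ d gD g v) ∧
  (∀ q : ScalSpace T k, lhs2 T φ d τ X q = rhs2 T τ gD f q) ∧
  (∀ μ : TraceSpace T k, lhs3 T φ d τ X μ = rhs3 T τ gD μ)

/-- The discrete energy
`‖u‖² + ‖p‖² + ‖p̂‖²_{Γ_D,τ} + ‖p‖²_{Γ_D,τ} + ‖p - p̂‖²_{∂Ω_h ∖ Γ_D,τ}`. -/
def energy (τ : Pt n → ℝ) (X : Triple T k) : ℝ :=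
  (∑ K : T.Elem, ∫ x in (K : Set (Pt n)), ‖vecVal (X.u K) x‖ ^ 2)
  + (∑ K : T.Elem, ∫ x in (K : Set (Pt n)), polyVal (X.p K) x ^ 2)
  + (∑ e ∈ T.outer, faceIntegral (e : Set (Pt n)) fun x =>
      |τ x| * (X.phat e : Pt n → ℝ) x ^ 2)
  + (∑ K : T.Elem, ∑ e ∈ T.outerOf K, faceIntegral (e : Set (Pt n)) fun x =>
      |τ x| * polyVal (X.p K) x ^ 2)
  + ∑ K : T.Elem, ∑ e ∈ T.innerOf K, faceIntegral (e : Set (Pt n)) fun x =>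
      |τ x| * (polyVal (X.p K) x - (X.phat e : Pt n → ℝ) x) ^ 2

/-- `‖w‖²_{Ω_h}` for a function with values in a normed space. -/
def volNormSq {F : Type*} [NormedAddCommGroup F] (w : Pt n → F) : ℝ :=
  ∑ K : T.Elem, ∫ x in (K : Set (Pt n)), ‖w x‖ ^ 2

/-- `‖w‖²_{Γ_D,τ}`. -/
def bdryNormSq (τ w : Pt n → ℝ) : ℝ :=
  ∑ e ∈ T.outer, faceIntegral (e : Set (Pt n)) fun x => |τ x| * w x ^ 2

end System

end HDG

end

/-! The energy identity `bilin_self` is integration by parts. When the form is tested with its own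
argument, the volume terms that carry coefficients add up to minus the divergence of `φ^{-1/2} d p
u`, because `∇(φ^{-1/2} d) = φ^{-1/2} ∇d - ½ φ^{-3/2} d ∇φ`. The boundary terms produced in this way
cancel against the flux terms, and only squares weighted by `τ` survive. Zero energy forces a zero
triple (`eq_zero_of_energy_eq_zero`), so on a finite-dimensional space the system is uniquely
solvable for every load. For the stability bound, Young's inequality estimates the load by half the
energy plus the data (`exists_load_le`). The only term without a direct counterpart in the energy is
`g_D` against `u · n` on the boundary; it is handled by the equivalence of norms on polynomials
(`exists_norm_vecVal_sq_le`) and by `τ ≥ C₁/h`.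

The substance lies in justifying the integration by parts for a coefficient that degenerates. The
hypotheses bound the gradient of `φ^{-1/2} d` where `φ > 0`, but continuity of `φ` and `d` alone
does not control the quotient at zeros of `φ`. The third coefficient closes this gap: it equals
`φ^{-1/2} d ∇ log φ`, so wherever `φ^{-1/2} d` stays away from zero, `log φ` is Lipschitz and `φ`
cannot reach zero. Hence `φ^{-1/2} d` tends to zero linearly at the zeros of `φ`
(`IsAdmissible.abs_coefB_le_of_zero`) and is Lipschitz on every closed element
(`IsAdmissible.exists_lipschitzOnWith`). This also makes its values on faces usable.

The divergence theorem for a Lipschitz function on a convex body with flat faces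
(`integral_lineDeriv_eq_sum_faces`) comes from translating the body: up to a null set, body and
translate differ by thin tubes over the faces, and dividing by the length of the shift produces
surface integrals. It requires that the faces cover the boundary of an element and overlap in null
sets only. The overlap property (`Mesh.faceMeasure_inter_eq_zero`) holds because a convex body
containing a flat disc contains a half ball on one side of it, and non-overlapping elements cannot
share a side. -/

noncomputable section

namespace HDG

/-! ### Lipschitz bounds from almost-everywhere derivative bounds -/

section
open Set Filter Topology

/-- A Lipschitz function on a convex open set whose derivative is a.e. bounded by `L` is
Lipschitz with constant `L`. -/
theorem abs_sub_le_of_ae_norm_fderiv_le {E : Type*} [NormedAddCommGroup E] [NormedSpace ℝ E]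
    [FiniteDimensional ℝ E] [MeasurableSpace E] [BorelSpace E] (μ : Measure E)
    [μ.IsAddHaarMeasure] {f : E → ℝ} {C : NNReal} (hf : LipschitzWith C f) {s : Set E}
    (hs : IsOpen s) (hc : Convex ℝ s) {L : ℝ}
    (h : ∀ᵐ x ∂μ, x ∈ s → ‖fderiv ℝ f x‖ ≤ L) {x y : E} (hx : x ∈ s) (hy : y ∈ s) :
    |f y - f x| ≤ L * ‖y - x‖ := by
  set v := y - x with hv
  have hgood : ∀ᵐ w ∂μ, DifferentiableAt ℝ f w ∧ (w ∈ s → ‖fderiv ℝ f w‖ ≤ L) :=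
    hf.ae_differentiableAt.and h
  obtain ⟨N, hNsub, hNmeas, hN0⟩ := exists_measurable_superset_of_null
    (MeasureTheory.ae_iff.mp hgood)
  -- The segment from `x` to `y` itself may lie in the exceptional null set. By Fubini almost every
  -- parallel copy of it meets that set in a null set of times.
  have hprod : ∀ᵐ z ∂μ, ∀ᵐ t : ℝ, x + z + t • v ∉ N := by
    have hm : MeasurableSet {q : ℝ × E | x + q.2 + q.1 • v ∈ N} := by
      have : Measurable fun q : ℝ × E => x + q.2 + q.1 • v := by fun_prop
      exact this hNmeas
    have h0 : ((volume : Measure ℝ).prod μ) {q : ℝ × E | x + q.2 + q.1 • v ∈ N} = 0 := by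
      rw [Measure.measure_prod_null hm]
      refine Eventually.of_forall fun t => ?_
      have : (Prod.mk t ⁻¹' {q : ℝ × E | x + q.2 + q.1 • v ∈ N})
          = (fun z => (x + t • v) + z) ⁻¹' N := by
        ext z; simp only [mem_preimage, mem_ofPred_eq]
        rw [show x + z + t • v = x + t • v + z by abel]
      simp only [this, Pi.zero_apply]
      simpa using hN0
    rw [← Measure.prod_swap, Measure.map_apply measurable_swap hm] at h0
    have := (Measure.measure_prod_null (measurable_swap hm)).mp h0
    filter_upwards [this] with z hz
    rw [MeasureTheory.ae_iff]
    simpa using hz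
  -- A violation of the bound is an open condition on the offset `z`, so it persists on a set of
  -- positive measure and therefore on some good parallel segment.
  by_contra hcon
  push Not at hcon
  have hopen : IsOpen {z : E | L * ‖v‖ < |f (y + z) - f (x + z)|} := by
    have := hf.continuous
    exact isOpen_lt (by fun_prop) (by fun_prop)
  have hopen2 : IsOpen {z : E | x + z ∈ s ∧ y + z ∈ s} :=
    (hs.preimage (by fun_prop : Continuous fun z : E => x + z)).inter
      (hs.preimage (by fun_prop : Continuous fun z : E => y + z))
  have hne : ({z : E | L * ‖v‖ < |f (y + z) - f (x + z)|} ∩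
      {z : E | x + z ∈ s ∧ y + z ∈ s}).Nonempty := ⟨0, by simpa using hcon, by simpa using ⟨hx, hy⟩⟩
  have hpos := (hopen.inter hopen2).measure_pos μ hne
  obtain ⟨z, ⟨hz1, hz2, hz3⟩, hz4⟩ : ∃ z, z ∈ ({z : E | L * ‖v‖ < |f (y + z) - f (x + z)|} ∩
      {z : E | x + z ∈ s ∧ y + z ∈ s}) ∧ ∀ᵐ t : ℝ, x + z + t • v ∉ N := by
    by_contra hno
    push Not at hno
    have : μ ({z : E | L * ‖v‖ < |f (y + z) - f (x + z)|} ∩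
      {z : E | x + z ∈ s ∧ y + z ∈ s}) = 0 :=
      measure_mono_null (fun z hz => hno z hz) (MeasureTheory.ae_iff.mp hprod)
    exact hpos.ne' this
  -- Along the good segment the function is Lipschitz, hence absolutely continuous, and the
  -- fundamental theorem of calculus applies with a derivative bounded almost everywhere.
  set F : ℝ → ℝ := fun t => f (x + z + t • v) with hF
  have hFL : LipschitzWith (C * ‖v‖₊) F := by
    refine hf.comp (LipschitzWith.of_dist_le_mul fun a b => ?_)
    rw [dist_add_left, dist_eq_norm, ← sub_smul, norm_smul, dist_eq_norm]
    simp [mul_comm]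
  have hint := (hFL.lipschitzOnWith (s := uIcc 0 1)).absolutelyContinuousOnInterval.integral_deriv_eq_sub
  have hF1 : F 1 - F 0 = f (y + z) - f (x + z) := by
    simp only [hF, hv]; congr 2 <;> simp <;> abel
  have hb : ‖∫ t in (0 : ℝ)..1, deriv F t‖ ≤ L * ‖v‖ * |1 - 0| := by
    refine intervalIntegral.norm_integral_le_of_norm_le_const_ae ?_
    filter_upwards [hz4] with t ht htI
    have ht' : DifferentiableAt ℝ f (x + z + t • v) ∧
        (x + z + t • v ∈ s → ‖fderiv ℝ f (x + z + t • v)‖ ≤ L) := by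
      by_contra hh; exact ht (hNsub hh)
    rw [uIoc_of_le zero_le_one] at htI
    have hmem : x + z + t • v ∈ s := by
      have := hc.add_smul_sub_mem hz2 hz3 ⟨htI.1.le, htI.2⟩
      simpa [hv] using this
    have hd : HasDerivAt F (fderiv ℝ f (x + z + t • v) v) t := by
      have h1 : HasDerivAt (fun t : ℝ => x + z + t • v) v t := by
        simpa using ((hasDerivAt_id t).smul_const v).const_add (x + z)
      exact ht'.1.hasFDerivAt.comp_hasDerivAt t h1
    rw [hd.deriv]
    exact (ContinuousLinearMap.le_opNorm _ _).trans
      (mul_le_mul_of_nonneg_right (ht'.2 hmem) (norm_nonneg _))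
  rw [hint, hF1] at hb
  simp only [sub_zero, abs_one, mul_one, Real.norm_eq_abs] at hb
  exact absurd hb (not_le.mpr hz1)

/-- The same along segments, for locally Lipschitz functions. -/
theorem abs_sub_le_of_segment_subset {E : Type*} [NormedAddCommGroup E] [NormedSpace ℝ E]
    [FiniteDimensional ℝ E] [MeasurableSpace E] [BorelSpace E] (μ : Measure E)
    [μ.IsAddHaarMeasure] {f : E → ℝ} {G : Set E} (hG : IsOpen G) (hf : LocallyLipschitzOn G f)
    {L : ℝ} (h : ∀ᵐ x ∂μ, x ∈ G → ‖fderiv ℝ f x‖ ≤ L) {x y : E}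
    (hxy : segment ℝ x y ⊆ G) : |f y - f x| ≤ L * ‖y - x‖ := by
  -- On a small ball the function agrees with a globally Lipschitz extension, whose derivative is
  -- the same at every point of the ball.
  have hloc : ∀ p ∈ G, ∃ r > 0, ∀ a ∈ Metric.ball p r, ∀ b ∈ Metric.ball p r,
      |f b - f a| ≤ L * ‖b - a‖ := by
    intro p hp
    obtain ⟨C, t, ht, hCt⟩ := hf hp
    rw [hG.nhdsWithin_eq hp] at ht
    obtain ⟨r, hr, hrt⟩ := Metric.mem_nhds_iff.mp (inter_mem ht (hG.mem_nhds hp))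
    obtain ⟨g, hg, hgf⟩ := (hCt.mono (hrt.trans inter_subset_left)).extend_real
    refine ⟨r, hr, fun a ha b hb => ?_⟩
    rw [hgf ha, hgf hb]
    refine abs_sub_le_of_ae_norm_fderiv_le μ hg Metric.isOpen_ball (convex_ball p r) ?_ ha hb
    filter_upwards [h] with w hw hwb
    have : fderiv ℝ g w = fderiv ℝ f w := by
      refine Filter.EventuallyEq.fderiv_eq ?_
      filter_upwards [Metric.isOpen_ball.mem_nhds hwb] with u hu using (hgf hu).symm
    rw [this]
    exact hw (hrt hwb).2
  set c : ℝ → E := fun t => x + t • (y - x) with hc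
  have hcc : Continuous c := by fun_prop
  have hcG : ∀ t ∈ Icc (0 : ℝ) 1, c t ∈ G := fun t ht => hxy (by
    rw [segment_eq_image']; exact ⟨t, ht, rfl⟩)
  have hfc : ContinuousOn (fun t => f (c t)) (Icc 0 1) :=
    hf.continuousOn.comp hcc.continuousOn hcG
  have hcl : IsClosed ({t | |f (c t) - f (c 0)| ≤ L * ‖y - x‖ * t} ∩ Icc 0 1) := by
    have : ContinuousOn (fun t => |f (c t) - f (c 0)| - L * ‖y - x‖ * t) (Icc 0 1) := by
      exact ((hfc.sub continuousOn_const).abs).sub (by fun_prop)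
    have h2 := this.preimage_isClosed_of_isClosed isClosed_Icc (isClosed_Iic (a := (0 : ℝ)))
    convert h2 using 1
    ext t; simp [and_comm]
  -- Continuity induction along the segment: the times at which the bound holds form a closed set,
  -- and the local bound pushes each such time further to the right.
  have hsub := hcl.Icc_subset_of_forall_exists_gt (by simp) (fun t ht u hu => by
    obtain ⟨r, hr, hb⟩ := hloc (c t) (hcG t ⟨ht.2.1, ht.2.2.le⟩)
    have hnear : ∀ᶠ t' in 𝓝[>] t, c t' ∈ Metric.ball (c t) r :=
      (hcc.continuousAt.eventually (Metric.ball_mem_nhds _ hr)).filter_mono nhdsWithin_le_nhds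
    obtain ⟨t', ht'1, ht'2⟩ := (hnear.and (Ioc_mem_nhdsGT hu)).exists
    refine ⟨t', ?_, ht'2⟩
    have h1 := hb _ (Metric.mem_ball_self hr) _ ht'1
    have h2 : ‖c t' - c t‖ = (t' - t) * ‖y - x‖ := by
      rw [show c t' - c t = (t' - t) • (y - x) by simp only [hc, sub_smul]; abel, norm_smul,
        Real.norm_of_nonneg (by linarith [ht'2.1])]
    rw [h2] at h1
    have h3 := ht.1
    simp only [mem_ofPred_eq] at h3 ⊢
    calc |f (c t') - f (c 0)| ≤ |f (c t') - f (c t)| + |f (c t) - f (c 0)| := abs_sub_le _ _ _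
      _ ≤ _ := by linarith)
  have := hsub (right_mem_Icc.mpr zero_le_one)
  simpa [hc] using this

end

/-! ### Lipschitz continuity of the degenerate coefficient -/

section
open Set Filter Topology

theorem locallyLipschitzOn_comp {X Y Z : Type*} [PseudoEMetricSpace X] [PseudoEMetricSpace Y]
    [PseudoEMetricSpace Z] {g : Y → Z} {f : X → Y} {s : Set X} {t : Set Y}
    (hg : LocallyLipschitzOn t g) (hf : LocallyLipschitzOn s f) (h : MapsTo f s t) :
    LocallyLipschitzOn s (g ∘ f) := by
  intro x hx
  obtain ⟨C, u, hu, hCu⟩ := hf hx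
  obtain ⟨D, w, hw, hDw⟩ := hg (h hx)
  refine ⟨D * C, u ∩ f ⁻¹' w, inter_mem hu ?_, ?_⟩
  · exact (hf.continuousOn x hx).tendsto_nhdsWithin h hw
  · exact hDw.comp (hCu.mono inter_subset_left) (fun y hy => hy.2)

/-- Rademacher's theorem for locally Lipschitz functions. -/
theorem ae_differentiableAt_of_locallyLipschitzOn {E : Type*} [NormedAddCommGroup E]
    [NormedSpace ℝ E] [FiniteDimensional ℝ E] [MeasurableSpace E] [BorelSpace E] (μ : Measure E)
    [μ.IsAddHaarMeasure] {f : E → ℝ} {G : Set E} (hG : IsOpen G) (hf : LocallyLipschitzOn G f) :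
    ∀ᵐ x ∂μ, x ∈ G → DifferentiableAt ℝ f x := by
  rw [MeasureTheory.ae_iff]
  refine measure_null_of_locally_null _ fun p hp => ?_
  simp only [mem_ofPred_eq, Classical.not_imp] at hp
  obtain ⟨C, t, ht, hCt⟩ := hf hp.1
  rw [hG.nhdsWithin_eq hp.1] at ht
  obtain ⟨r, hr, hrt⟩ := Metric.mem_nhds_iff.mp ht
  have h := (hCt.mono hrt).ae_differentiableWithinAt (μ := μ) measurableSet_ball
  rw [ae_restrict_iff' measurableSet_ball] at h
  refine ⟨{x | x ∈ G → DifferentiableAt ℝ f x}ᶜ ∩ Metric.ball p r,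
    inter_mem (by convert! self_mem_nhdsWithin using 1)
      (mem_nhdsWithin_of_mem_nhds (Metric.ball_mem_nhds p hr)), ?_⟩
  refine measure_mono_null ?_ h
  intro x hx hcon
  exact hx.1 fun _ => (hcon hx.2).differentiableAt (Metric.isOpen_ball.mem_nhds hx.2)

theorem memLp_top_exists_bound {α F : Type*} [MeasurableSpace α] {μ : Measure α}
    [NormedAddCommGroup F] {f : α → F} (hf : MemLp f ⊤ μ) :
    ∃ C : ℝ, 0 ≤ C ∧ ∀ᵐ x ∂μ, ‖f x‖ ≤ C := by
  refine ⟨(eLpNorm f ⊤ μ).toReal, ENNReal.toReal_nonneg, ?_⟩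
  have h := hf.2
  rw [eLpNorm_exponent_top] at h ⊢
  filter_upwards [ae_le_eLpNormEssSup (f := f) (μ := μ)] with x hx
  rw [← toReal_enorm]
  exact ENNReal.toReal_mono h.ne hx

variable {n : ℕ} {Ω : Set (Pt n)} {φ d : Pt n → ℝ}

/-- The part of the domain where the porosity is positive. -/
def posSet (Ω : Set (Pt n)) (φ : Pt n → ℝ) : Set (Pt n) := {x | x ∈ Ω ∧ 0 < φ x}

theorem coefB_of_zero {x : Pt n} (h : φ x = 0) : coefB φ d x = 0 := by
  rw [coefB, h, Real.zero_rpow (by norm_num), zero_mul]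

theorem coefD_of_zero {x : Pt n} (h : φ x = 0) : coefD φ d x = 0 := by
  rw [coefD, h, Real.zero_rpow (by norm_num), zero_smul]

theorem coefP_of_zero {x : Pt n} (h : φ x = 0) : coefP φ d x = 0 := by
  rw [coefP, h, Real.zero_rpow (by norm_num), zero_mul, zero_smul]

/-- This is the product rule, with `-1/2 - 1 = -3/2` in the exponent. It explains why exactly these
two coefficients, with the factor one half, occur in the discrete equations. -/
theorem hasGradientAt_coefB {x : Pt n} (hφ0 : 0 < φ x) (hφ : DifferentiableAt ℝ φ x)
    (hd : DifferentiableAt ℝ d x) :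
    HasGradientAt (coefB φ d) (coefD φ d x - (1 / 2 : ℝ) • coefP φ d x) x := by
  have h1 := hφ.hasGradientAt.hasFDerivAt
  have h2 := hd.hasGradientAt.hasFDerivAt
  have h3 := (h1.rpow_const (p := (-(1 / 2) : ℝ)) (Or.inl hφ0.ne')).mul h2
  rw [hasGradientAt_iff_hasFDerivAt]
  convert! h3 using 1
  ext y
  simp only [coefD, coefP, map_sub, map_smul, _root_.sub_apply,
    _root_.smul_apply, _root_.add_apply, smul_eq_mul]
  rw [show (-(1 / 2) - 1 : ℝ) = -(3 / 2) by norm_num]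
  ring

theorem IsAdmissible.isOpen_posSet (h : IsAdmissible Ω φ d) (hΩ : IsOpen Ω) :
    IsOpen (posSet Ω φ) :=
  (h.phi_cont.mono subset_closure).isOpen_inter_preimage hΩ isOpen_Ioi

theorem IsAdmissible.locallyLipschitzOn_coefB (h : IsAdmissible Ω φ d) :
    LocallyLipschitzOn (posSet Ω φ) (coefB φ d) := by
  have h1 : LocallyLipschitzOn (Ioi (0 : ℝ)) fun t : ℝ => t ^ (-(1 / 2) : ℝ) :=
    ContDiffOn.locallyLipschitzOn (convex_Ioi 0) fun t ht =>
      (Real.contDiffAt_rpow_const_of_ne ht.ne').contDiffWithinAt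
  have h2 : LocallyLipschitzOn (posSet Ω φ) ((fun t : ℝ => t ^ (-(1 / 2) : ℝ)) ∘ φ) :=
    locallyLipschitzOn_comp h1 h.phi_lip fun x hx => hx.2
  have h3 : LocallyLipschitz fun q : ℝ × ℝ => q.1 * q.2 :=
    ContDiff.locallyLipschitz (𝕂 := ℝ) (by fun_prop)
  have h4 : LocallyLipschitzOn (posSet Ω φ) fun x => (φ x ^ (-(1 / 2) : ℝ), d x) := by
    intro x hx
    obtain ⟨C, u, hu, hCu⟩ := h2 hx
    obtain ⟨D, w, hw, hDw⟩ := h.d_lip hx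
    exact ⟨max C D, u ∩ w, inter_mem hu hw,
      (hCu.mono inter_subset_left).prodMk (hDw.mono inter_subset_right)⟩
  exact locallyLipschitzOn_comp (t := univ) (locallyLipschitzOn_univ.mpr h3) h4 fun _ _ => trivial

theorem IsAdmissible.locallyLipschitzOn_log (h : IsAdmissible Ω φ d) :
    LocallyLipschitzOn (posSet Ω φ) fun x => Real.log (φ x) := by
  have h1 : LocallyLipschitzOn (Ioi (0 : ℝ)) Real.log :=
    ContDiffOn.locallyLipschitzOn (convex_Ioi 0) fun t ht =>
      (Real.contDiffAt_log.mpr ht.ne').contDiffWithinAt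
  exact locallyLipschitzOn_comp h1 h.phi_lip fun x hx => hx.2

theorem IsAdmissible.ae_differentiableAt (h : IsAdmissible Ω φ d) (hΩ : IsOpen Ω) :
    ∀ᵐ x : Pt n, x ∈ posSet Ω φ → DifferentiableAt ℝ φ x ∧ DifferentiableAt ℝ d x := by
  filter_upwards [ae_differentiableAt_of_locallyLipschitzOn volume (h.isOpen_posSet hΩ) h.phi_lip,
    ae_differentiableAt_of_locallyLipschitzOn volume (h.isOpen_posSet hΩ) h.d_lip] with x h1 h2 hx
    using ⟨h1 hx, h2 hx⟩

/-- Writing `φ^{-3/2} ∇φ = φ^{-1/2} ∇ log φ` turns the boundedness of the third coefficient into a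
bound on the logarithmic gradient, weighted by `φ^{-1/2} d`. -/
theorem IsAdmissible.exists_coefP_bound (h : IsAdmissible Ω φ d) (hΩ : IsOpen Ω) :
    ∃ M : ℝ, 0 ≤ M ∧ ∀ᵐ x : Pt n, x ∈ posSet Ω φ →
      |coefB φ d x| * ‖fderiv ℝ (fun x => Real.log (φ x)) x‖ ≤ M := by
  obtain ⟨M, hM, hb⟩ := memLp_top_exists_bound h.coefP_bdd
  refine ⟨M, hM, ?_⟩
  rw [ae_restrict_iff' hΩ.measurableSet] at hb
  filter_upwards [hb, h.ae_differentiableAt hΩ] with x h1 h2 hx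
  have h3 := ((h2 hx).1.hasGradientAt.hasFDerivAt.log hx.2.ne').fderiv
  refine le_trans (le_of_eq ?_) (h1 hx.1)
  rw [h3, norm_smul, LinearIsometryEquiv.norm_map, coefP, norm_smul, ← mul_assoc, coefB,
    Real.norm_eq_abs, ← abs_mul, Real.norm_eq_abs,
    show (-(3 / 2) : ℝ) = -(1 / 2) + -1 by norm_num, Real.rpow_add hx.2, Real.rpow_neg_one]
  congr 2
  ring

theorem IsAdmissible.exists_fderiv_bound (h : IsAdmissible Ω φ d) (hΩ : IsOpen Ω) :
    ∃ L : ℝ, 0 ≤ L ∧ ∀ᵐ x : Pt n, x ∈ posSet Ω φ → ‖fderiv ℝ (coefB φ d) x‖ ≤ L := by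
  obtain ⟨M, hM, hb⟩ := memLp_top_exists_bound (h.coefD_bdd.sub (h.coefP_bdd.const_smul (1/2:ℝ)))
  refine ⟨M, hM, ?_⟩
  rw [ae_restrict_iff' hΩ.measurableSet] at hb
  filter_upwards [hb, h.ae_differentiableAt hΩ] with x h1 h2 hx
  rw [(hasGradientAt_coefB hx.2 (h2 hx).1 (h2 hx).2).hasFDerivAt.fderiv,
    LinearIsometryEquiv.norm_map]
  exact h1 hx.1

/-- At a zero of the porosity, the distance to the zero controls `φ^{-1/2} d`: where
`|φ^{-1/2} d|` is bounded below, `log φ` is Lipschitz, so that `φ` cannot vanish. -/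
theorem IsAdmissible.abs_coefB_le_of_zero (h : IsAdmissible Ω φ d) (hΩ : IsOpen Ω) {L : ℝ}
    (hL0 : 0 ≤ L) (hL : ∀ᵐ x : Pt n, x ∈ posSet Ω φ → ‖fderiv ℝ (coefB φ d) x‖ ≤ L)
    {x z : Pt n} (hz : z ∈ closure Ω) (hφz : φ z = 0)
    (hseg : ∀ t ∈ Ico (0 : ℝ) 1, x + t • (z - x) ∈ Ω) :
    |coefB φ d x| ≤ L * ‖z - x‖ := by
  obtain ⟨M, hM0, hM⟩ := h.exists_coefP_bound hΩ
  by_contra hcon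
  push Not at hcon
  -- If the claim fails, the Lipschitz bound keeps the coefficient above this positive gap on the
  -- way to the first zero of `φ`.
  set b := |coefB φ d x| - L * ‖z - x‖ with hb
  have hb0 : 0 < b := sub_pos.mpr hcon
  have hx : φ x ≠ 0 := fun hx => by
    rw [coefB_of_zero hx, abs_zero] at hcon
    exact absurd hcon (not_lt.mpr (by positivity))
  set c : ℝ → Pt n := fun t => x + t • (z - x) with hc
  have hcc : Continuous c := by fun_prop
  have hc0 : c 0 = x := by simp [hc]
  have hc1 : c 1 = z := by simp [hc]
  have hcl : ∀ t ∈ Icc (0 : ℝ) 1, c t ∈ closure Ω := by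
    intro t ht
    rcases ht.2.eq_or_lt with h1 | h1
    · rw [h1, hc1]; exact hz
    · exact subset_closure (hseg t ⟨ht.1, h1⟩)
  have hφc : ContinuousOn (fun t => φ (c t)) (Icc 0 1) :=
    h.phi_cont.comp hcc.continuousOn hcl
  set Z := Icc (0 : ℝ) 1 ∩ (fun t => φ (c t)) ⁻¹' {0} with hZ
  have hZc : IsCompact Z :=
    isCompact_Icc.of_isClosed_subset (hφc.preimage_isClosed_of_isClosed isClosed_Icc
      isClosed_singleton) inter_subset_left
  have hZm : sInf Z ∈ Z := hZc.sInf_mem ⟨1, by simp, by simpa [hc1] using hφz⟩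
  -- The first time at which `φ` vanishes on the segment. Strictly before it the path stays where
  -- `φ` is positive and all derivative bounds are available.
  set s := sInf Z with hs
  have hs0 : 0 < s := lt_of_le_of_ne hZm.1.1 fun h0 => hx (by
    have := hZm.2; rw [← h0] at this; simpa [hc0] using this)
  have hpos : ∀ t ∈ Ico 0 s, c t ∈ posSet Ω φ := by
    intro t ht
    have ht1 : t < 1 := ht.2.trans_le hZm.1.2
    refine ⟨hseg t ⟨ht.1, ht1⟩, lt_of_le_of_ne (h.phi_nonneg _ (hcl t ⟨ht.1, ht1.le⟩)) ?_⟩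
    intro h0
    exact absurd (csInf_le hZc.bddBelow ⟨⟨ht.1, ht1.le⟩, h0.symm⟩) (not_le.mpr ht.2)
  have hsegc : ∀ t ∈ Ico 0 s, ∀ y ∈ segment ℝ x (c t), ∃ t' ∈ Icc 0 t, y = c t' := by
    intro t ht y hy
    rw [segment_eq_image'] at hy
    obtain ⟨θ, hθ, rfl⟩ := hy
    refine ⟨θ * t, ⟨mul_nonneg hθ.1 ht.1, mul_le_of_le_one_left ht.1 hθ.2⟩, ?_⟩
    simp [hc, smul_smul]
  have hnorm : ∀ t ∈ Ico 0 s, ‖c t - x‖ ≤ ‖z - x‖ := by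
    intro t ht
    simp only [hc, add_sub_cancel_left, norm_smul, Real.norm_of_nonneg ht.1]
    exact mul_le_of_le_one_left (norm_nonneg _) (ht.2.le.trans hZm.1.2)
  have hBlow : ∀ t ∈ Ico 0 s, b ≤ |coefB φ d (c t)| := by
    intro t ht
    have h1 := abs_sub_le_of_segment_subset volume (h.isOpen_posSet hΩ) h.locallyLipschitzOn_coefB
      hL (x := x) (y := c t) fun y hy => by
        obtain ⟨t', ht', rfl⟩ := hsegc t ht y hy
        exact hpos t' ⟨ht'.1, ht'.2.trans_lt ht.2⟩
    have h2 := mul_le_mul_of_nonneg_left (hnorm t ht) hL0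
    have h3 := abs_sub_abs_le_abs_sub (coefB φ d x) (coefB φ d (c t))
    rw [abs_sub_comm] at h3
    linarith
  -- Half of the gap is used so that the set is open and still contains the path before time `s`. On
  -- it the gradient of `log φ` is bounded by `M / (b / 2)`.
  set G := posSet Ω φ ∩ {y | b / 2 < |coefB φ d y|} with hG
  have hGo : IsOpen G :=
    (h.locallyLipschitzOn_coefB.continuousOn.abs).isOpen_inter_preimage (h.isOpen_posSet hΩ)
      isOpen_Ioi
  have hlogb : ∀ᵐ y : Pt n, y ∈ G → ‖fderiv ℝ (fun x => Real.log (φ x)) y‖ ≤ M / (b / 2) := by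
    filter_upwards [hM] with y hy hyG
    rw [le_div_iff₀ (by positivity), mul_comm]
    exact (mul_le_mul_of_nonneg_right (le_of_lt hyG.2) (norm_nonneg _)).trans (hy hyG.1)
  have hlog : ∀ t ∈ Ico 0 s, Real.exp (Real.log (φ x) - M / (b / 2) * ‖z - x‖) ≤ φ (c t) := by
    intro t ht
    have h1 := abs_sub_le_of_segment_subset volume hGo
      (h.locallyLipschitzOn_log.mono inter_subset_left) hlogb (x := x) (y := c t) fun y hy => by
        obtain ⟨t', ht', rfl⟩ := hsegc t ht y hy
        have ht'' : t' ∈ Ico 0 s := ⟨ht'.1, ht'.2.trans_lt ht.2⟩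
        exact ⟨hpos t' ht'', show b / 2 < _ by linarith [hBlow t' ht'']⟩
    have h2 := mul_le_mul_of_nonneg_left (hnorm t ht) (by positivity : 0 ≤ M / (b / 2))
    rw [← Real.exp_log (hpos t ht).2]
    refine Real.exp_le_exp.mpr ?_
    linarith [neg_abs_le (Real.log (φ (c t)) - Real.log (φ x))]
  -- The lower bound for `φ` does not depend on `t`, so it passes to the limit and contradicts `φ (c
  -- s) = 0`.
  have htend : Tendsto (fun t => φ (c t)) (𝓝[Ico 0 s] s) (𝓝 (φ (c s))) :=
    (hφc s hZm.1).mono_left (nhdsWithin_mono _ fun t ht => ⟨ht.1, ht.2.le.trans hZm.1.2⟩)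
  have : (𝓝[Ico 0 s] s).NeBot := by
    rw [← mem_closure_iff_nhdsWithin_neBot, closure_Ico hs0.ne]
    exact right_mem_Icc.mpr hs0.le
  have hfin := ge_of_tendsto htend (eventually_nhdsWithin_of_forall hlog)
  rw [show φ (c s) = 0 from hZm.2] at hfin
  exact absurd hfin (not_le.mpr (Real.exp_pos _))

/-- `φ^{-1/2} d` is Lipschitz, with one constant, on the closures of all convex subsets
of the domain. -/
theorem IsAdmissible.exists_lipschitzOnWith (h : IsAdmissible Ω φ d) (hΩ : IsOpen Ω) :
    ∃ L : NNReal, ∀ K : Set (Pt n), Convex ℝ K → (interior K).Nonempty → K ⊆ closure Ω →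
      interior K ⊆ Ω → LipschitzOnWith L (coefB φ d) K := by
  obtain ⟨L, hL0, hL⟩ := h.exists_fderiv_bound hΩ
  refine ⟨⟨L, hL0⟩, fun K hK ⟨p, hp⟩ hKΩ hint => ?_⟩
  have hzero : ∀ x ∈ interior K, ∀ z ∈ K, φ z = 0 → |coefB φ d x| ≤ L * ‖z - x‖ := by
    intro x hx z hz hφz
    refine h.abs_coefB_le_of_zero hΩ hL0 hL (hKΩ hz) hφz fun t ht => hint ?_
    have := hK.combo_interior_self_mem_interior hx hz (a := 1 - t) (b := t)
      (by linarith [ht.2]) ht.1 (by ring)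
    convert this using 1
    simp only [smul_sub, sub_smul, one_smul]; abel
  have hinner : ∀ x ∈ interior K, ∀ y ∈ interior K,
      |coefB φ d x - coefB φ d y| ≤ L * ‖x - y‖ := by
    intro x hx y hy
    by_cases hs : segment ℝ y x ⊆ posSet Ω φ
    · exact abs_sub_le_of_segment_subset volume (h.isOpen_posSet hΩ) h.locallyLipschitzOn_coefB
        hL hs
    -- If the segment meets a zero `z` of `φ`, the two estimates from `x` and from `y` to `z` add
    -- up, since `z` splits the length of the segment.
    · obtain ⟨z, hz, hzn⟩ := not_subset.mp hs
      have hzK : z ∈ interior K := hK.interior.segment_subset hy hx hz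
      have hφz : φ z = 0 := by
        refine le_antisymm ?_ (h.phi_nonneg _ (subset_closure (hint hzK)))
        by_contra hc
        exact hzn ⟨hint hzK, not_le.mp hc⟩
      have h1 := hzero x hx z (interior_subset hzK) hφz
      have h2 := hzero y hy z (interior_subset hzK) hφz
      have h3 := dist_add_dist_of_mem_segment hz
      rw [dist_comm y z, dist_eq_norm, dist_eq_norm, dist_eq_norm, norm_sub_rev y x] at h3
      rw [← h3, mul_add]
      have := abs_sub (coefB φ d x) (coefB φ d y)
      linarith
  -- Values on the boundary of `K` are limits along rays to an interior point: by the estimate at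
  -- zeros where `φ` vanishes, and by continuity of `φ` and `d` elsewhere. The Lipschitz bound on
  -- the interior then carries over to `K`, because the homothety towards `p` contracts distances.
  have htend : ∀ x ∈ K, Tendsto (fun t : ℝ => coefB φ d (x + t • (p - x))) (𝓝[>] 0)
      (𝓝 (coefB φ d x)) := by
    intro x hx
    have hmem : ∀ᶠ t : ℝ in 𝓝[>] 0, x + t • (p - x) ∈ interior K := by
      filter_upwards [Ioc_mem_nhdsGT (zero_lt_one' ℝ)] with t ht
      exact hK.add_smul_sub_mem_interior hx hp ht
    have hc : Tendsto (fun t : ℝ => x + t • (p - x)) (𝓝[>] 0) (𝓝 x) := by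
      have : Continuous fun t : ℝ => x + t • (p - x) := by fun_prop
      simpa using (this.tendsto 0).mono_left (nhdsWithin_le_nhds (s := Ioi 0))
    by_cases hφx : φ x = 0
    · rw [coefB_of_zero hφx, tendsto_zero_iff_abs_tendsto_zero]
      refine squeeze_zero' (Eventually.of_forall fun t => abs_nonneg _)
        (hmem.mono fun t ht => hzero _ ht x hx hφx) ?_
      have : Tendsto (fun t : ℝ => L * ‖x - (x + t • (p - x))‖) (𝓝[>] 0) (𝓝 (L * ‖x - x‖)) :=
        ((tendsto_const_nhds.sub hc).norm).const_mul L
      simpa using this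
    · have hcw : Tendsto (fun t : ℝ => x + t • (p - x)) (𝓝[>] 0) (𝓝[closure Ω] x) :=
        tendsto_nhdsWithin_iff.mpr ⟨hc, hmem.mono fun t ht => subset_closure (hint ht)⟩
      have h1 : Tendsto (fun t : ℝ => φ (x + t • (p - x))) (𝓝[>] 0) (𝓝 (φ x)) :=
        (h.phi_cont x (hKΩ hx)).tendsto.comp hcw
      have h2 : Tendsto (fun t : ℝ => d (x + t • (p - x))) (𝓝[>] 0) (𝓝 (d x)) :=
        (h.d_cont x (hKΩ hx)).tendsto.comp hcw
      exact (h1.rpow_const (Or.inl hφx)).mul h2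
  refine LipschitzOnWith.of_dist_le_mul fun x hx y hy => ?_
  rw [Real.dist_eq, dist_eq_norm]
  refine le_of_tendsto ((htend x hx).sub (htend y hy)).abs ?_
  filter_upwards [Ioc_mem_nhdsGT (zero_lt_one' ℝ)] with t ht
  refine (hinner _ (hK.add_smul_sub_mem_interior hx hp ht) _
    (hK.add_smul_sub_mem_interior hy hp ht)).trans ?_
  refine mul_le_mul_of_nonneg_left ?_ hL0
  rw [show x + t • (p - x) - (y + t • (p - y)) = (1 - t) • (x - y) by
    simp only [smul_sub, sub_smul, one_smul]; abel, norm_smul, Real.norm_of_nonneg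
    (by linarith [ht.2])]
  exact mul_le_of_le_one_left (norm_nonneg _) (by linarith [ht.1])

end

/-! ### Tubes over flat faces and surface measure -/

section
open Set Filter Topology

variable {n : ℕ}

/-- The points reached from `e` along `v` at times in `I`. -/
def sweep (e : Set (Pt n)) (v : Pt n) (I : Set ℝ) : Set (Pt n) :=
  {x | ∃ s ∈ I, ∃ y ∈ e, x = y + s • v}

/-- Oblique coordinates: a hyperplane and a transversal direction. -/
def oblique (p ν v : Pt n) (q : ℝ × (ℝ ∙ ν)ᗮ) : Pt n := p + q.2 + q.1 • v

theorem injective_oblique (p : Pt n) {ν v : Pt n} (hc : inner ℝ ν v ≠ 0) :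
    Function.Injective (oblique p ν v) := by
  rintro ⟨s, y⟩ ⟨s', y'⟩ h
  simp only [oblique] at h
  have hy : inner ℝ ν (y : Pt n) = 0 := Submodule.mem_orthogonal_singleton_iff_inner_right.mp y.2
  have hy' : inner ℝ ν (y' : Pt n) = 0 := Submodule.mem_orthogonal_singleton_iff_inner_right.mp y'.2
  have h1 := congrArg (inner ℝ ν) h
  simp only [inner_add_right, inner_smul_right, hy, hy', add_zero] at h1
  have h2 : s = s' := by
    have := add_left_cancel h1
    exact mul_right_cancel₀ hc this
  subst h2
  simp only [add_left_inj, add_right_inj, Subtype.coe_inj] at h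
  rw [h]

theorem continuous_oblique (p ν v : Pt n) : Continuous (oblique p ν v) := by
  unfold oblique; fun_prop

theorem measurableEmbedding_oblique (p : Pt n) {ν v : Pt n} (hc : inner ℝ ν v ≠ 0) :
    MeasurableEmbedding (oblique p ν v) :=
  (continuous_oblique p ν v).measurableEmbedding (injective_oblique p hc)

/-- Splitting `v = c ν + w` with `w ⊥ ν` factors the oblique coordinates into a scaling of the first
variable by `c`, a shear along the hyperplane and the orthogonal decomposition. Only the scaling
changes volume, which gives the density `|c|`. -/
theorem measurePreserving_oblique (p : Pt n) {ν v : Pt n} (hν : ‖ν‖ = 1)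
    (hc : inner ℝ ν v ≠ 0) :
    MeasurePreserving (oblique p ν v)
      ((ENNReal.ofReal |inner ℝ ν v| • (volume : Measure ℝ)).prod
        (volume : Measure (ℝ ∙ ν)ᗮ)) volume := by
  set c := inner ℝ ν v with hcdef
  have hw : v - c • ν ∈ (ℝ ∙ ν)ᗮ := by
    rw [Submodule.mem_orthogonal_singleton_iff_inner_right, inner_sub_right, inner_smul_right,
      real_inner_self_eq_norm_sq, hν]
    simp [hcdef]
  set w : (ℝ ∙ ν)ᗮ := ⟨v - c • ν, hw⟩ with hwdef
  have hscale : MeasurePreserving (fun s : ℝ => c * s) (ENNReal.ofReal |c| • volume) volume :=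
    ⟨by fun_prop, by rw [Measure.map_smul]; exact Real.smul_map_volume_mul_left hc⟩
  have hshear : MeasurePreserving (fun q : ℝ × (ℝ ∙ ν)ᗮ => (c * q.1, q.2 + q.1 • w))
      ((ENNReal.ofReal |c| • (volume : Measure ℝ)).prod volume) (volume.prod volume) := by
    refine hscale.skew_product (g := fun s y => y + s • w) (by fun_prop) ?_
    exact Eventually.of_forall fun s => (measurePreserving_add_right volume (s • w)).map_eq
  have hspan : MeasurePreserving (LinearIsometryEquiv.toSpanUnitSingleton ν hν) volume volume :=
    LinearIsometryEquiv.measurePreserving _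
  have hE := ((ℝ ∙ ν).measurePreserving_measurableEquivProd p).symm
  rw [InnerProductSpace.euclideanHausdorffMeasure_eq_volume] at hE
  have hall := hE.comp ((hspan.prod (MeasurePreserving.id volume)).comp hshear)
  suffices hfun : oblique p ν v = (⇑((ℝ ∙ ν).measurableEquivProd p).symm ∘
      Prod.map (⇑(LinearIsometryEquiv.toSpanUnitSingleton ν hν)) id ∘
        fun q => (c * q.1, q.2 + q.1 • w)) by
    rw [hfun]; exact hall
  funext q
  simp only [oblique, Function.comp_apply, Submodule.measurableEquivProd_symm_apply, Prod.map_apply,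
    LinearIsometryEquiv.toSpanUnitSingleton_apply, id_eq, Submodule.coe_add, Submodule.coe_smul,
    hwdef, vadd_eq_add, smul_sub, smul_smul]
  rw [mul_comm c]
  abel

theorem sweep_eq_image {e : Set (Pt n)} {p ν v : Pt n} (he : ∀ x ∈ e, inner ℝ ν (x - p) = 0)
    (I : Set ℝ) :
    sweep e v I = oblique p ν v '' (I ×ˢ ((fun y : (ℝ ∙ ν)ᗮ => p + (y : Pt n)) ⁻¹' e)) := by
  ext x
  constructor
  · rintro ⟨s, hs, y, hy, rfl⟩
    refine ⟨(s, ⟨y - p, Submodule.mem_orthogonal_singleton_iff_inner_right.mpr (he y hy)⟩),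
      ⟨hs, by simpa using hy⟩, by simp [oblique]⟩
  · rintro ⟨⟨s, y⟩, ⟨hs, hy⟩, rfl⟩
    exact ⟨s, hs, _, hy, rfl⟩

theorem isometry_hyperplane (p ν : Pt n) :
    Isometry fun y : (ℝ ∙ ν)ᗮ => p + (y : Pt n) :=
  (isometry_add_left p).comp isometry_subtype_coe

theorem finrank_hyperplane {ν : Pt n} (hν : ‖ν‖ = 1) :
    Module.finrank ℝ (ℝ ∙ ν)ᗮ = n - 1 := by
  have h1 := (ℝ ∙ ν).finrank_add_finrank_orthogonal
  rw [finrank_span_singleton (by rintro rfl; simp at hν), finrank_euclideanSpace_fin] at h1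
  omega

/-- The parametrization is isometric and the normalized Hausdorff measure on an inner product space
of the same dimension is its volume. Integrals over flat faces therefore become Lebesgue integrals
on `νᗮ`. -/
theorem map_hyperplane (p : Pt n) {ν : Pt n} (hν : ‖ν‖ = 1) :
    (volume : Measure (ℝ ∙ ν)ᗮ).map (fun y : (ℝ ∙ ν)ᗮ => p + (y : Pt n)) =
      (μHE[n - 1] : Measure (Pt n)).restrict (range fun y : (ℝ ∙ ν)ᗮ => p + (y : Pt n)) := by
  rw [← (isometry_hyperplane p ν).map_euclideanHausdorffMeasure, ← finrank_hyperplane hν,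
    InnerProductSpace.euclideanHausdorffMeasure_eq_volume]

theorem subset_range_hyperplane {e : Set (Pt n)} {p ν : Pt n}
    (he : ∀ x ∈ e, inner ℝ ν (x - p) = 0) :
    e ⊆ range fun y : (ℝ ∙ ν)ᗮ => p + (y : Pt n) := fun x hx =>
  ⟨⟨x - p, Submodule.mem_orthogonal_singleton_iff_inner_right.mpr (he x hx)⟩, by simp⟩

theorem faceMeasure_eq {e : Set (Pt n)} {p ν : Pt n} (hν : ‖ν‖ = 1)
    (he : ∀ x ∈ e, inner ℝ ν (x - p) = 0) :
    (μHE[n - 1] : Measure (Pt n)) e =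
      volume ((fun y : (ℝ ∙ ν)ᗮ => p + (y : Pt n)) ⁻¹' e) := by
  have hm : MeasurableEmbedding fun y : (ℝ ∙ ν)ᗮ => p + (y : Pt n) :=
    (isometry_hyperplane p ν).isClosedEmbedding.measurableEmbedding
  rw [← hm.map_apply, map_hyperplane p hν, Measure.restrict_eq_self _ (subset_range_hyperplane he)]

theorem faceIntegral_eq {e : Set (Pt n)} {p ν : Pt n} (hν : ‖ν‖ = 1)
    (he : ∀ x ∈ e, inner ℝ ν (x - p) = 0) (w : Pt n → ℝ) :
    faceIntegral e w = ∫ y in (fun y : (ℝ ∙ ν)ᗮ => p + (y : Pt n)) ⁻¹' e, w (p + y) := by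
  have hm : MeasurableEmbedding fun y : (ℝ ∙ ν)ᗮ => p + (y : Pt n) :=
    (isometry_hyperplane p ν).isClosedEmbedding.measurableEmbedding
  rw [← hm.setIntegral_map, map_hyperplane p hν, Measure.restrict_restrict_of_subset
    (subset_range_hyperplane he), faceIntegral]

/-- For tangential `v` the sweep stays in a hyperplane; for transversal `v` it is, in oblique
coordinates, a product with a null factor. It discards lines in a face direction and lines through
the overlap of two faces. -/
theorem volume_sweep_eq_zero {e : Set (Pt n)} {p ν : Pt n} (hν : ‖ν‖ = 1)
    (he : ∀ x ∈ e, inner ℝ ν (x - p) = 0) {v : Pt n}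
    (h0 : inner ℝ ν v ≠ 0 → (μHE[n - 1] : Measure (Pt n)) e = 0) :
    volume (sweep e v univ) = 0 := by
  by_cases hc : inner ℝ ν v = 0
  · have hsub : sweep e v univ ⊆ (AffineSubspace.mk' p (ℝ ∙ ν)ᗮ : Set (Pt n)) := by
      rintro x ⟨s, -, y, hy, rfl⟩
      rw [SetLike.mem_coe, AffineSubspace.mem_mk', Submodule.mem_orthogonal_singleton_iff_inner_right,
        vsub_eq_sub, add_sub_right_comm, inner_add_right, he y hy, inner_smul_right, hc]
      simp
    refine measure_mono_null hsub (Measure.addHaar_affineSubspace _ _ fun htop => ?_)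
    have h1 := congrArg AffineSubspace.direction htop
    rw [AffineSubspace.direction_mk', AffineSubspace.direction_top, Submodule.orthogonal_eq_top_iff,
      Submodule.span_singleton_eq_bot] at h1
    simp [h1] at hν
  · have h1 := h0 hc
    rw [faceMeasure_eq hν he] at h1
    rw [sweep_eq_image he, ← (measurePreserving_oblique p hν hc).measure_preimage_emb
      (measurableEmbedding_oblique p hc), (injective_oblique p hc).preimage_image,
      Measure.prod_prod, h1, mul_zero]

/-- The flux through a flat face is the limit of the integrals over thin tubes. -/
theorem tendsto_integral_sweep {e : Set (Pt n)} (hec : IsCompact e) {p ν : Pt n} (hν : ‖ν‖ = 1)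
    (he : ∀ x ∈ e, inner ℝ ν (x - p) = 0) {v : Pt n} (hc : inner ℝ ν v ≠ 0)
    {w : Pt n → ℝ} {C : NNReal} (hw : LipschitzWith C w) {I : ℝ → Set ℝ}
    (hIt : ∀ t, I t ⊆ Icc 0 t)
    (hvol : ∀ t, volume (I t) = ENNReal.ofReal t) :
    Tendsto (fun t : ℝ => t⁻¹ * ∫ x in sweep e v (I t), w x) (𝓝[>] 0)
      (𝓝 (|inner ℝ ν v| * faceIntegral e w)) := by
  set c := inner ℝ ν v with hcdef
  set A := (fun y : (ℝ ∙ ν)ᗮ => p + (y : Pt n)) ⁻¹' e with hA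
  have hAc : IsCompact A := (isometry_hyperplane p ν).isClosedEmbedding.isCompact_preimage hec
  have hAfin : volume A ≠ ⊤ := hAc.measure_lt_top.ne
  have key : ∀ t > 0, ∫ x in sweep e v (I t), w x =
      |c| * ∫ q in I t ×ˢ A, w (oblique p ν v q) ∂((volume : Measure ℝ).prod volume) := by
    intro t ht
    rw [sweep_eq_image he, ← (measurePreserving_oblique p hν hc).setIntegral_preimage_emb
      (measurableEmbedding_oblique p hc), (injective_oblique p hc).preimage_image,
      Measure.prod_smul_left, Measure.restrict_smul, integral_smul_measure, smul_eq_mul,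
      ENNReal.toReal_ofReal (abs_nonneg _)]
  have key2 : ∀ t > 0, ∫ q in I t ×ˢ A, w (p + (q.2 : Pt n)) ∂((volume : Measure ℝ).prod volume)
      = t * faceIntegral e w := by
    intro t ht
    have := setIntegral_prod_mul (μ := (volume : Measure ℝ)) (ν := (volume : Measure (ℝ ∙ ν)ᗮ))
      (fun _ => (1 : ℝ)) (fun y : (ℝ ∙ ν)ᗮ => w (p + (y : Pt n))) (I t) A
    simp only [one_mul] at this
    rw [this, faceIntegral_eq hν he]
    simp [Measure.real, hvol, ENNReal.toReal_ofReal ht.le, hA]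
  have hmeas : ∀ t > 0, ((volume : Measure ℝ).prod (volume : Measure (ℝ ∙ ν)ᗮ)) (I t ×ˢ A)
      = ENNReal.ofReal t * volume A := by
    intro t ht; rw [Measure.prod_prod, hvol]
  -- Within the tube `w` differs by at most `C t ‖v‖` from its value at the foot point, and the tube
  -- has volume `|c| t` times the area of the face. After division by `t` the error is of order `t`.
  have hbound : ∀ t > 0, |t⁻¹ * (∫ x in sweep e v (I t), w x) - |c| * faceIntegral e w|
      ≤ |c| * (C * ‖v‖ * (volume A).toReal) * t := by
    intro t ht
    have hcomp : IsCompact (Icc 0 t ×ˢ A) := isCompact_Icc.prod hAc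
    have hsub : I t ×ˢ A ⊆ Icc 0 t ×ˢ A := prod_mono (hIt t) subset_rfl
    have hwc := hw.continuous
    have hob := continuous_oblique p ν v
    have hi1 : IntegrableOn (fun q => w (oblique p ν v q)) (I t ×ˢ A)
        ((volume : Measure ℝ).prod volume) :=
      ((hwc.comp hob).continuousOn.integrableOn_compact hcomp).mono_set hsub
    have hi2 : IntegrableOn (fun q : ℝ × (ℝ ∙ ν)ᗮ => w (p + (q.2 : Pt n))) (I t ×ˢ A)
        ((volume : Measure ℝ).prod volume) := by
      refine (ContinuousOn.integrableOn_compact hcomp ?_).mono_set hsub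
      fun_prop
    have hdiff : |(∫ q in I t ×ˢ A, w (oblique p ν v q) ∂((volume : Measure ℝ).prod volume))
        - t * faceIntegral e w| ≤ C * (t * ‖v‖) * (t * (volume A).toReal) := by
      rw [← key2 t ht, ← integral_sub hi1 hi2]
      have hfin : ((volume : Measure ℝ).prod (volume : Measure (ℝ ∙ ν)ᗮ)) (I t ×ˢ A) < ⊤ := by
        rw [hmeas t ht]; exact ENNReal.mul_lt_top ENNReal.ofReal_lt_top hAfin.lt_top
      have := norm_setIntegral_le_of_norm_le_const (C := C * (t * ‖v‖)) hfin
        (f := fun q : ℝ × (ℝ ∙ ν)ᗮ => w (oblique p ν v q) - w (p + (q.2 : Pt n)))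
        fun q hq => by
          refine (hw.norm_sub_le _ _).trans ?_
          refine mul_le_mul_of_nonneg_left ?_ C.2
          have hq1 := hIt t hq.1
          simp only [oblique, add_sub_cancel_left, norm_smul, Real.norm_of_nonneg hq1.1]
          exact mul_le_mul_of_nonneg_right hq1.2 (norm_nonneg _)
      rw [Real.norm_eq_abs] at this
      refine this.trans (le_of_eq ?_)
      rw [Measure.real, hmeas t ht, ENNReal.toReal_mul, ENNReal.toReal_ofReal ht.le]
    rw [key t ht, show t⁻¹ * (|c| * ∫ q in I t ×ˢ A, w (oblique p ν v q)
        ∂((volume : Measure ℝ).prod volume)) - |c| * faceIntegral e w = |c| * t⁻¹ *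
        ((∫ q in I t ×ˢ A, w (oblique p ν v q) ∂((volume : Measure ℝ).prod volume))
        - t * faceIntegral e w) by field_simp, abs_mul, abs_mul, abs_abs, abs_of_pos
        (inv_pos.mpr ht)]
    calc |c| * t⁻¹ * _ ≤ |c| * t⁻¹ * (C * (t * ‖v‖) * (t * (volume A).toReal)) :=
          mul_le_mul_of_nonneg_left hdiff (by positivity)
      _ = _ := by field_simp
  rw [tendsto_iff_dist_tendsto_zero]
  have hlim : Tendsto (fun t : ℝ => |c| * (C * ‖v‖ * (volume A).toReal) * t) (𝓝[>] 0) (𝓝 0) := by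
    have : Continuous fun t : ℝ => |c| * (C * ‖v‖ * (volume A).toReal) * t := by fun_prop
    simpa using (this.tendsto 0).mono_left (nhdsWithin_le_nhds (s := Ioi 0))
  refine squeeze_zero' (Eventually.of_forall fun _ => dist_nonneg) ?_ hlim
  filter_upwards [self_mem_nhdsWithin] with t ht
  rw [Real.dist_eq]
  exact hbound t ht

end

/-! ### The divergence theorem on convex bodies with flat faces -/

section
open Set Filter Topology

variable {n : ℕ}

theorem IsOutwardNormal.inner_eq_zero {K e : Set (Pt n)} {ν : Pt n} (h : IsOutwardNormal K e ν)
    (heK : e ⊆ K) {p : Pt n} (hp : p ∈ e) : ∀ x ∈ e, inner ℝ ν (x - p) = 0 := by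
  intro x hx
  refine le_antisymm (h.2 p hp x (heK hx)) ?_
  have := h.2 x hx p (heK hp)
  rw [← neg_sub, inner_neg_right] at this
  linarith

theorem measurableSet_sweep {e : Set (Pt n)} (he : IsCompact e) {p ν v : Pt n}
    (hflat : ∀ x ∈ e, inner ℝ ν (x - p) = 0) (hc : inner ℝ ν v ≠ 0) {I : Set ℝ}
    (hI : MeasurableSet I) : MeasurableSet (sweep e v I) := by
  rw [sweep_eq_image hflat, (measurableEmbedding_oblique p hc).measurableSet_image]
  exact hI.prod ((isometry_hyperplane p ν).continuous.measurable he.measurableSet)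

/-- Almost every line in a given direction that meets a convex body meets its interior. -/
theorem volume_tangent_lines {K : Set (Pt n)} (hK : Convex ℝ K) (hKi : (interior K).Nonempty)
    (v : Pt n) :
    volume {x | (∃ s : ℝ, x + s • v ∈ K) ∧ ¬ ∃ s : ℝ, x + s • v ∈ interior K} = 0 := by
  -- The union of the lines through the interior is convex, so its frontier is null. A line that
  -- meets `K` lies in the closure of this union, because `K` lies in the closure of its interior.
  set U := {x : Pt n | ∃ s : ℝ, x + s • v ∈ interior K} with hU
  have hUc : Convex ℝ U := by
    rintro x ⟨s, hs⟩ y ⟨r, hr⟩ a b ha hb hab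
    refine ⟨a * s + b * r, ?_⟩
    have := hK.interior hs hr ha hb hab
    convert this using 1
    simp only [smul_add, add_smul, smul_smul]; abel
  refine measure_mono_null ?_ (hUc.addHaar_frontier volume)
  rintro x ⟨⟨s, hs⟩, hx⟩
  refine ⟨?_, fun hxi => hx (show x ∈ U from interior_subset hxi)⟩
  have h1 : x + s • v ∈ closure (interior K) := by
    rw [hK.closure_interior_eq_closure_of_nonempty_interior hKi]; exact subset_closure hs
  have h2 : x ∈ closure ((Homeomorph.addRight (s • v)) ⁻¹' interior K) := by
    rw [← Homeomorph.preimage_closure]; exact h1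
  exact closure_mono (fun y hy => show y ∈ U from ⟨s, hy⟩) h2

theorem indicator_sum_eq {X ι : Type*} {F : Finset ι} {T : ι → Set X} {x : X} {P : Prop}
    [Decidable P] {j : ι} (hj : j ∈ F) (h : ∀ i ∈ F, x ∈ T i ↔ (P ∧ i = j)) :
    ∑ i ∈ F, (T i).indicator (fun _ => (1 : ℝ)) x = if P then 1 else 0 := by
  classical
  rw [Finset.sum_eq_single j]
  · by_cases hP : P
    · rw [if_pos hP, indicator_of_mem ((h j hj).mpr ⟨hP, rfl⟩)]
    · rw [if_neg hP, indicator_of_notMem fun hh => hP ((h j hj).mp hh).1]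
  · intro i hi hij
    exact indicator_of_notMem (fun hh => hij ((h i hi).mp hh).2) _
  · exact fun hh => absurd hj hh

/-- Translating a convex body sweeps out the tubes over the faces that look forward, and leaves
the tubes over the faces that look backward. -/
theorem indicator_translate_ae {K : Set (Pt n)} (hK : Convex ℝ K) (hKc : IsCompact K)
    (hKi : (interior K).Nonempty) {ι : Type*} {F : Finset ι} {e : ι → Set (Pt n)}
    {ν : ι → Pt n} (heK : ∀ i ∈ F, e i ⊆ K) (hν : ∀ i ∈ F, IsOutwardNormal K (e i) (ν i))
    (hcov : frontier K ⊆ ⋃ i ∈ F, e i)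
    (hnull : ∀ i ∈ F, ∀ j ∈ F, i ≠ j → (μHE[n - 1] : Measure (Pt n)) (e i ∩ e j) = 0)
    {v : Pt n} (hv : v ≠ 0) {t : ℝ} (ht : 0 < t) :
    ∀ᵐ x : Pt n, K.indicator (fun _ => (1 : ℝ)) (x - t • v) +
        ∑ i ∈ F with inner ℝ (ν i) v < 0, (sweep (e i) v (Ico 0 t)).indicator (fun _ => (1 : ℝ)) x
      = K.indicator (fun _ => (1 : ℝ)) x +
        ∑ i ∈ F with 0 < inner ℝ (ν i) v,
          (sweep (e i) v (Ioc 0 t)).indicator (fun _ => (1 : ℝ)) x := by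
  classical
  have h1 : ∀ᵐ x : Pt n, ¬ ((∃ s : ℝ, x + s • v ∈ K) ∧ ¬ ∃ s : ℝ, x + s • v ∈ interior K) := by
    rw [MeasureTheory.ae_iff]; simpa using volume_tangent_lines hK hKi v
  have h2 : ∀ i ∈ F, ∀ᵐ x : Pt n, inner ℝ (ν i) v = 0 → x ∉ sweep (e i) v univ := by
    intro i hi
    by_cases hc : inner ℝ (ν i) v = 0
    · rcases (e i).eq_empty_or_nonempty with he | ⟨p, hp⟩
      · simp [sweep, he]
      · have := volume_sweep_eq_zero (hν i hi).1 ((hν i hi).inner_eq_zero (heK i hi) hp)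
          (v := v) (fun h => absurd hc h)
        filter_upwards [measure_eq_zero_iff_ae_notMem.mp this] with x hx _ using hx
    · exact Eventually.of_forall fun x h => absurd h hc
  have h3 : ∀ i ∈ F, ∀ j ∈ F, ∀ᵐ x : Pt n, i ≠ j → x ∉ sweep (e i ∩ e j) v univ := by
    intro i hi j hj
    by_cases hij : i = j
    · exact Eventually.of_forall fun x h => absurd hij h
    · rcases (e i ∩ e j).eq_empty_or_nonempty with he | ⟨p, hp⟩
      · simp [sweep, he]
      · have := volume_sweep_eq_zero (e := e i ∩ e j) (hν i hi).1
          (fun x hx => (hν i hi).inner_eq_zero (heK i hi) hp.1 x hx.1)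
          (v := v) (fun _ => hnull i hi j hj hij)
        filter_upwards [measure_eq_zero_iff_ae_notMem.mp this] with x hx _ using hx
  have h2' := (Filter.eventually_all_finset F).mpr h2
  have h3' := (Filter.eventually_all_finset F).mpr
    fun i hi => (Filter.eventually_all_finset F).mpr (h3 i hi)
  -- Three kinds of lines have been excluded: those touching `K` without entering its interior,
  -- those through a face parallel to `v`, and those through the overlap of two faces.
  filter_upwards [h1, h2', h3'] with x hx1 hx2 hx3
  set g : ℝ → Pt n := fun s => x + s • v with hg
  have hgc : Continuous g := by fun_prop
  have hmem : ∀ (i : ι) (I : Set ℝ), x ∈ sweep (e i) v I ↔ ∃ s ∈ I, g (-s) ∈ e i := by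
    intro i I
    constructor
    · rintro ⟨s, hs, y, hy, hxy⟩
      exact ⟨s, hs, by simpa [hg, hxy] using hy⟩
    · rintro ⟨s, hs, hy⟩
      exact ⟨s, hs, _, hy, by simp [hg]⟩
  set J := g ⁻¹' K with hJ
  have hgt : x - t • v = g (-t) := by simp [hg, sub_eq_add_neg]
  have hg0 : x = g 0 := by simp [hg]
  by_cases hJe : J.Nonempty
  swap
  · have hno : ∀ s, g s ∉ K := fun s hs => hJe ⟨s, hs⟩
    have hno' : ∀ i ∈ F, ∀ I, x ∉ sweep (e i) v I := by
      intro i hi I hx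
      obtain ⟨s, -, hs⟩ := (hmem i I).mp hx
      exact hno _ (heK i hi hs)
    rw [hgt, indicator_of_notMem (hno _), indicator_of_notMem (by rw [hg0]; exact hno 0),
      Finset.sum_eq_zero, Finset.sum_eq_zero]
    · exact fun i hi => indicator_of_notMem (hno' i (Finset.mem_filter.mp hi).1 _) _
    · exact fun i hi => indicator_of_notMem (hno' i (Finset.mem_filter.mp hi).1 _) _
  have hgemb : Topology.IsClosedEmbedding g :=
    (Homeomorph.addLeft x).isClosedEmbedding.comp (isClosedEmbedding_smul_left hv)
  have hJc : IsCompact J := hgemb.isCompact_preimage hKc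
  have hJconv : Convex ℝ J := by
    intro s hs r hr a b ha hb hab
    have := hK hs hr ha hb hab
    simp only [hJ, mem_preimage]
    convert this using 1
    simp only [hg, smul_add, smul_smul, smul_eq_mul, add_smul]
    nth_rewrite 1 [← one_smul ℝ x]
    rw [← hab, add_smul]; abel
  -- Every remaining line that meets `K` does so in a nondegenerate chord with parameters from `b`
  -- to `a`. It leaves through exactly one forward face, at `a`, and enters through exactly one
  -- backward face, at `b`.
  set a := sSup J with ha
  set b := sInf J with hb
  have haJ : a ∈ J := hJc.sSup_mem hJe
  have hbJ : b ∈ J := hJc.sInf_mem hJe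
  have hJI : ∀ s, g s ∈ K ↔ b ≤ s ∧ s ≤ a := fun s =>
    ⟨fun hs => ⟨csInf_le hJc.bddBelow hs, le_csSup hJc.bddAbove hs⟩,
      fun hs => hJconv.ordConnected.out hbJ haJ hs⟩
  obtain ⟨s₀, hs₀⟩ : ∃ s : ℝ, g s ∈ interior K := by
    by_contra hno
    exact hx1 ⟨hJe, hno⟩
  have hwiggle : ∀ s, g s ∈ interior K → s < a ∧ b < s := by
    intro s hs
    have hJo : g ⁻¹' interior K ∈ 𝓝 s := (isOpen_interior.preimage hgc).mem_nhds hs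
    obtain ⟨δ, hδ, hball⟩ := Metric.mem_nhds_iff.mp hJo
    have h5 : g (s + δ / 2) ∈ interior K := by
      refine hball ?_
      rw [Metric.mem_ball, Real.dist_eq, add_sub_cancel_left, abs_of_pos (half_pos hδ)]
      linarith
    have h6 : g (s - δ / 2) ∈ interior K := by
      refine hball ?_
      rw [Metric.mem_ball, Real.dist_eq, sub_sub_cancel_left, abs_neg, abs_of_pos (half_pos hδ)]
      linarith
    have h7 := ((hJI _).mp (interior_subset h5)).2
    have h8 := ((hJI _).mp (interior_subset h6)).1
    constructor <;> linarith
  have hba : b < a := (hwiggle s₀ hs₀).2.trans (hwiggle s₀ hs₀).1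
  have hface : ∀ s, g s ∈ K → g s ∉ interior K → ∃ i ∈ F, g s ∈ e i := by
    intro s hs hsn
    have := hcov (show g s ∈ frontier K from ⟨subset_closure hs, hsn⟩)
    simpa using this
  obtain ⟨ia, hia, hia'⟩ := hface a haJ fun h => lt_irrefl _ (hwiggle a h).1
  obtain ⟨ib, hib, hib'⟩ := hface b hbJ fun h => lt_irrefl _ (hwiggle b h).2
  have hsw : ∀ s (S : Set (Pt n)), g s ∈ S → x ∈ sweep S v univ := fun s S hs =>
    ⟨-s, trivial, g s, hs, by simp [hg]⟩
  have huniq : ∀ i ∈ F, ∀ j ∈ F, ∀ s, g s ∈ e i → g s ∈ e j → i = j := by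
    intro i hi j hj s h5 h6
    by_contra hij
    exact hx3 i hi j hj hij (hsw s _ ⟨h5, h6⟩)
  have hne : ∀ i ∈ F, ∀ s, g s ∈ e i → inner ℝ (ν i) v ≠ 0 := fun i hi s hs h0 =>
    hx2 i hi h0 (hsw s _ hs)
  have hdir : ∀ i ∈ F, ∀ s, g s ∈ e i → ∀ r, g r ∈ K → (r - s) * inner ℝ (ν i) v ≤ 0 := by
    intro i hi s hs r hr
    have := (hν i hi).2 _ hs _ hr
    rwa [show g r - g s = (r - s) • v by simp only [hg, sub_smul]; abel, inner_smul_right] at this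
  have hca : 0 < inner ℝ (ν ia) v := by
    have h5 := hdir ia hia a hia' b hbJ
    have h6 := hne ia hia a hia'
    rcases lt_or_gt_of_ne h6 with h7 | h7
    · nlinarith
    · exact h7
  have hcb : inner ℝ (ν ib) v < 0 := by
    have h5 := hdir ib hib b hib' a haJ
    have h6 := hne ib hib b hib'
    rcases lt_or_gt_of_ne h6 with h7 | h7
    · exact h7
    · nlinarith
  have htop : ∀ i ∈ F, 0 < inner ℝ (ν i) v → ∀ s, g s ∈ e i → s = a ∧ i = ia := by
    intro i hi hc s hs
    have h5 := hdir i hi s hs a haJ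
    have h6 := ((hJI s).mp (heK i hi hs)).2
    have h7 : s = a := by nlinarith
    subst h7
    exact ⟨rfl, huniq i hi ia hia _ hs hia'⟩
  have hbot : ∀ i ∈ F, inner ℝ (ν i) v < 0 → ∀ s, g s ∈ e i → s = b ∧ i = ib := by
    intro i hi hc s hs
    have h5 := hdir i hi s hs b hbJ
    have h6 := ((hJI s).mp (heK i hi hs)).1
    have h7 : s = b := by nlinarith
    subst h7
    exact ⟨rfl, huniq i hi ib hib _ hs hib'⟩
  -- Both sides now count whether the chord `[b, a]` meets `[-t, 0]`. The half-open intervals, `[0,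
  -- t)` for backward and `(0, t]` for forward tubes, make the count exact, without double counting
  -- at end points.
  rw [indicator_sum_eq (P := -t < b ∧ b ≤ 0) (j := ib) (Finset.mem_filter.mpr ⟨hib, hcb⟩),
    indicator_sum_eq (P := -t ≤ a ∧ a < 0) (j := ia) (Finset.mem_filter.mpr ⟨hia, hca⟩)]
  · rw [hgt]
    have hx0 := hJI 0
    rw [← hg0] at hx0
    simp only [indicator_apply, hJI, hx0]
    split_ifs <;> grind
  · intro i hi
    rw [Finset.mem_filter] at hi
    rw [hmem]
    constructor
    · rintro ⟨s, hs, hsi⟩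
      obtain ⟨h5, h6⟩ := htop i hi.1 hi.2 _ hsi
      exact ⟨⟨by linarith [hs.2], by linarith [hs.1]⟩, h6⟩
    · rintro ⟨hs, rfl⟩
      exact ⟨-a, ⟨by linarith [hs.2], by linarith [hs.1]⟩, by rwa [neg_neg]⟩
  · intro i hi
    rw [Finset.mem_filter] at hi
    rw [hmem]
    constructor
    · rintro ⟨s, hs, hsi⟩
      obtain ⟨h5, h6⟩ := hbot i hi.1 hi.2 _ hsi
      exact ⟨⟨by linarith [hs.2], by linarith [hs.1]⟩, h6⟩
    · rintro ⟨hs, rfl⟩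
      exact ⟨-b, ⟨by linarith [hs.2], by linarith [hs.1]⟩, by rwa [neg_neg]⟩

/-- The divergence theorem on a convex body with flat faces. -/
theorem integral_lineDeriv_eq_sum_faces {K : Set (Pt n)} (hK : Convex ℝ K) (hKc : IsCompact K)
    (hKi : (interior K).Nonempty) {ι : Type*} {F : Finset ι} {e : ι → Set (Pt n)}
    {ν : ι → Pt n} (hec : ∀ i ∈ F, IsCompact (e i)) (heK : ∀ i ∈ F, e i ⊆ K)
    (hν : ∀ i ∈ F, IsOutwardNormal K (e i) (ν i)) (hcov : frontier K ⊆ ⋃ i ∈ F, e i)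
    (hnull : ∀ i ∈ F, ∀ j ∈ F, i ≠ j → (μHE[n - 1] : Measure (Pt n)) (e i ∩ e j) = 0)
    {w : Pt n → ℝ} {C : NNReal} (hw : LipschitzWith C w) (v : Pt n) :
    ∫ x in K, lineDeriv ℝ w x v = ∑ i ∈ F, inner ℝ (ν i) v * faceIntegral (e i) w := by
  classical
  rcases eq_or_ne v 0 with rfl | hv
  · simp [lineDeriv]
  have hwc := hw.continuous
  have hmK := hKc.measurableSet
  set ind : Set (Pt n) → Pt n → ℝ := fun S => S.indicator fun _ => (1 : ℝ) with hind
  have hindK : Integrable (ind K) := by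
    rw [hind, integrable_indicator_iff hmK]
    exact integrableOn_const hKc.measure_lt_top.ne
  have hmul : ∀ S : Set (Pt n), MeasurableSet S → ∫ x, w x * ind S x = ∫ x in S, w x := by
    intro S hS
    rw [← integral_indicator hS]
    congr 1; ext x
    by_cases hx : x ∈ S <;> simp [hind, hx]
  -- The integral of the directional derivative is a limit of difference quotients. By a change of
  -- variables the shift moves from `w` to the indicator of `K`, where it is described by tubes.
  have hlim1 := hw.integral_inv_smul_sub_mul_tendsto_integral_lineDeriv_mul (μ := volume) hindK v
  have hlhs : ∫ x, lineDeriv ℝ w x v * ind K x = ∫ x in K, lineDeriv ℝ w x v := by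
    rw [← integral_indicator hmK]
    congr 1; ext x
    by_cases hx : x ∈ K <;> simp [hind, hx]
  rw [hlhs] at hlim1
  refine tendsto_nhds_unique hlim1 ?_
  have hflat : ∀ i ∈ F, ∃ p, ∀ x ∈ e i, inner ℝ (ν i) (x - p) = 0 := by
    intro i hi
    rcases (e i).eq_empty_or_nonempty with he | ⟨p, hp⟩
    · exact ⟨0, by simp [he]⟩
    · exact ⟨p, (hν i hi).inner_eq_zero (heK i hi) hp⟩
  have hsweepm : ∀ i ∈ F, inner ℝ (ν i) v ≠ 0 → ∀ I : Set ℝ, MeasurableSet I →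
      MeasurableSet (sweep (e i) v I) := by
    intro i hi hc I hI
    obtain ⟨p, hp⟩ := hflat i hi
    exact measurableSet_sweep (hec i hi) hp hc hI
  have hsweepi : ∀ i ∈ F, inner ℝ (ν i) v ≠ 0 → ∀ (t : ℝ) (I : Set ℝ), MeasurableSet I →
      I ⊆ Icc 0 t → Integrable fun x => w x * ind (sweep (e i) v I) x := by
    intro i hi hc t I hI hIt
    have hcomp : IsCompact ((fun q : Pt n × ℝ => q.1 + q.2 • v) '' (e i ×ˢ Icc 0 t)) :=
      ((hec i hi).prod isCompact_Icc).image (by fun_prop)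
    have hsub : sweep (e i) v I ⊆ (fun q : Pt n × ℝ => q.1 + q.2 • v) '' (e i ×ˢ Icc 0 t) := by
      rintro x ⟨s, hs, y, hy, rfl⟩
      exact ⟨(y, s), ⟨hy, hIt hs⟩, rfl⟩
    have h1 : IntegrableOn w (sweep (e i) v I) :=
      (hwc.continuousOn.integrableOn_compact hcomp).mono_set hsub
    rw [← integrable_indicator_iff (hsweepm i hi hc I hI)] at h1
    refine h1.congr (Eventually.of_forall fun x => ?_)
    by_cases hx : x ∈ sweep (e i) v I <;> simp [hind, hx]
  have hwK : Integrable fun x => w x * ind K x := by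
    have h1 : IntegrableOn w K := hwc.continuousOn.integrableOn_compact hKc
    rw [← integrable_indicator_iff hmK] at h1
    refine h1.congr (Eventually.of_forall fun x => ?_)
    by_cases hx : x ∈ K <;> simp [hind, hx]
  have hwKt : ∀ t : ℝ, Integrable fun x => w (x + t • v) * ind K x := by
    intro t
    have h1 : IntegrableOn (fun x => w (x + t • v)) K :=
      ContinuousOn.integrableOn_compact hKc (by fun_prop)
    rw [← integrable_indicator_iff hmK] at h1
    refine h1.congr (Eventually.of_forall fun x => ?_)
    by_cases hx : x ∈ K <;> simp [hind, hx]
  have hIco : ∀ t : ℝ, (Ico 0 t : Set ℝ) ⊆ Icc 0 t := fun t => Ico_subset_Icc_self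
  have hIoc : ∀ t : ℝ, (Ioc 0 t : Set ℝ) ⊆ Icc 0 t := fun t => Ioc_subset_Icc_self
  have key : ∀ t > 0, ∫ x, t⁻¹ • (w (x + t • v) - w x) * ind K x =
      ∑ i ∈ F with 0 < inner ℝ (ν i) v, t⁻¹ * (∫ x in sweep (e i) v (Ioc 0 t), w x)
      - ∑ i ∈ F with inner ℝ (ν i) v < 0, t⁻¹ * ∫ x in sweep (e i) v (Ico 0 t), w x := by
    intro t ht
    have h1 : ∫ x, t⁻¹ • (w (x + t • v) - w x) * ind K x
        = t⁻¹ * ((∫ x, w x * ind K (x - t • v)) - ∫ x, w x * ind K x) := by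
      have h2 : ∫ x, w x * ind K (x - t • v) = ∫ x, w (x + t • v) * ind K x := by
        rw [← integral_add_right_eq_self (fun x => w x * ind K (x - t • v)) (t • v)]
        simp
      rw [h2, ← integral_sub (hwKt t) hwK, ← integral_const_mul]
      congr 1; ext x
      simp only [smul_eq_mul]; ring
    have h3 : Integrable fun x => w x * ind K (x - t • v) := by
      have := (hwKt t).comp_sub_right (t • v)
      simpa using this
    have h4 : (∫ x, w x * ind K (x - t • v)) +
        ∑ i ∈ F with inner ℝ (ν i) v < 0, ∫ x, w x * ind (sweep (e i) v (Ico 0 t)) x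
        = (∫ x, w x * ind K x) +
        ∑ i ∈ F with 0 < inner ℝ (ν i) v, ∫ x, w x * ind (sweep (e i) v (Ioc 0 t)) x := by
      have hi1 : ∀ i ∈ {i ∈ F | inner ℝ (ν i) v < 0},
          Integrable fun x => w x * ind (sweep (e i) v (Ico 0 t)) x := fun i hi =>
        hsweepi i (Finset.mem_filter.mp hi).1 (Finset.mem_filter.mp hi).2.ne t _ measurableSet_Ico
          (hIco t)
      have hi2 : ∀ i ∈ {i ∈ F | 0 < inner ℝ (ν i) v},
          Integrable fun x => w x * ind (sweep (e i) v (Ioc 0 t)) x := fun i hi =>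
        hsweepi i (Finset.mem_filter.mp hi).1 (Finset.mem_filter.mp hi).2.ne' t _
          measurableSet_Ioc (hIoc t)
      rw [← integral_finsetSum _ hi1, ← integral_finsetSum _ hi2, ← integral_add h3
        (integrable_finsetSum _ hi1), ← integral_add hwK (integrable_finsetSum _ hi2)]
      refine integral_congr_ae ?_
      filter_upwards [indicator_translate_ae hK hKc hKi heK hν hcov hnull hv ht] with x hx
      rw [← Finset.mul_sum, ← Finset.mul_sum, ← mul_add, ← mul_add, hx]
    have h5 : ∀ i ∈ {i ∈ F | inner ℝ (ν i) v < 0},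
        ∫ x, w x * ind (sweep (e i) v (Ico 0 t)) x = ∫ x in sweep (e i) v (Ico 0 t), w x :=
      fun i hi => hmul _ (hsweepm i (Finset.mem_filter.mp hi).1 (Finset.mem_filter.mp hi).2.ne _
        measurableSet_Ico)
    have h6 : ∀ i ∈ {i ∈ F | 0 < inner ℝ (ν i) v},
        ∫ x, w x * ind (sweep (e i) v (Ioc 0 t)) x = ∫ x in sweep (e i) v (Ioc 0 t), w x :=
      fun i hi => hmul _ (hsweepm i (Finset.mem_filter.mp hi).1 (Finset.mem_filter.mp hi).2.ne' _
        measurableSet_Ioc)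
    rw [Finset.sum_congr rfl h5, Finset.sum_congr rfl h6] at h4
    rw [h1, ← Finset.mul_sum, ← Finset.mul_sum, ← mul_sub]
    congr 1
    linarith
  have hlim2 : Tendsto (fun t : ℝ =>
      ∑ i ∈ F with 0 < inner ℝ (ν i) v, t⁻¹ * (∫ x in sweep (e i) v (Ioc 0 t), w x)
      - ∑ i ∈ F with inner ℝ (ν i) v < 0, t⁻¹ * ∫ x in sweep (e i) v (Ico 0 t), w x) (𝓝[>] 0)
      (𝓝 (∑ i ∈ F with 0 < inner ℝ (ν i) v, |inner ℝ (ν i) v| * faceIntegral (e i) w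
        - ∑ i ∈ F with inner ℝ (ν i) v < 0, |inner ℝ (ν i) v| * faceIntegral (e i) w)) := by
    refine (tendsto_finsetSum _ fun i hi => ?_).sub (tendsto_finsetSum _ fun i hi => ?_)
    · rw [Finset.mem_filter] at hi
      obtain ⟨p, hp⟩ := hflat i hi.1
      exact tendsto_integral_sweep (hec i hi.1) (hν i hi.1).1 hp hi.2.ne' hw hIoc (by simp)
    · rw [Finset.mem_filter] at hi
      obtain ⟨p, hp⟩ := hflat i hi.1
      exact tendsto_integral_sweep (hec i hi.1) (hν i hi.1).1 hp hi.2.ne hw hIco (by simp)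
  -- The sign of each contribution replaces the absolute value, and faces parallel to `v` contribute
  -- zero to the full sum.
  have hval : ∑ i ∈ F with 0 < inner ℝ (ν i) v, |inner ℝ (ν i) v| * faceIntegral (e i) w
        - ∑ i ∈ F with inner ℝ (ν i) v < 0, |inner ℝ (ν i) v| * faceIntegral (e i) w
      = ∑ i ∈ F, inner ℝ (ν i) v * faceIntegral (e i) w := by
    rw [Finset.sum_filter, Finset.sum_filter, ← Finset.sum_sub_distrib]
    refine Finset.sum_congr rfl fun i _ => ?_
    rcases lt_trichotomy (inner ℝ (ν i) v) 0 with h | h | h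
    · rw [if_neg h.le.not_gt, if_pos h, abs_of_neg h]; ring
    · simp [h]
    · rw [if_pos h, if_neg h.le.not_gt, abs_of_pos h]; ring
  rw [← hval]
  refine hlim2.congr' ?_
  filter_upwards [self_mem_nhdsWithin] with t ht
  exact (key t ht).symm

end

/-! ### Half balls, and how the faces of a mesh overlap -/

section
open Set Filter Topology

variable {n : ℕ}

/-- `K` contains a half ball around `x`, on the side of `ν`. -/
def ContainsHalfBall (K : Set (Pt n)) (ν x : Pt n) : Prop :=
  ∃ ρ > 0, ∀ z, ‖z - x‖ < ρ → 0 ≤ inner ℝ ν (z - x) → z ∈ K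

/-- `S` contains a disc around `x` that is orthogonal to `ν`. -/
def ContainsDisc (S : Set (Pt n)) (ν x : Pt n) : Prop :=
  ∃ r > 0, ∀ z, ‖z - x‖ < r → inner ℝ ν (z - x) = 0 → z ∈ S

theorem ContainsDisc.mono {S S' : Set (Pt n)} {ν x : Pt n} (h : ContainsDisc S ν x)
    (hS : S ⊆ S') : ContainsDisc S' ν x := by
  obtain ⟨r, hr, h⟩ := h
  exact ⟨r, hr, fun z h1 h2 => hS (h z h1 h2)⟩

theorem ContainsDisc.mem {S : Set (Pt n)} {ν x : Pt n} (h : ContainsDisc S ν x) : x ∈ S := by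
  obtain ⟨r, hr, h⟩ := h
  exact h x (by simpa using hr) (by simp)

theorem ContainsDisc.neg {S : Set (Pt n)} {ν x : Pt n} (h : ContainsDisc S ν x) :
    ContainsDisc S (-ν) x := by
  obtain ⟨r, hr, h⟩ := h
  exact ⟨r, hr, fun z h1 h2 => h z h1 (by simpa using h2)⟩

/-- The cone with apex `y` over the disc fills a half ball: a point at small height `a` over the
disc is a convex combination of `y`, with weight `a / h`, and a point of the disc. -/
theorem ContainsDisc.containsHalfBall {K : Set (Pt n)} (hK : Convex ℝ K) {ν x : Pt n}
    (hν : ‖ν‖ = 1) (hD : ContainsDisc K ν x) {y : Pt n} (hy : y ∈ K)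
    (hpos : 0 < inner ℝ ν (y - x)) : ContainsHalfBall K ν x := by
  obtain ⟨r, hr, hD⟩ := hD
  set h := inner ℝ ν (y - x) with hh
  set M := ‖y - x‖ with hM
  have hM0 : 0 ≤ M := norm_nonneg _
  have hq : 0 < 1 + M / h := by positivity
  -- The first bound keeps the weight `s` at most one half, so that `(1 - s)⁻¹ ≤ 2`; the second then
  -- keeps the base point `z'` within distance `r` of `x`.
  refine ⟨min (h / 2) (r / (4 * (1 + M / h))), by positivity, fun z hz ha => ?_⟩
  set a := inner ℝ ν (z - x) with hadef
  have haz : a ≤ ‖z - x‖ := by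
    have := real_inner_le_norm ν (z - x)
    rwa [hν, one_mul] at this
  have hz1 : ‖z - x‖ < h / 2 := hz.trans_le (min_le_left _ _)
  have hz2 : ‖z - x‖ < r / (4 * (1 + M / h)) := hz.trans_le (min_le_right _ _)
  set s := a / h with hs
  have hs0 : 0 ≤ s := by positivity
  have hs1 : s ≤ 1 / 2 := by
    rw [hs, div_le_iff₀ hpos]; linarith
  have h1s : 0 < 1 - s := by linarith
  set z' := x + (1 - s)⁻¹ • ((z - x) - s • (y - x)) with hz'
  have hmem : z' ∈ K := by
    refine hD z' ?_ ?_
    · rw [hz', add_sub_cancel_left, norm_smul, Real.norm_of_nonneg (by positivity)]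
      have h1 : (1 - s)⁻¹ ≤ 2 := by
        rw [inv_le_comm₀ h1s (by norm_num)]; linarith
      have h2 : ‖(z - x) - s • (y - x)‖ ≤ ‖z - x‖ * (1 + M / h) := by
        calc ‖(z - x) - s • (y - x)‖ ≤ ‖z - x‖ + s * M := by
              refine (norm_sub_le _ _).trans ?_
              rw [norm_smul, Real.norm_of_nonneg hs0]
          _ ≤ ‖z - x‖ + ‖z - x‖ / h * M := by
              have : s ≤ ‖z - x‖ / h := div_le_div_of_nonneg_right haz hpos.le
              gcongr
          _ = _ := by ring
      have h3 : ‖z - x‖ * (1 + M / h) < r / 4 := by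
        rw [lt_div_iff₀ (by positivity)] at hz2
        linarith
      calc (1 - s)⁻¹ * ‖(z - x) - s • (y - x)‖ ≤ 2 * (‖z - x‖ * (1 + M / h)) := by gcongr
        _ < r := by linarith
    · rw [hz', add_sub_cancel_left, inner_smul_right, inner_sub_right, inner_smul_right, ← hh,
        ← hadef, hs, div_mul_cancel₀ _ hpos.ne', sub_self, mul_zero]
  have hcomb := hK hmem hy h1s.le hs0 (by ring)
  convert hcomb using 1
  rw [hz', smul_add, smul_smul, mul_inv_cancel₀ h1s.ne', one_smul]
  simp only [sub_smul, smul_sub, one_smul]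
  abel

/-- A body with interior points does not lie in the hyperplane of the disc, so it has a point on one
side that serves as the apex of a cone. -/
theorem ContainsDisc.containsHalfBall_or {K : Set (Pt n)} (hK : Convex ℝ K)
    (hKi : (interior K).Nonempty) {ν x : Pt n} (hν : ‖ν‖ = 1) (hD : ContainsDisc K ν x) :
    ContainsHalfBall K ν x ∨ ContainsHalfBall K (-ν) x := by
  have hex : ∃ y ∈ K, inner ℝ ν (y - x) ≠ 0 := by
    by_contra hno
    push Not at hno
    obtain ⟨p, hp⟩ := hKi
    have hc : Continuous fun t : ℝ => p + t • ν := by fun_prop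
    have h1 : ∀ᶠ t in 𝓝 (0 : ℝ), p + t • ν ∈ interior K :=
      hc.tendsto 0 |>.eventually (by simpa using isOpen_interior.mem_nhds hp)
    obtain ⟨δ, hδ, hb⟩ := Metric.eventually_nhds_iff_ball.mp h1
    have h2 := hno _ (interior_subset (hb (δ / 2) (by
      rw [Metric.mem_ball, Real.dist_eq, sub_zero, abs_of_pos (half_pos hδ)]; linarith)))
    have h3 := hno _ (interior_subset hp)
    rw [add_sub_right_comm, inner_add_right, h3, inner_smul_right, real_inner_self_eq_norm_sq, hν]
      at h2
    linarith
  obtain ⟨y, hy, hne⟩ := hex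
  rcases lt_or_gt_of_ne hne with h | h
  · exact Or.inr (hD.neg.containsHalfBall hK (by rwa [norm_neg]) hy (by
      rw [inner_neg_left]; linarith))
  · exact Or.inl (hD.containsHalfBall hK hν hy h)

theorem ContainsHalfBall.interior_inter_nonempty {K L : Set (Pt n)} {ν x : Pt n} (hν : ‖ν‖ = 1)
    (hK : ContainsHalfBall K ν x) (hL : ContainsHalfBall L ν x) :
    (interior K ∩ interior L).Nonempty := by
  obtain ⟨r, hr, hK⟩ := hK
  obtain ⟨r', hr', hL⟩ := hL
  set m := min r r' with hm
  have hm0 : 0 < m := lt_min hr hr'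
  have hopen : IsOpen {z : Pt n | ‖z - x‖ < m ∧ 0 < inner ℝ ν (z - x)} := by
    have h1 : Continuous fun z : Pt n => ‖z - x‖ := by fun_prop
    have h2 : Continuous fun z : Pt n => inner ℝ ν (z - x) := by fun_prop
    exact (isOpen_lt h1 continuous_const).and (isOpen_lt continuous_const h2)
  have hmem : x + (m / 2) • ν ∈ {z : Pt n | ‖z - x‖ < m ∧ 0 < inner ℝ ν (z - x)} := by
    rw [mem_ofPred_eq, add_sub_cancel_left, norm_smul, inner_smul_right,
      real_inner_self_eq_norm_sq, hν, Real.norm_of_nonneg (by positivity)]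
    constructor <;> linarith
  refine ⟨x + (m / 2) • ν, interior_maximal (fun z hz => ?_) hopen hmem,
    interior_maximal (fun z hz => ?_) hopen hmem⟩
  · exact hK z (hz.1.trans_le (min_le_left _ _)) hz.2.le
  · exact hL z (hz.1.trans_le (min_le_right _ _)) hz.2.le

theorem ContainsHalfBall.mem_interior_union {K L : Set (Pt n)} {ν x : Pt n}
    (hK : ContainsHalfBall K ν x) (hL : ContainsHalfBall L (-ν) x) : x ∈ interior (K ∪ L) := by
  obtain ⟨r, hr, hK⟩ := hK
  obtain ⟨r', hr', hL⟩ := hL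
  rw [mem_interior_iff_mem_nhds]
  refine mem_of_superset (Metric.ball_mem_nhds x (lt_min hr hr')) fun z hz => ?_
  rw [mem_ball_iff_norm] at hz
  rcases le_total 0 (inner ℝ ν (z - x)) with h | h
  · exact Or.inl (hK z (hz.trans_le (min_le_left _ _)) h)
  · exact Or.inr (hL z (hz.trans_le (min_le_right _ _)) (by rw [inner_neg_left]; linarith))

/-- A convex flat set of positive surface measure contains a disc. -/
theorem exists_containsDisc {S : Set (Pt n)} (hS : Convex ℝ S) {p ν : Pt n} (hν : ‖ν‖ = 1)
    (hflat : ∀ x ∈ S, inner ℝ ν (x - p) = 0) (h0 : (μHE[n - 1] : Measure (Pt n)) S ≠ 0) :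
    ∃ x, ContainsDisc S ν x := by
  rw [faceMeasure_eq hν hflat] at h0
  set A := (fun y : (ℝ ∙ ν)ᗮ => p + (y : Pt n)) ⁻¹' S with hA
  have hAc : Convex ℝ A := by
    have h1 := hS.translate_preimage_right p
    exact h1.linear_preimage (ℝ ∙ ν)ᗮ.subtype
  have hint : (interior A).Nonempty := by
    by_contra hno
    rw [not_nonempty_iff_eq_empty] at hno
    refine h0 (measure_mono_null ?_ (hAc.addHaar_frontier volume))
    rw [frontier, hno, sdiff_empty]
    exact subset_closure
  obtain ⟨y, hy⟩ := hint
  obtain ⟨r, hr, hb⟩ := Metric.mem_nhds_iff.mp (mem_interior_iff_mem_nhds.mp hy)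
  refine ⟨p + y, r, hr, fun z hz hzn => ?_⟩
  have hmem : z - p ∈ (ℝ ∙ ν)ᗮ := by
    rw [Submodule.mem_orthogonal_singleton_iff_inner_right]
    have h1 : inner ℝ ν (y : Pt n) = 0 :=
      Submodule.mem_orthogonal_singleton_iff_inner_right.mp y.2
    rw [← sub_sub, inner_sub_right, h1, sub_zero] at hzn
    exact hzn
  have h2 : (⟨z - p, hmem⟩ : (ℝ ∙ ν)ᗮ) ∈ A := by
    refine hb ?_
    rw [mem_ball_iff_norm]
    have h3 : ‖z - p - (y : Pt n)‖ < r := by rwa [sub_sub]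
    exact h3
  simpa [hA] using h2

namespace Mesh

variable {Ω : Set (Pt n)} (T : Mesh n Ω)

theorem convex_elem {K : Set (Pt n)} (hK : K ∈ T.elements) : Convex ℝ K := by
  obtain ⟨⟨s, rfl⟩, -⟩ := T.isCell K hK
  exact convex_convexHull ℝ _

theorem isCompact_elem {K : Set (Pt n)} (hK : K ∈ T.elements) : IsCompact K := by
  obtain ⟨⟨s, rfl⟩, -⟩ := T.isCell K hK
  exact s.finite_toSet.isCompact_convexHull ℝ

theorem interior_nonempty {K : Set (Pt n)} (hK : K ∈ T.elements) : (interior K).Nonempty :=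
  (T.isCell K hK).2

theorem subset_closure {K : Set (Pt n)} (hK : K ∈ T.elements) : K ⊆ closure Ω := by
  rw [← T.iUnion_eq]
  exact subset_biUnion_of_mem (u := fun K : Set (Pt n) => K) hK

theorem interior_subset (hreg : interior (closure Ω) = Ω) {K : Set (Pt n)}
    (hK : K ∈ T.elements) : interior K ⊆ Ω := by
  rw [← hreg]
  exact interior_mono (T.subset_closure hK)

/-- An open set that misses the interior of `L` misses the closure of that interior, which contains
`L` by convexity. -/
theorem disjoint_interior_elem {K L : Set (Pt n)} (hK : K ∈ T.elements) (hL : L ∈ T.elements)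
    (h : K ≠ L) : Disjoint (interior K) L := by
  have h1 := (T.disjoint_interior K hK L hL h).closure_right isOpen_interior
  rw [(T.convex_elem hL).closure_interior_eq_closure_of_nonempty_interior
    (T.interior_nonempty hL)] at h1
  exact h1.mono_right _root_.subset_closure

/-- A disc that lies in two elements is in the interior of the domain. -/
theorem mem_of_containsDisc (hreg : interior (closure Ω) = Ω) {K L : Set (Pt n)}
    (hK : K ∈ T.elements) (hL : L ∈ T.elements) (h : K ≠ L) {ν x : Pt n} (hν : ‖ν‖ = 1)
    (hDK : ContainsDisc K ν x) (hDL : ContainsDisc L ν x) : x ∈ Ω := by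
  have hν' : ‖-ν‖ = 1 := by rwa [norm_neg]
  have hsub : interior (K ∪ L) ⊆ Ω := by
    refine (interior_mono (union_subset (T.subset_closure hK) (T.subset_closure hL))).trans ?_
    exact hreg.subset
  have hdis := disjoint_iff_inter_eq_empty.mp (T.disjoint_interior K hK L hL h)
  -- Half balls on the same side would make the interiors overlap. On opposite sides they fill a
  -- ball, which lies in `interior (closure Ω) = Ω`.
  rcases hDK.containsHalfBall_or (T.convex_elem hK) (T.interior_nonempty hK) hν with h1 | h1 <;>
  rcases hDL.containsHalfBall_or (T.convex_elem hL) (T.interior_nonempty hL) hν with h2 | h2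
  · exact absurd hdis (h1.interior_inter_nonempty hν h2).ne_empty
  · exact hsub (h1.mem_interior_union h2)
  · rw [union_comm] at hsub
    exact hsub (h2.mem_interior_union h1)
  · exact absurd hdis (h1.interior_inter_nonempty hν' h2).ne_empty

/-- A disc lies in at most two elements. -/
theorem eq_of_containsDisc {K L M : Set (Pt n)} (hK : K ∈ T.elements) (hL : L ∈ T.elements)
    (hM : M ∈ T.elements) (hKL : K ≠ L) (hKM : K ≠ M) {ν x : Pt n} (hν : ‖ν‖ = 1)
    (hDK : ContainsDisc K ν x) (hDL : ContainsDisc L ν x) (hDM : ContainsDisc M ν x) : L = M := by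
  by_contra hLM
  have hν' : ‖-ν‖ = 1 := by rwa [norm_neg]
  have hd := disjoint_iff_inter_eq_empty.mp (T.disjoint_interior K hK L hL hKL)
  have hd' := disjoint_iff_inter_eq_empty.mp (T.disjoint_interior K hK M hM hKM)
  have hd'' := disjoint_iff_inter_eq_empty.mp (T.disjoint_interior L hL M hM hLM)
  -- Among three half balls two lie on the same side of the disc, and their elements would overlap.
  rcases hDK.containsHalfBall_or (T.convex_elem hK) (T.interior_nonempty hK) hν with h1 | h1 <;>
  rcases hDL.containsHalfBall_or (T.convex_elem hL) (T.interior_nonempty hL) hν with h2 | h2 <;>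
  rcases hDM.containsHalfBall_or (T.convex_elem hM) (T.interior_nonempty hM) hν with h3 | h3
  · exact (h1.interior_inter_nonempty hν h2).ne_empty hd
  · exact (h1.interior_inter_nonempty hν h2).ne_empty hd
  · exact (h1.interior_inter_nonempty hν h3).ne_empty hd'
  · exact (h2.interior_inter_nonempty hν' h3).ne_empty hd''
  · exact (h2.interior_inter_nonempty hν h3).ne_empty hd''
  · exact (h1.interior_inter_nonempty hν' h3).ne_empty hd'
  · exact (h1.interior_inter_nonempty hν' h2).ne_empty hd
  · exact (h1.interior_inter_nonempty hν' h2).ne_empty hd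

/-- The pair of elements that defines `e` need not mention `K` a priori. If it did not, the disc in
`e` would lie in three elements. -/
theorem interiorFace_eq_inter {e K : Set (Pt n)} (he : e ∈ T.interiorFaces)
    (hK : K ∈ T.elements) (heK : e ⊆ K) {ν x : Pt n} (hν : ‖ν‖ = 1) (hD : ContainsDisc e ν x) :
    ∃ L ∈ T.elements, K ≠ L ∧ e = K ∩ L := by
  obtain ⟨L, hL, M, hM, hLM, rfl, -⟩ := (T.mem_interiorFaces e).mp he
  by_cases h1 : K = L
  · exact ⟨M, hM, h1 ▸ hLM, by rw [h1]⟩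
  by_cases h2 : K = M
  · exact ⟨L, hL, h1, by rw [h2, inter_comm]⟩
  exact absurd (T.eq_of_containsDisc hK hL hM h1 h2 hν (hD.mono heK) (hD.mono inter_subset_left)
    (hD.mono inter_subset_right)) hLM

/-- The facet belongs to `K`, since otherwise its disc would lie in two elements and so inside `Ω`.
The functional exposing it is constant on the disc, hence along every direction in the hyperplane,
so every point of `K` in that hyperplane is also a maximizer. -/
theorem subset_boundaryFace (hΩ : IsOpen Ω) (hreg : interior (closure Ω) = Ω)
    {e K : Set (Pt n)} (he : e ∈ T.boundaryFaces)
    (hK : K ∈ T.elements) (heK : e ⊆ K) {ν x : Pt n} (hν : ‖ν‖ = 1) (hD : ContainsDisc e ν x) :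
    ∀ y ∈ K, Inner.inner ℝ ν (y - x) = 0 → y ∈ e := by
  obtain ⟨L, hL, ⟨hexp, hcod⟩, hfr⟩ := (T.mem_boundaryFaces e).mp he
  have hLK : K = L := by
    by_contra hne
    have h1 := T.mem_of_containsDisc hreg hK hL hne hν (hD.mono heK) (hD.mono hexp.subset)
    exact (hΩ.frontier_eq ▸ hfr hD.mem).2 h1
  subst hLK
  obtain ⟨l, hl⟩ := hexp ⟨x, hD.mem⟩
  intro y hy hyx
  obtain ⟨r, hr, hDr⟩ := hD
  have hmax : ∀ z ∈ e, ∀ z' ∈ e, l z = l z' := by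
    intro z hz z' hz'
    rw [hl] at hz hz'
    exact le_antisymm (hz'.2 z hz.1) (hz.2 z' hz'.1)
  obtain ⟨t, ht, htr⟩ : ∃ t : ℝ, 0 < t ∧ t * ‖y - x‖ < r := by
    refine ⟨r / (2 * (‖y - x‖ + 1)), by positivity, ?_⟩
    rw [div_mul_eq_mul_div, div_lt_iff₀ (by positivity)]
    nlinarith [norm_nonneg (y - x)]
  have h1 : x + t • (y - x) ∈ e := by
    refine hDr _ ?_ ?_
    · rw [add_sub_cancel_left, norm_smul, Real.norm_of_nonneg ht.le]; exact htr
    · rw [add_sub_cancel_left, inner_smul_right, hyx, mul_zero]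
  have hxe : x ∈ e := hDr x (by simpa using hr) (by simp)
  have h2 := hmax _ h1 _ hxe
  rw [map_add, map_smul, map_sub, smul_eq_mul, add_eq_left, mul_eq_zero, sub_eq_zero] at h2
  have h3 := h2.resolve_left ht.ne'
  rw [hl] at hxe ⊢
  exact ⟨hy, fun z hz => h3 ▸ hxe.2 z hz⟩

theorem isCompact_convex_face {e : Set (Pt n)} (he : e ∈ T.interiorFaces ∨ e ∈ T.boundaryFaces) :
    IsCompact e ∧ Convex ℝ e := by
  rcases he with he | he
  · obtain ⟨L, hL, M, hM, -, rfl, -⟩ := (T.mem_interiorFaces e).mp he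
    exact ⟨(T.isCompact_elem hL).inter_right (T.isCompact_elem hM).isClosed,
      (T.convex_elem hL).inter (T.convex_elem hM)⟩
  · obtain ⟨L, hL, ⟨hexp, -⟩, -⟩ := (T.mem_boundaryFaces e).mp he
    exact ⟨hexp.isCompact (T.isCompact_elem hL), hexp.convex (T.convex_elem hL)⟩

theorem hasCodimOne_face {e : Set (Pt n)} (he : e ∈ T.interiorFaces ∨ e ∈ T.boundaryFaces) :
    HasCodimOne e := by
  rcases he with he | he
  · obtain ⟨L, hL, M, hM, -, -, h⟩ := (T.mem_interiorFaces e).mp he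
    exact h
  · obtain ⟨L, hL, ⟨-, h⟩, -⟩ := (T.mem_boundaryFaces e).mp he
    exact h

theorem exists_elem_superset {e : Set (Pt n)} (he : e ∈ T.interiorFaces ∨ e ∈ T.boundaryFaces) :
    ∃ K ∈ T.elements, e ⊆ K := by
  rcases he with he | he
  · obtain ⟨L, hL, M, hM, -, rfl, -⟩ := (T.mem_interiorFaces e).mp he
    exact ⟨L, hL, inter_subset_left⟩
  · obtain ⟨L, hL, ⟨h, -⟩, -⟩ := (T.mem_boundaryFaces e).mp he
    exact ⟨L, hL, h.subset⟩

theorem disjoint_interior_face (hΩ : IsOpen Ω) (hreg : interior (closure Ω) = Ω)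
    {e K : Set (Pt n)} (he : e ∈ T.interiorFaces ∨ e ∈ T.boundaryFaces) (hK : K ∈ T.elements) :
    Disjoint (interior K) e := by
  rcases he with he | he
  · obtain ⟨L, hL, M, hM, hLM, rfl, -⟩ := (T.mem_interiorFaces e).mp he
    by_cases h1 : K = L
    · exact (T.disjoint_interior_elem hK hM (h1 ▸ hLM)).mono_right inter_subset_right
    · exact (T.disjoint_interior_elem hK hL h1).mono_right inter_subset_left
  · obtain ⟨L, hL, -, hfr⟩ := (T.mem_boundaryFaces e).mp he
    rw [hΩ.frontier_eq] at hfr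
    exact Set.disjoint_left.mpr fun x hx hxe => (hfr hxe).2 (T.interior_subset hreg hK hx)

/-- The empty set has a zero-dimensional vector span and would count as a set of codimension one on
the line. This is where `2 ≤ n` enters. -/
theorem face_nonempty (hn : 2 ≤ n) {e : Set (Pt n)}
    (he : e ∈ T.interiorFaces ∨ e ∈ T.boundaryFaces) : e.Nonempty := by
  by_contra hno
  rw [not_nonempty_iff_eq_empty] at hno
  have h := T.hasCodimOne_face he
  rw [hno, HasCodimOne, vectorSpan_empty, finrank_bot] at h
  omega

/-- Hahn–Banach separates the open interior of `K` from the convex face, and the bound extends to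
`K` by closure. The Riesz vector of the functional, normalized, is the witness required by the
choice in `outwardNormal`; it is nonzero since the separation is strict at an interior point. -/
theorem isOutwardNormal (hn : 2 ≤ n) (hΩ : IsOpen Ω) (hreg : interior (closure Ω) = Ω)
    {e K : Set (Pt n)} (he : e ∈ T.interiorFaces ∨ e ∈ T.boundaryFaces) (hK : K ∈ T.elements) :
    IsOutwardNormal K e (outwardNormal K e) := by
  refine Classical.epsilon_spec (p := IsOutwardNormal K e) ?_
  obtain ⟨l, u, h1, h2⟩ := geometric_hahn_banach_open (T.convex_elem hK).interior isOpen_interior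
    (T.isCompact_convex_face he).2 (T.disjoint_interior_face hΩ hreg he hK)
  obtain ⟨p, hp⟩ := T.interior_nonempty hK
  have hcl : K ⊆ closure (interior K) := by
    rw [(T.convex_elem hK).closure_interior_eq_closure_of_nonempty_interior ⟨p, hp⟩]
    exact _root_.subset_closure
  have h3 : ∀ y ∈ K, l y ≤ u := fun y hy =>
    closure_minimal (fun z hz => (h1 z hz).le) (isClosed_le l.continuous continuous_const) (hcl hy)
  obtain ⟨q, hq⟩ := T.face_nonempty hn he
  have hn : (InnerProductSpace.toDual ℝ (Pt n)).symm l ≠ 0 := by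
    intro h0
    rw [LinearIsometryEquiv.map_eq_zero_iff] at h0
    have h4 := h1 p hp
    have h5 := h2 q hq
    simp only [h0, _root_.zero_apply] at h4 h5
    linarith
  refine ⟨‖(InnerProductSpace.toDual ℝ (Pt n)).symm l‖⁻¹ •
    (InnerProductSpace.toDual ℝ (Pt n)).symm l, ?_, fun x hx y hy => ?_⟩
  · rw [norm_smul, norm_inv, norm_norm, inv_mul_cancel₀ (norm_ne_zero_iff.mpr hn)]
  · rw [inner_smul_left, InnerProductSpace.toDual_symm_apply, map_sub]
    refine mul_nonpos_of_nonneg_of_nonpos (by simp) ?_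
    linarith [h2 x hx, h3 y hy]

/-- Two different faces of an element overlap in a null set only, and no face is both an interior
face and a boundary face up to null sets. -/
theorem faceMeasure_inter_eq_zero (hn : 2 ≤ n) (hΩ : IsOpen Ω)
    (hreg : interior (closure Ω) = Ω) {e e' K : Set (Pt n)} (hK : K ∈ T.elements)
    (heK : e ⊆ K) (heK' : e' ⊆ K)
    (h : (e ∈ T.interiorFaces ∧ e' ∈ T.interiorFaces ∧ e ≠ e') ∨
      (e ∈ T.boundaryFaces ∧ e' ∈ T.boundaryFaces ∧ e ≠ e') ∨
      (e ∈ T.interiorFaces ∧ e' ∈ T.boundaryFaces)) :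
    (μHE[n - 1] : Measure (Pt n)) (e ∩ e') = 0 := by
  have he : e ∈ T.interiorFaces ∨ e ∈ T.boundaryFaces := by tauto
  have he' : e' ∈ T.interiorFaces ∨ e' ∈ T.boundaryFaces := by tauto
  by_contra h0
  obtain ⟨p, hp⟩ : (e ∩ e').Nonempty := by
    by_contra hno
    rw [not_nonempty_iff_eq_empty] at hno
    simp [hno] at h0
  have hconv := (T.isCompact_convex_face he).2.inter (T.isCompact_convex_face he').2
  have hN := T.isOutwardNormal hn hΩ hreg he hK
  have hN' := T.isOutwardNormal hn hΩ hreg he' hK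
  set ν := outwardNormal K e
  set ν' := outwardNormal K e'
  -- One disc is taken for each of the two normals, which avoids comparing the normals. For two
  -- boundary faces both inclusions are needed, each with its own normal.
  obtain ⟨x, hx⟩ := exists_containsDisc hconv hN.1
    (fun y hy => hN.inner_eq_zero heK hp.1 y hy.1) h0
  obtain ⟨x', hx'⟩ := exists_containsDisc hconv hN'.1
    (fun y hy => hN'.inner_eq_zero heK' hp.2 y hy.2) h0
  rcases h with ⟨h1, h2, hne⟩ | ⟨h1, h2, hne⟩ | ⟨h1, h2⟩
  · obtain ⟨L, hL, hKL, rfl⟩ := T.interiorFace_eq_inter h1 hK heK hN.1 (hx.mono inter_subset_left)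
    obtain ⟨M, hM, hKM, rfl⟩ := T.interiorFace_eq_inter h2 hK heK' hN.1
      (hx.mono inter_subset_right)
    refine hne ?_
    rw [T.eq_of_containsDisc hK hL hM hKL hKM hN.1 (hx.mono (inter_subset_left.trans heK))
      (hx.mono (inter_subset_left.trans inter_subset_right))
      (hx.mono (inter_subset_right.trans inter_subset_right))]
  · refine hne (Subset.antisymm (fun y hy => ?_) fun y hy => ?_)
    · exact T.subset_boundaryFace hΩ hreg h2 hK heK' hN.1 (hx.mono inter_subset_right) y (heK hy)
        (hN.inner_eq_zero heK hx.mem.1 y hy)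
    · exact T.subset_boundaryFace hΩ hreg h1 hK heK hN'.1 (hx'.mono inter_subset_left) y (heK' hy)
        (hN'.inner_eq_zero heK' hx'.mem.2 y hy)
  · obtain ⟨L, hL, hKL, rfl⟩ := T.interiorFace_eq_inter h1 hK heK hN.1 (hx.mono inter_subset_left)
    have hxΩ := T.mem_of_containsDisc hreg hK hL hKL hN.1
      (hx.mono (inter_subset_left.trans inter_subset_left))
      (hx.mono (inter_subset_left.trans inter_subset_right))
    obtain ⟨M, hM, -, hfr⟩ := (T.mem_boundaryFaces e').mp h2
    rw [hΩ.frontier_eq] at hfr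
    exact (hfr hx.mem.2).2 hxΩ

/-- A continuous function that vanishes almost everywhere on a face vanishes on it. -/
theorem eq_zero_of_ae_face (hn : 2 ≤ n) (hΩ : IsOpen Ω) (hreg : interior (closure Ω) = Ω)
    {e : Set (Pt n)} (he : e ∈ T.interiorFaces ∨ e ∈ T.boundaryFaces) {f : Pt n → ℝ}
    (hf : Continuous f) (h : ∀ᵐ x ∂(μHE[n - 1] : Measure (Pt n)).restrict e, f x = 0) :
    ∀ x ∈ e, f x = 0 := by
  obtain ⟨K, hK, heK⟩ := T.exists_elem_superset he
  obtain ⟨p, hp⟩ := T.face_nonempty hn he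
  have hN := T.isOutwardNormal hn hΩ hreg he hK
  set ν := outwardNormal K e
  have hflat := hN.inner_eq_zero heK hp
  obtain ⟨hcomp, hconv⟩ := T.isCompact_convex_face he
  have hemb : MeasurableEmbedding fun y : (ℝ ∙ ν)ᗮ => p + (y : Pt n) :=
    (isometry_hyperplane p ν).isClosedEmbedding.measurableEmbedding
  set A := (fun y : (ℝ ∙ ν)ᗮ => p + (y : Pt n)) ⁻¹' e with hA
  have hAc : Convex ℝ A :=
    (hconv.translate_preimage_right p).linear_preimage (ℝ ∙ ν)ᗮ.subtype
  have himg : e = (fun y : (ℝ ∙ ν)ᗮ => p + (y : Pt n)) '' A := by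
    rw [hA, image_preimage_eq_of_subset (subset_range_hyperplane hflat)]
  have hAne : A.Nonempty := ⟨0, by simpa [hA] using hp⟩
  -- Dimension `n - 1` of the face makes its copy in the hyperplane span everything. A convex set
  -- with full span has interior points and lies in the closure of its interior, so vanishing there
  -- suffices.
  have hspan : vectorSpan ℝ A = ⊤ := by
    have h1 : vectorSpan ℝ e = (vectorSpan ℝ A).map (ℝ ∙ ν)ᗮ.subtype := by
      have h2 := AffineMap.map_vectorSpan
        ((AffineEquiv.constVAdd ℝ (Pt n) p).toAffineMap.comp (ℝ ∙ ν)ᗮ.subtype.toAffineMap) (s := A)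
      rw [himg]
      exact h2.symm
    refine Submodule.eq_top_of_finrank_eq ?_
    have h3 := T.hasCodimOne_face he
    rw [HasCodimOne, h1, Submodule.finrank_map_subtype_eq] at h3
    rw [finrank_hyperplane hN.1]
    omega
  have hint : (interior A).Nonempty := by
    rw [hAc.interior_nonempty_iff_affineSpan_eq_top,
      AffineSubspace.affineSpan_eq_top_iff_vectorSpan_eq_top_of_nonempty ℝ _ _ hAne]
    exact hspan
  have hae : ∀ᵐ y : (ℝ ∙ ν)ᗮ ∂volume.restrict A, f (p + (y : Pt n)) = 0 := by
    have h1 : (μHE[n - 1] : Measure (Pt n)).restrict e =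
        ((volume : Measure (ℝ ∙ ν)ᗮ).restrict A).map fun y : (ℝ ∙ ν)ᗮ => p + (y : Pt n) := by
      have h2 := hemb.restrict_map (volume : Measure (ℝ ∙ ν)ᗮ) e
      rwa [map_hyperplane p hN.1, Measure.restrict_restrict_of_subset
        (subset_range_hyperplane hflat)] at h2
    rw [h1] at h
    exact hemb.ae_map_iff.mp h
  have hg : Continuous fun y : (ℝ ∙ ν)ᗮ => f (p + y) := by fun_prop
  have hzero : EqOn (fun y : (ℝ ∙ ν)ᗮ => f (p + y)) (fun _ => 0) (interior A) :=
    Measure.eqOn_open_of_ae_eq (μ := volume)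
      (ae_restrict_of_ae_restrict_of_subset _root_.interior_subset hae) isOpen_interior
      hg.continuousOn continuousOn_const
  have hzero2 := hzero.closure hg continuous_const
  rw [hAc.closure_interior_eq_closure_of_nonempty_interior hint] at hzero2
  intro x hx
  rw [himg] at hx
  obtain ⟨y, hy, rfl⟩ := hx
  exact hzero2 (_root_.subset_closure hy)

end Mesh

end

/-! ### Integration by parts on an element -/

section
open Set Filter Topology

variable {n : ℕ}

theorem continuous_polyVal (p : MvPolynomial (Fin n) ℝ) : Continuous (polyVal p) :=
  (MvPolynomial.continuous_eval p).comp (by fun_prop)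

theorem hasFDerivAt_polyVal (p : MvPolynomial (Fin n) ℝ) (x : Pt n) :
    HasFDerivAt (polyVal p)
      (∑ i, polyVal (MvPolynomial.pderiv i p) x • EuclideanSpace.proj (𝕜 := ℝ) i) x := by
  induction p using MvPolynomial.induction_on with
  | C a =>
    have h1 : polyVal (n := n) (MvPolynomial.C a) = fun _ => a := by ext y; simp [polyVal]
    rw [h1]
    simpa [polyVal] using hasFDerivAt_const a x
  | add p q hp hq =>
    have h1 : polyVal (p + q) = polyVal p + polyVal q := by ext y; simp [polyVal]
    rw [h1]
    convert! hp.add hq using 1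
    rw [← Finset.sum_add_distrib]
    refine Finset.sum_congr rfl fun i _ => ?_
    rw [← add_smul]; simp [polyVal]
  | mul_X p j hp =>
    have h1 : polyVal (p * MvPolynomial.X j) =
        polyVal p * fun y : Pt n => EuclideanSpace.proj (𝕜 := ℝ) j y := by
      ext y; simp [polyVal]
    rw [h1]
    convert! hp.mul (EuclideanSpace.proj (𝕜 := ℝ) j : Pt n →L[ℝ] ℝ).hasFDerivAt using 1
    rw [Finset.smul_sum]
    have h2 : polyVal p x • (EuclideanSpace.proj (𝕜 := ℝ) j : Pt n →L[ℝ] ℝ) =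
        ∑ i, (polyVal p x * if i = j then 1 else 0) •
          (EuclideanSpace.proj (𝕜 := ℝ) i : Pt n →L[ℝ] ℝ) := by
      simp
    rw [h2, ← Finset.sum_add_distrib]
    refine Finset.sum_congr rfl fun i _ => ?_
    rw [smul_smul, ← add_smul]
    congr 1
    rw [polyVal, Derivation.leibniz, MvPolynomial.pderiv_X, map_add, smul_eq_mul, smul_eq_mul,
      map_mul, map_mul, Pi.single_apply]
    simp only [polyVal, MvPolynomial.eval_X, eq_comm (a := j), PiLp.proj_apply]
    split_ifs <;> simp

theorem locallyLipschitz_polyVal (p : MvPolynomial (Fin n) ℝ) : LocallyLipschitz (polyVal p) := by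
  have h : AnalyticOnNhd ℝ (fun x : Pt n => MvPolynomial.aeval (fun i => x i) p) univ := by
    refine AnalyticOnNhd.aeval_mvPolynomial (fun i => ?_) p
    exact (EuclideanSpace.proj (𝕜 := ℝ) i : Pt n →L[ℝ] ℝ).analyticOnNhd univ
  have h2 : ContDiff ℝ 1 (polyVal p) := by
    have := h.contDiff (n := 1)
    convert this using 1
    ext x
    simp [polyVal, MvPolynomial.aeval_eq_eval]
  exact h2.locallyLipschitz

/-- At almost every zero of a function, its derivative vanishes where it exists. -/
theorem ae_fderiv_eq_zero_of_eq_zero {f : Pt n → ℝ} {s : Set (Pt n)} (hs : MeasurableSet s)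
    (hf : ∀ x ∈ s, f x = 0) : ∀ᵐ x : Pt n, x ∈ s → fderiv ℝ f x = 0 := by
  rcases subsingleton_or_nontrivial (Pt n) with hsub | hnt
  · exact Eventually.of_forall fun x _ => Subsingleton.elim _ _
  obtain ⟨v, hv⟩ := exists_ne (0 : Pt n)
  set s' := s ∩ {x | DifferentiableAt ℝ f x} with hs'
  have hm : MeasurableSet s' := hs.inter (measurableSet_of_differentiableAt ℝ f)
  -- Multiplication by a fixed vector turns `f` into a map of the space into itself. On `s'` this
  -- map is zero, so zero approximates it with constant `0`, and its derivative must vanish at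
  -- almost every point of `s'`.
  have h1 : ApproximatesLinearOn (fun x => f x • v) (0 : Pt n →L[ℝ] Pt n) s' 0 := by
    intro x hx y hy
    simp [hf x hx.1, hf y hy.1]
  have h2 := h1.norm_fderiv_sub_le (μ := volume) hm (fun x => (fderiv ℝ f x).smulRight v)
    fun x hx => (hx.2.hasFDerivAt.smul_const v).hasFDerivWithinAt
  rw [ae_restrict_iff' hm] at h2
  filter_upwards [h2] with x hx hxs
  by_cases hd : DifferentiableAt ℝ f x
  · have h3 := hx ⟨hxs, hd⟩
    rw [sub_zero, nonpos_iff_eq_zero, nnnorm_eq_zero] at h3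
    ext w
    have h4 := congrArg (fun A : Pt n →L[ℝ] Pt n => A w) h3
    simpa [hv] using h4
  · exact fderiv_zero_of_not_differentiableAt hd

variable {Ω : Set (Pt n)} {φ d : Pt n → ℝ}

/-- Where `φ > 0` this is the product rule. Where `φ = 0` the coefficient vanishes, so at almost
every such point its derivative is zero, in agreement with the convention that the other
coefficients are zero there. -/
theorem IsAdmissible.ae_hasGradientAt_coefB (h : IsAdmissible Ω φ d) (hΩ : IsOpen Ω)
    {K : Set (Pt n)} {L : NNReal} (hL : LipschitzOnWith L (coefB φ d) K) (hK : interior K ⊆ Ω) :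
    ∀ᵐ x : Pt n, x ∈ interior K →
      HasGradientAt (coefB φ d) (coefD φ d x - (1 / 2 : ℝ) • coefP φ d x) x := by
  have h1 := (hL.mono interior_subset).ae_differentiableWithinAt (μ := volume)
    isOpen_interior.measurableSet
  rw [ae_restrict_iff' isOpen_interior.measurableSet] at h1
  have hφc : ContinuousOn φ (interior K) := h.phi_cont.mono (hK.trans subset_closure)
  have hm : MeasurableSet (interior K ∩ {x | φ x = 0}) := by
    have h2 : interior K ∩ {x | φ x = 0} = interior K \ (interior K ∩ φ ⁻¹' {0}ᶜ) := by
      ext x; simp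
    rw [h2]
    exact isOpen_interior.measurableSet.diff
      (hφc.isOpen_inter_preimage isOpen_interior isOpen_compl_singleton).measurableSet
  have h2 := ae_fderiv_eq_zero_of_eq_zero (f := coefB φ d) hm fun x hx => coefB_of_zero hx.2
  filter_upwards [h1, h2, h.ae_differentiableAt hΩ] with x hx1 hx2 hx3 hxK
  by_cases hφ : φ x = 0
  · rw [coefD_of_zero hφ, coefP_of_zero hφ, smul_zero, sub_zero, hasGradientAt_iff_hasFDerivAt,
      map_zero, ← hx2 ⟨hxK, hφ⟩]
    exact ((hx1 hxK).differentiableAt (isOpen_interior.mem_nhds hxK)).hasFDerivAt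
  · have hpos : x ∈ posSet Ω φ := ⟨hK hxK, lt_of_le_of_ne
      (h.phi_nonneg x (subset_closure (hK hxK))) (Ne.symm hφ)⟩
    exact hasGradientAt_coefB hpos.2 (hx3 hpos).1 (hx3 hpos).2

namespace Mesh

variable (T : Mesh n Ω)

theorem mem_innerOf {K : T.Elem} {e : T.Face} :
    e ∈ T.innerOf K ↔ (e : Set (Pt n)) ∈ T.interiorFaces ∧ (e : Set (Pt n)) ⊆ K := by
  simp [innerOf, Mesh.inner]

theorem mem_outerOf {K : T.Elem} {e : T.Face} :
    e ∈ T.outerOf K ↔ (e : Set (Pt n)) ∈ T.boundaryFaces ∧ (e : Set (Pt n)) ⊆ K := by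
  simp [outerOf, outer]

theorem face_cases (e : T.Face) :
    (e : Set (Pt n)) ∈ T.interiorFaces ∨ (e : Set (Pt n)) ∈ T.boundaryFaces := by
  simpa [faces] using e.2

theorem mem_faces_of {e : Set (Pt n)} (he : e ∈ T.interiorFaces ∨ e ∈ T.boundaryFaces) :
    e ∈ T.faces := by
  simpa [faces] using he

theorem faceMeasure_lt_top (hn : 2 ≤ n) (hΩ : IsOpen Ω) (hreg : interior (closure Ω) = Ω)
    (e : T.Face) : (μHE[n - 1] : Measure (Pt n)) e < ⊤ := by
  obtain ⟨K, hK, heK⟩ := T.exists_elem_superset (T.face_cases e)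
  obtain ⟨p, hp⟩ := T.face_nonempty hn (T.face_cases e)
  have hN := T.isOutwardNormal hn hΩ hreg (T.face_cases e) hK
  rw [faceMeasure_eq hN.1 (hN.inner_eq_zero heK hp)]
  exact ((isometry_hyperplane p _).isClosedEmbedding.isCompact_preimage
    (T.isCompact_convex_face (T.face_cases e)).1).measure_lt_top

theorem integrableOn_face (hn : 2 ≤ n) (hΩ : IsOpen Ω) (hreg : interior (closure Ω) = Ω)
    (e : T.Face) {f : Pt n → ℝ} (hf : ContinuousOn f e) :
    IntegrableOn f e (μHE[n - 1] : Measure (Pt n)) := by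
  have hc := (T.isCompact_convex_face (T.face_cases e)).1
  obtain ⟨C, hC⟩ := hc.exists_bound_of_continuousOn hf
  have : IsFiniteMeasure ((μHE[n - 1] : Measure (Pt n)).restrict e) :=
    ⟨by simpa using T.faceMeasure_lt_top hn hΩ hreg e⟩
  exact Integrable.of_bound (hf.aestronglyMeasurable hc.measurableSet) C
    ((ae_restrict_iff' hc.measurableSet).mpr (Eventually.of_forall hC))

theorem faceIntegral_eq_zero_of_null {e : Set (Pt n)}
    (h : (μHE[n - 1] : Measure (Pt n)) e = 0) (f : Pt n → ℝ) : faceIntegral e f = 0 := by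
  rw [faceIntegral, Measure.restrict_eq_zero.mpr h, integral_zero_measure]

/-- The divergence theorem on an element, with its faces in the skeleton. -/
theorem integral_lineDeriv_elem (hn : 2 ≤ n) (hΩ : IsOpen Ω) (hreg : interior (closure Ω) = Ω)
    (K : T.Elem) {w : Pt n → ℝ} {C : NNReal} (hw : LipschitzWith C w) (v : Pt n) :
    ∫ x in (K : Set (Pt n)), lineDeriv ℝ w x v =
      ∑ e ∈ T.innerOf K, Inner.inner ℝ (outwardNormal K e) v * faceIntegral (e : Set (Pt n)) w +
      ∑ e ∈ T.outerOf K, Inner.inner ℝ (outwardNormal K e) v * faceIntegral (e : Set (Pt n)) w := by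
  classical
  have hmem : ∀ e : T.Face, e ∈ T.innerOf K ∪ T.outerOf K ↔ (e : Set (Pt n)) ⊆ K := by
    intro e
    rw [Finset.mem_union, mem_innerOf, mem_outerOf, ← or_and_right]
    exact and_iff_right (T.face_cases e)
  -- A set listed both as an interior and as a boundary face would be counted twice in the sum. It
  -- overlaps itself in a null set, hence is null and contributes nothing.
  rw [← Finset.sum_union_inter, Finset.sum_eq_zero (s := T.innerOf K ∩ T.outerOf K), add_zero]
  · refine integral_lineDeriv_eq_sum_faces (T.convex_elem K.2) (T.isCompact_elem K.2)
      (T.interior_nonempty K.2) (e := fun e : T.Face => (e : Set (Pt n)))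
      (fun e _ => (T.isCompact_convex_face (T.face_cases e)).1) (fun e he => (hmem e).mp he)
      (fun e _ => T.isOutwardNormal hn hΩ hreg (T.face_cases e) K.2) ?_ ?_ hw v
    · intro x hx
      obtain ⟨e, he, heK, hxe⟩ := T.frontier_subset K K.2 x hx
      exact mem_biUnion (x := (⟨e, T.mem_faces_of he⟩ : T.Face))
        ((hmem ⟨e, T.mem_faces_of he⟩).mpr heK) hxe
    · intro e he e' he' hne
      have hne' : (e : Set (Pt n)) ≠ e' := fun h => hne (Subtype.ext h)
      have heK := (hmem e).mp he
      have heK' := (hmem e').mp he'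
      rcases T.face_cases e with h1 | h1 <;> rcases T.face_cases e' with h2 | h2
      · exact T.faceMeasure_inter_eq_zero hn hΩ hreg K.2 heK heK' (Or.inl ⟨h1, h2, hne'⟩)
      · exact T.faceMeasure_inter_eq_zero hn hΩ hreg K.2 heK heK' (Or.inr (Or.inr ⟨h1, h2⟩))
      · rw [inter_comm]
        exact T.faceMeasure_inter_eq_zero hn hΩ hreg K.2 heK' heK (Or.inr (Or.inr ⟨h2, h1⟩))
      · exact T.faceMeasure_inter_eq_zero hn hΩ hreg K.2 heK heK' (Or.inr (Or.inl ⟨h1, h2, hne'⟩))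
  · intro e he
    rw [Finset.mem_inter, mem_innerOf, mem_outerOf] at he
    have h0 := T.faceMeasure_inter_eq_zero hn hΩ hreg K.2 he.1.2 he.2.2
      (Or.inr (Or.inr ⟨he.1.1, he.2.1⟩))
    rw [inter_self] at h0
    rw [faceIntegral_eq_zero_of_null h0, mul_zero]

/-- Integration by parts on an element. -/
theorem integral_by_parts (hn : 2 ≤ n) (hΩ : IsOpen Ω) (hreg : interior (closure Ω) = Ω)
    (h : IsAdmissible Ω φ d) {k : ℕ} (K : T.Elem) (u : Fin n → Poly n k) (p : Poly n k) :
    ∫ x in (K : Set (Pt n)), (polyVal p x * Inner.inner ℝ (coefD φ d x) (vecVal u x)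
        + coefB φ d x * polyVal p x * vecDiv u x
        - (1 / 2 : ℝ) * Inner.inner ℝ (coefP φ d x) (vecVal u x) * polyVal p x
        + coefB φ d x * Inner.inner ℝ (vecVal u x) (polyGrad (p : MvPolynomial (Fin n) ℝ) x)) =
      (∑ e ∈ T.innerOf K, faceIntegral (e : Set (Pt n)) fun x => coefB φ d x *
        Inner.inner ℝ (vecVal u x) (outwardNormal K e) * polyVal p x) +
      ∑ e ∈ T.outerOf K, faceIntegral (e : Set (Pt n)) fun x => coefB φ d x *
        Inner.inner ℝ (vecVal u x) (outwardNormal K e) * polyVal p x := by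
  obtain ⟨L, hL⟩ := h.exists_lipschitzOnWith hΩ
  have hLK := hL K (T.convex_elem K.2) (T.interior_nonempty K.2) (T.subset_closure K.2)
    (T.interior_subset hreg K.2)
  -- The components of the vector field `φ^{-1/2} d p u` are the coefficient times these
  -- polynomials. Each product is Lipschitz on `K` and is extended to the whole space, as the
  -- divergence theorem requires.
  set q : Fin n → MvPolynomial (Fin n) ℝ := fun i =>
    (p : MvPolynomial (Fin n) ℝ) * (u i : MvPolynomial (Fin n) ℝ) with hq
  have hlip : ∀ i, ∃ C, LipschitzOnWith C (fun x => coefB φ d x * polyVal (q i) x) K := by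
    intro i
    refine LocallyLipschitzOn.exists_lipschitzOnWith_of_compact (T.isCompact_elem K.2) ?_
    have h3 : LocallyLipschitz fun q : ℝ × ℝ => q.1 * q.2 :=
      ContDiff.locallyLipschitz (𝕂 := ℝ) (by fun_prop)
    have h4 : LocallyLipschitzOn (K : Set (Pt n)) fun x => (coefB φ d x, polyVal (q i) x) := by
      intro x hx
      obtain ⟨D, w, hw, hDw⟩ := locallyLipschitz_polyVal (q i) x
      exact ⟨max L D, (K : Set (Pt n)) ∩ w, inter_mem self_mem_nhdsWithin
        (mem_nhdsWithin_of_mem_nhds hw), (hLK.mono inter_subset_left).prodMk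
        (hDw.mono inter_subset_right)⟩
    exact locallyLipschitzOn_comp (t := univ) (locallyLipschitzOn_univ.mpr h3) h4
      fun _ _ => trivial
  choose C hC using hlip
  choose g hg hgK using fun i => (hC i).extend_real
  have hdiv := fun i => T.integral_lineDeriv_elem hn hΩ hreg K (hg i) (EuclideanSpace.single i 1)
  have hnull : (volume : Measure (Pt n)) (frontier K) = 0 := (T.convex_elem K.2).addHaar_frontier _
  have hae : ∀ᵐ x ∂(volume : Measure (Pt n)).restrict K,
      (polyVal p x * Inner.inner ℝ (coefD φ d x) (vecVal u x)
        + coefB φ d x * polyVal p x * vecDiv u x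
        - (1 / 2 : ℝ) * Inner.inner ℝ (coefP φ d x) (vecVal u x) * polyVal p x
        + coefB φ d x * Inner.inner ℝ (vecVal u x) (polyGrad (p : MvPolynomial (Fin n) ℝ) x)) =
      ∑ i, lineDeriv ℝ (g i) x (EuclideanSpace.single i 1) := by
    rw [ae_restrict_iff' (T.isCompact_elem K.2).measurableSet]
    -- Off the null frontier the extension agrees with the product in a neighbourhood, so the two
    -- have the same derivative.
    filter_upwards [measure_eq_zero_iff_ae_notMem.mp hnull,
      h.ae_hasGradientAt_coefB hΩ hLK (T.interior_subset hreg K.2)] with x hx1 hx2 hxK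
    have hxi : x ∈ interior (K : Set (Pt n)) := by
      by_contra hno
      exact hx1 ⟨_root_.subset_closure hxK, hno⟩
    have hB := (hx2 hxi).hasFDerivAt
    have hline : ∀ i, lineDeriv ℝ (g i) x (EuclideanSpace.single i 1) =
        coefB φ d x * polyVal (MvPolynomial.pderiv i (q i)) x +
        polyVal (q i) x * (coefD φ d x - (1 / 2 : ℝ) • coefP φ d x) i := by
      intro i
      have h5 := hB.mul (hasFDerivAt_polyVal (q i) x)
      have h6 : g i =ᶠ[𝓝 x] (coefB φ d * polyVal (q i)) := by
        filter_upwards [isOpen_interior.mem_nhds hxi] with y hy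
        exact (hgK i (_root_.interior_subset hy)).symm
      have h7 := (h5.congr_of_eventuallyEq h6).hasLineDerivAt (EuclideanSpace.single i 1)
      rw [h7.lineDeriv]
      simp [EuclideanSpace.inner_single_right, PiLp.single_apply]
    rw [Finset.sum_congr rfl fun i _ => hline i]
    simp only [vecDiv, polyGrad, vecVal, PiLp.inner_apply, hq, polyVal, MvPolynomial.pderiv_mul,
      map_add, map_mul, Finset.mul_sum, Finset.sum_mul, ← Finset.sum_add_distrib,
      ← Finset.sum_sub_distrib]
    refine Finset.sum_congr rfl fun i _ => ?_
    simp
    ring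
  rw [integral_congr_ae hae, integral_finsetSum]
  · rw [Finset.sum_congr rfl fun i _ => hdiv i, Finset.sum_add_distrib, Finset.sum_comm]
    rw [Finset.sum_comm (s := Finset.univ) (t := T.outerOf K)]
    have hface : ∀ e : T.Face, (e : Set (Pt n)) ⊆ K →
        ∑ i, Inner.inner ℝ (outwardNormal K e) (EuclideanSpace.single i 1) *
          faceIntegral (e : Set (Pt n)) (g i) =
        faceIntegral (e : Set (Pt n)) fun x => coefB φ d x *
          Inner.inner ℝ (vecVal u x) (outwardNormal K e) * polyVal p x := by
      intro e heK
      simp only [faceIntegral, ← integral_const_mul]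
      rw [← integral_finsetSum]
      · refine setIntegral_congr_fun (T.isCompact_convex_face (T.face_cases e)).1.measurableSet
          fun x hx => ?_
        simp only [vecVal, PiLp.inner_apply, Finset.mul_sum, Finset.sum_mul]
        refine Finset.sum_congr rfl fun i _ => ?_
        rw [← hgK i (heK hx)]
        simp [hq, polyVal]
        ring
      · intro i _
        exact (T.integrableOn_face hn hΩ hreg e (hg i).continuous.continuousOn).const_mul _
    congr 1
    · exact Finset.sum_congr rfl fun e he => hface e (T.mem_innerOf.mp he).2
    · exact Finset.sum_congr rfl fun e he => hface e (T.mem_outerOf.mp he).2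
  · intro i _
    exact ((hg i).locallyIntegrable_lineDeriv _).integrableOn_isCompact (T.isCompact_elem K.2)

end Mesh

end

/-! ### Integrability of the terms and the energy identity -/

section
open Set Filter Topology

theorem memLp_top_of_continuousOn {X F : Type*} [TopologicalSpace X] [MeasurableSpace X]
    [OpensMeasurableSpace X] [SecondCountableTopology X] [T2Space X] [NormedAddCommGroup F]
    {S : Set X}
    (hS : IsCompact S) {f : X → F} (hf : ContinuousOn f S) (μ : Measure X) :
    MemLp f ⊤ (μ.restrict S) := by
  obtain ⟨C, hC⟩ := hS.exists_bound_of_continuousOn hf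
  exact memLp_top_of_bound
    (hf.aestronglyMeasurable_of_isCompact hS hS.measurableSet) C
    ((ae_restrict_iff' hS.measurableSet).mpr (Eventually.of_forall hC))

theorem memLp_top_mul {α : Type*} [MeasurableSpace α] {μ : Measure α} {f g : α → ℝ}
    (hf : MemLp f ⊤ μ) (hg : MemLp g ⊤ μ) : MemLp (fun x => f x * g x) ⊤ μ := hg.mul' hf

theorem memLp_two_mul {α : Type*} [MeasurableSpace α] {μ : Measure α} {f g : α → ℝ}
    (hf : MemLp f ⊤ μ) (hg : MemLp g 2 μ) : MemLp (fun x => f x * g x) 2 μ := hg.mul' hf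

theorem memLp_top_inner {α : Type*} [MeasurableSpace α] {μ : Measure α} {E : Type*}
    [NormedAddCommGroup E] [InnerProductSpace ℝ E] {f g : α → E}
    (hf : MemLp f ⊤ μ) (hg : MemLp g ⊤ μ) : MemLp (fun x => inner ℝ (f x) (g x)) ⊤ μ := by
  obtain ⟨C, hC0, hC⟩ := memLp_top_exists_bound hf
  obtain ⟨D, hD0, hD⟩ := memLp_top_exists_bound hg
  refine memLp_top_of_bound (hf.1.inner hg.1) (C * D) ?_
  filter_upwards [hC, hD] with x h1 h2
  exact (norm_inner_le_norm _ _).trans (mul_le_mul h1 h2 (norm_nonneg _) hC0)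

variable {n : ℕ} {k : ℕ}

theorem continuous_vecVal (u : Fin n → Poly n k) : Continuous (vecVal u) :=
  (PiLp.continuous_toLp 2 _).comp (continuous_pi fun _ => continuous_polyVal _)

theorem continuous_polyGrad (p : MvPolynomial (Fin n) ℝ) : Continuous (polyGrad p) :=
  (PiLp.continuous_toLp 2 _).comp (continuous_pi fun _ => continuous_polyVal _)

theorem continuous_vecDiv (u : Fin n → Poly n k) : Continuous (vecDiv u) :=
  continuous_finsetSum _ fun _ _ => continuous_polyVal _

namespace Mesh

variable {Ω : Set (Pt n)} {φ d τ : Pt n → ℝ} (T : Mesh n Ω)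

/-- The surface measure on a face. -/
def faceMeasure (e : T.Face) : Measure (Pt n) := (μHE[n - 1] : Measure (Pt n)).restrict e

/-- The volume measure on an element. -/
def elemMeasure (K : T.Elem) : Measure (Pt n) := (volume : Measure (Pt n)).restrict K

instance (K : T.Elem) : IsFiniteMeasure (T.elemMeasure K) :=
  ⟨by simpa [elemMeasure] using (T.isCompact_elem K.2).measure_lt_top⟩

theorem isFiniteMeasure_faceMeasure (hn : 2 ≤ n) (hΩ : IsOpen Ω)
    (hreg : interior (closure Ω) = Ω) (e : T.Face) : IsFiniteMeasure (T.faceMeasure e) :=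
  ⟨by simpa [faceMeasure] using T.faceMeasure_lt_top hn hΩ hreg e⟩

theorem isCompact_face (e : T.Face) : IsCompact (e : Set (Pt n)) :=
  (T.isCompact_convex_face (T.face_cases e)).1

theorem memLp_elem {F : Type*} [NormedAddCommGroup F] (K : T.Elem) {f : Pt n → F}
    (hf : Continuous f) : MemLp f ⊤ (T.elemMeasure K) :=
  memLp_top_of_continuousOn (T.isCompact_elem K.2) hf.continuousOn _

theorem memLp_face {F : Type*} [NormedAddCommGroup F] (e : T.Face) {f : Pt n → F}
    (hf : Continuous f) : MemLp f ⊤ (T.faceMeasure e) :=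
  memLp_top_of_continuousOn (T.isCompact_face e) hf.continuousOn _

/-- A closed element may touch the boundary of the domain, but the frontier of a convex set is null
and its interior lies in `Ω`. Hence essential bounds on `Ω` pass to elements. -/
theorem elemMeasure_le (hreg : interior (closure Ω) = Ω) (K : T.Elem) :
    T.elemMeasure K ≤ volume.restrict Ω := by
  have h1 : (volume : Measure (Pt n)).restrict K = volume.restrict (interior (K : Set (Pt n))) :=
    Measure.restrict_congr_set ((interior_ae_eq_of_null_frontier
      ((T.convex_elem K.2).addHaar_frontier _)).symm)
  rw [elemMeasure, h1]
  exact Measure.restrict_mono (T.interior_subset hreg K.2) le_rfl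

theorem lipschitz_coefB_elem (hΩ : IsOpen Ω) (hreg : interior (closure Ω) = Ω)
    (h : IsAdmissible Ω φ d) : ∃ L, ∀ K : T.Elem, LipschitzOnWith L (coefB φ d) K := by
  obtain ⟨L, hL⟩ := h.exists_lipschitzOnWith hΩ
  exact ⟨L, fun K => hL K (T.convex_elem K.2) (T.interior_nonempty K.2) (T.subset_closure K.2)
    (T.interior_subset hreg K.2)⟩

theorem memLp_coefB_elem (hΩ : IsOpen Ω) (hreg : interior (closure Ω) = Ω)
    (h : IsAdmissible Ω φ d) (K : T.Elem) : MemLp (coefB φ d) ⊤ (T.elemMeasure K) := by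
  obtain ⟨L, hL⟩ := T.lipschitz_coefB_elem hΩ hreg h
  exact memLp_top_of_continuousOn (T.isCompact_elem K.2) (hL K).continuousOn _

/-- An essential bound with respect to volume says nothing on a face. The bound comes from Lipschitz
continuity on the closed element that contains the face. -/
theorem memLp_coefB_face (hΩ : IsOpen Ω) (hreg : interior (closure Ω) = Ω)
    (h : IsAdmissible Ω φ d) (e : T.Face) : MemLp (coefB φ d) ⊤ (T.faceMeasure e) := by
  obtain ⟨L, hL⟩ := T.lipschitz_coefB_elem hΩ hreg h
  obtain ⟨K, hK, heK⟩ := T.exists_elem_superset (T.face_cases e)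
  exact memLp_top_of_continuousOn (T.isCompact_face e) ((hL ⟨K, hK⟩).continuousOn.mono heK) _

theorem subset_skeleton (e : T.Face) : (e : Set (Pt n)) ⊆ T.skeleton :=
  subset_iUnion (fun e : T.Face => (e : Set (Pt n))) e

/-- A nonempty open set contains two different points. Positivity matters because `C₁ / T.h` would
be `0` for `T.h = 0`, and the stabilization would lose its positive lower bound. -/
theorem h_pos (hn : 2 ≤ n) (K : T.Elem) : 0 < T.h := by
  have h1 : Metric.diam (K : Set (Pt n)) ≤ T.h :=
    le_ciSup (f := fun K : T.Elem => Metric.diam (K : Set (Pt n))) (Set.finite_range _).bddAbove K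
  refine lt_of_lt_of_le ?_ h1
  obtain ⟨p, hp⟩ := T.interior_nonempty K.2
  have : Nontrivial (Pt n) := by
    have : Nonempty (Fin n) := ⟨⟨0, by omega⟩⟩
    infer_instance
  have : (𝓝[≠] p).NeBot := Module.punctured_nhds_neBot ℝ (Pt n) p
  obtain ⟨q, hq, hqp⟩ := (infinite_of_mem_nhds p (mem_interior_iff_mem_nhds.mp hp)).nontrivial.exists_ne p
  exact (dist_pos.mpr hqp).trans_le (Metric.dist_le_diam_of_mem (T.isCompact_elem K.2).isBounded
    hq (_root_.interior_subset hp))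

theorem h_pos_of_face (hn : 2 ≤ n) (e : T.Face) : 0 < T.h := by
  obtain ⟨K, hK, -⟩ := T.exists_elem_superset (T.face_cases e)
  exact T.h_pos hn ⟨K, hK⟩

end Mesh

variable {Ω : Set (Pt n)} {φ d τ : Pt n → ℝ} (T : Mesh n Ω) {C₁ C₂ : ℝ}

theorem IsStabilization.pos {T : Mesh n Ω} (hτ : IsStabilization T C₁ C₂ τ) (hn : 2 ≤ n)
    (hC₁ : 0 < C₁) (e : T.Face) {x : Pt n} (hx : x ∈ (e : Set (Pt n))) : 0 < τ x :=
  (div_pos hC₁ (T.h_pos_of_face hn e)).trans_le (hτ.lower x (T.subset_skeleton e hx))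

theorem IsStabilization.memLp_face {T : Mesh n Ω} (hτ : IsStabilization T C₁ C₂ τ) (hn : 2 ≤ n)
    (hC₁ : 0 < C₁) (e : T.Face) : MemLp τ ⊤ (T.faceMeasure e) := by
  refine memLp_top_of_bound (hτ.meas.mono_measure
    (Measure.restrict_mono (T.subset_skeleton e) le_rfl)) (C₂ / T.h) ?_
  refine (ae_restrict_iff' (T.isCompact_face e).measurableSet).mpr (Eventually.of_forall ?_)
  intro x hx
  rw [Real.norm_of_nonneg (hτ.pos hn hC₁ e hx).le]
  exact hτ.upper x (T.subset_skeleton e hx)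

theorem exists_polyVal_eq_of_mem_facePoly {e : Set (Pt n)} (μ : facePoly k e) :
    ∃ p : Poly n k, ∀ x ∈ e, (μ : Pt n → ℝ) x = polyVal p x := by
  obtain ⟨p, hp, hpe⟩ := μ.2
  refine ⟨⟨p, hp⟩, fun x hx => ?_⟩
  rw [← hpe]
  simp [restrictTo, hx]

theorem memLp_facePoly {T : Mesh n Ω} (e : T.Face) (μ : facePoly k (e : Set (Pt n))) :
    MemLp (μ : Pt n → ℝ) ⊤ (T.faceMeasure e) := by
  obtain ⟨p, hp⟩ := exists_polyVal_eq_of_mem_facePoly μ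
  refine (T.memLp_face e (continuous_polyVal (p : MvPolynomial (Fin n) ℝ))).ae_eq ?_
  refine (ae_restrict_iff' (T.isCompact_face e).measurableSet).mpr (Eventually.of_forall ?_)
  exact fun x hx => (hp x hx).symm

/-- Sums over interior faces and the adjacent elements, the other way round. -/
theorem sum_inner_adjacent (F : T.Elem → T.Face → ℝ) :
    ∑ e ∈ T.inner, ∑ K ∈ T.adjacent e, F K e = ∑ K : T.Elem, ∑ e ∈ T.innerOf K, F K e := by
  classical
  refine Finset.sum_comm' fun e K => ?_
  simp [Mesh.adjacent, Mesh.innerOf]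

theorem integrable_elem {K : T.Elem} {f : Pt n → ℝ} (hf : MemLp f ⊤ (T.elemMeasure K)) :
    Integrable f (T.elemMeasure K) := hf.integrable le_top

theorem integrable_face (hn : 2 ≤ n) (hΩ : IsOpen Ω) (hreg : interior (closure Ω) = Ω)
    {e : T.Face} {f : Pt n → ℝ} (hf : MemLp f ⊤ (T.faceMeasure e)) :
    Integrable f (T.faceMeasure e) :=
  have := T.isFiniteMeasure_faceMeasure hn hΩ hreg e
  hf.integrable le_top

theorem memLp_elem_coefD_mul (hreg : interior (closure Ω) = Ω)
    (h : IsAdmissible Ω φ d) (K : T.Elem) (p : Poly n k) (v : Fin n → Poly n k) :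
    MemLp (fun x => polyVal p x * inner ℝ (coefD φ d x) (vecVal v x)) ⊤ (T.elemMeasure K) :=
  memLp_top_mul (T.memLp_elem K (continuous_polyVal _))
    (memLp_top_inner (h.coefD_bdd.mono_measure (T.elemMeasure_le hreg K))
      (T.memLp_elem K (continuous_vecVal v)))

theorem memLp_elem_coefB_div (hΩ : IsOpen Ω) (hreg : interior (closure Ω) = Ω)
    (h : IsAdmissible Ω φ d) (K : T.Elem) (p : Poly n k) (v : Fin n → Poly n k) :
    MemLp (fun x => coefB φ d x * polyVal p x * vecDiv v x) ⊤ (T.elemMeasure K) :=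
  memLp_top_mul (memLp_top_mul (T.memLp_coefB_elem hΩ hreg h K)
    (T.memLp_elem K (continuous_polyVal _))) (T.memLp_elem K (continuous_vecDiv v))

theorem memLp_elem_coefP_mul (hreg : interior (closure Ω) = Ω)
    (h : IsAdmissible Ω φ d) (K : T.Elem) (q : Poly n k) (u : Fin n → Poly n k) :
    MemLp (fun x => (1 / 2 : ℝ) * inner ℝ (coefP φ d x) (vecVal u x) * polyVal q x) ⊤
      (T.elemMeasure K) :=
  memLp_top_mul ((memLp_top_inner (h.coefP_bdd.mono_measure (T.elemMeasure_le hreg K))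
    (T.memLp_elem K (continuous_vecVal u))).const_mul _) (T.memLp_elem K (continuous_polyVal _))

theorem memLp_elem_coefB_grad (hΩ : IsOpen Ω) (hreg : interior (closure Ω) = Ω)
    (h : IsAdmissible Ω φ d) (K : T.Elem) (q : Poly n k) (u : Fin n → Poly n k) :
    MemLp (fun x => coefB φ d x *
      inner ℝ (vecVal u x) (polyGrad (q : MvPolynomial (Fin n) ℝ) x)) ⊤ (T.elemMeasure K) :=
  memLp_top_mul (T.memLp_coefB_elem hΩ hreg h K) (memLp_top_inner
    (T.memLp_elem K (continuous_vecVal u)) (T.memLp_elem K (continuous_polyGrad _)))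

theorem memLp_elem_inner (K : T.Elem) (u v : Fin n → Poly n k) :
    MemLp (fun x => inner ℝ (vecVal u x) (vecVal v x)) ⊤ (T.elemMeasure K) :=
  memLp_top_inner (T.memLp_elem K (continuous_vecVal u)) (T.memLp_elem K (continuous_vecVal v))

theorem memLp_elem_mul (K : T.Elem) (p q : Poly n k) :
    MemLp (fun x => polyVal p x * polyVal q x) ⊤ (T.elemMeasure K) :=
  memLp_top_mul (T.memLp_elem K (continuous_polyVal _)) (T.memLp_elem K (continuous_polyVal _))

theorem memLp_face_coefB_normal (hΩ : IsOpen Ω) (hreg : interior (closure Ω) = Ω)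
    (h : IsAdmissible Ω φ d) (e : T.Face) (u : Fin n → Poly n k) (ν : Pt n) :
    MemLp (fun x => coefB φ d x * inner ℝ (vecVal u x) ν) ⊤ (T.faceMeasure e) :=
  memLp_top_mul (T.memLp_coefB_face hΩ hreg h e) (memLp_top_inner
    (T.memLp_face e (continuous_vecVal u)) (T.memLp_face e continuous_const))

theorem memLp_face_coefB_trace (hΩ : IsOpen Ω) (hreg : interior (closure Ω) = Ω)
    (h : IsAdmissible Ω φ d) (e : T.Face) (μ : facePoly k (e : Set (Pt n)))
    (v : Fin n → Poly n k) (ν : Pt n) :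
    MemLp (fun x => coefB φ d x * (μ : Pt n → ℝ) x * inner ℝ (vecVal v x) ν) ⊤
      (T.faceMeasure e) :=
  memLp_top_mul (memLp_top_mul (T.memLp_coefB_face hΩ hreg h e) (memLp_facePoly e μ))
    (memLp_top_inner (T.memLp_face e (continuous_vecVal v)) (T.memLp_face e continuous_const))

theorem memLp_flux (hn : 2 ≤ n) (hΩ : IsOpen Ω) (hreg : interior (closure Ω) = Ω)
    (h : IsAdmissible Ω φ d) (hC₁ : 0 < C₁) (hτ : IsStabilization T C₁ C₂ τ) (X : Triple T k)
    (K : T.Elem) (e : T.Face) : MemLp (flux T φ d τ X K e) ⊤ (T.faceMeasure e) :=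
  (memLp_face_coefB_normal T hΩ hreg h e (X.u K) _).add (memLp_top_mul
    (hτ.memLp_face hn hC₁ e) ((T.memLp_face e (continuous_polyVal _)).sub
      (memLp_facePoly e (X.phat e))))

/-- Integration by parts reduces the volume terms with coefficients to `-φ^{-1/2} d (u · n) p` on
all faces. With `b = φ^{-1/2} d (u · n)` and flux `b + τ (p - p̂)`, an interior face carries `b p̂ +
flux · (p - p̂) - b p = τ (p - p̂)²`, and a boundary face carries `(b + τ p) p - b p = τ p²`. -/
theorem bilin_self (hn : 2 ≤ n) (hΩ : IsOpen Ω) (hreg : interior (closure Ω) = Ω)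
    (h : IsAdmissible Ω φ d) (hC₁ : 0 < C₁) (hτ : IsStabilization T C₁ C₂ τ) (X : Triple T k) :
    bilin T φ d τ X X = energy T τ X := by
  have habs : ∀ (e : T.Face) (w : Pt n → ℝ),
      faceIntegral (e : Set (Pt n)) (fun x => |τ x| * w x) =
      faceIntegral (e : Set (Pt n)) (fun x => τ x * w x) := by
    intro e w
    refine setIntegral_congr_fun (T.isCompact_face e).measurableSet fun x hx => ?_
    simp only [abs_of_pos (hτ.pos hn hC₁ e hx)]
  have hint : ∀ (K : T.Elem) (e : T.Face),
      faceIntegral (e : Set (Pt n)) (fun x => |τ x| *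
        (polyVal (X.p K) x - (X.phat e : Pt n → ℝ) x) ^ 2) =
      faceIntegral (e : Set (Pt n)) (fun x => coefB φ d x * (X.phat e : Pt n → ℝ) x *
        inner ℝ (vecVal (X.u K) x) (outwardNormal K e))
      + faceIntegral (e : Set (Pt n)) (fun x => flux T φ d τ X K e x * polyVal (X.p K) x)
      - faceIntegral (e : Set (Pt n)) (fun x => flux T φ d τ X K e x * (X.phat e : Pt n → ℝ) x)
      - faceIntegral (e : Set (Pt n)) (fun x => coefB φ d x *
        inner ℝ (vecVal (X.u K) x) (outwardNormal K e) * polyVal (X.p K) x) := by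
    intro K e
    have hfl := memLp_flux T hn hΩ hreg h hC₁ hτ X K e
    have i1 := integrable_face T hn hΩ hreg
      (memLp_face_coefB_trace T hΩ hreg h e (X.phat e) (X.u K) (outwardNormal K e))
    have i2 := integrable_face T hn hΩ hreg
      (memLp_top_mul hfl (T.memLp_face e (continuous_polyVal (X.p K : MvPolynomial (Fin n) ℝ))))
    have i3 := integrable_face T hn hΩ hreg (memLp_top_mul hfl (memLp_facePoly e (X.phat e)))
    have i4 := integrable_face T hn hΩ hreg (memLp_top_mul
      (memLp_face_coefB_normal T hΩ hreg h e (X.u K) (outwardNormal K e))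
      (T.memLp_face e (continuous_polyVal (X.p K : MvPolynomial (Fin n) ℝ))))
    have e1 := integral_add i1 i2
    have e2 := integral_sub (i1.add i2) i3
    have e3 := integral_sub ((i1.add i2).sub i3) i4
    simp only [Pi.add_apply, Pi.sub_apply, Mesh.faceMeasure] at e1 e2 e3
    rw [habs]
    simp only [faceIntegral]
    rw [← e1, ← e2, ← e3]
    refine integral_congr_ae (Eventually.of_forall fun x => ?_)
    simp only [flux]
    ring
  have hout : ∀ (K : T.Elem) (e : T.Face),
      faceIntegral (e : Set (Pt n)) (fun x => |τ x| * polyVal (X.p K) x ^ 2) =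
      faceIntegral (e : Set (Pt n)) (fun x => (coefB φ d x *
        inner ℝ (vecVal (X.u K) x) (outwardNormal K e) + τ x * polyVal (X.p K) x) *
          polyVal (X.p K) x)
      - faceIntegral (e : Set (Pt n)) (fun x => coefB φ d x *
        inner ℝ (vecVal (X.u K) x) (outwardNormal K e) * polyVal (X.p K) x) := by
    intro K e
    have hp := T.memLp_face e (continuous_polyVal (X.p K : MvPolynomial (Fin n) ℝ))
    have hb := memLp_face_coefB_normal T hΩ hreg h e (X.u K) (outwardNormal K e)
    have i1 := integrable_face T hn hΩ hreg (memLp_top_mul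
      (hb.add (memLp_top_mul (hτ.memLp_face hn hC₁ e) hp)) hp)
    have i2 := integrable_face T hn hΩ hreg (memLp_top_mul hb hp)
    have e1 := integral_sub i1 i2
    simp only [Pi.add_apply, Mesh.faceMeasure] at e1
    rw [habs]
    simp only [faceIntegral]
    rw [← e1]
    refine integral_congr_ae (Eventually.of_forall fun x => ?_)
    ring
  have hvol : ∀ K : T.Elem,
      (∫ x in (K : Set (Pt n)), polyVal (X.p K) x * inner ℝ (coefD φ d x) (vecVal (X.u K) x))
      + (∫ x in (K : Set (Pt n)), coefB φ d x * polyVal (X.p K) x * vecDiv (X.u K) x)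
      - (∫ x in (K : Set (Pt n)),
          (1 / 2 : ℝ) * inner ℝ (coefP φ d x) (vecVal (X.u K) x) * polyVal (X.p K) x)
      + (∫ x in (K : Set (Pt n)), coefB φ d x *
          inner ℝ (vecVal (X.u K) x) (polyGrad (X.p K : MvPolynomial (Fin n) ℝ) x)) =
      (∑ e ∈ T.innerOf K, faceIntegral (e : Set (Pt n)) fun x => coefB φ d x *
        inner ℝ (vecVal (X.u K) x) (outwardNormal K e) * polyVal (X.p K) x) +
      ∑ e ∈ T.outerOf K, faceIntegral (e : Set (Pt n)) fun x => coefB φ d x *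
        inner ℝ (vecVal (X.u K) x) (outwardNormal K e) * polyVal (X.p K) x := by
    intro K
    rw [← T.integral_by_parts hn hΩ hreg h K (X.u K) (X.p K)]
    have i1 := integrable_elem T (memLp_elem_coefD_mul T hreg h K (X.p K) (X.u K))
    have i2 := integrable_elem T (memLp_elem_coefB_div T hΩ hreg h K (X.p K) (X.u K))
    have i3 := integrable_elem T (memLp_elem_coefP_mul T hreg h K (X.p K) (X.u K))
    have i4 := integrable_elem T (memLp_elem_coefB_grad T hΩ hreg h K (X.p K) (X.u K))
    have e1 := integral_add i1 i2
    have e2 := integral_sub (i1.add i2) i3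
    have e3 := integral_add ((i1.add i2).sub i3) i4
    simp only [Pi.add_apply, Pi.sub_apply, Mesh.elemMeasure] at e1 e2 e3
    rw [e3, e2, e1]
  -- The jump in the third equation is split into the fluxes of the single elements, so that it can
  -- be matched with the sums over `∂K` in the other two equations.
  have hjump : ∀ e ∈ T.inner, faceIntegral (e : Set (Pt n)) (fun x =>
      (∑ K ∈ T.adjacent e, flux T φ d τ X K e x) * (X.phat e : Pt n → ℝ) x) =
      ∑ K ∈ T.adjacent e, faceIntegral (e : Set (Pt n)) fun x =>
        flux T φ d τ X K e x * (X.phat e : Pt n → ℝ) x := by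
    intro e _
    simp only [faceIntegral, Finset.sum_mul]
    exact integral_finsetSum _ fun K _ => integrable_face T hn hΩ hreg
      (memLp_top_mul (memLp_flux T hn hΩ hreg h hC₁ hτ X K e) (memLp_facePoly e (X.phat e)))
  have hvolsum := Finset.sum_congr (rfl : (Finset.univ : Finset T.Elem) = _) fun K _ => hvol K
  simp only [Finset.sum_add_distrib, Finset.sum_sub_distrib] at hvolsum
  simp only [bilin, lhs1, lhs2, lhs3, energy, hint, hout, habs, Finset.sum_add_distrib,
    Finset.sum_sub_distrib]
  rw [Finset.sum_congr rfl hjump, sum_inner_adjacent]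
  simp only [real_inner_self_eq_norm_sq, ← sq, mul_assoc] at hvolsum ⊢
  linarith

end

/-! ### The bilinear form and the load as algebraic objects -/

section
open Set Filter Topology

/-- Linearity holds pointwise under the integral. Integrability is required for every pair, because
the integral of a non-integrable function is `0` by convention and additivity could fail. -/
theorem isBilinearMap_integral {α E F : Type*} [MeasurableSpace α] {μ : Measure α}
    [AddCommMonoid E] [Module ℝ E] [AddCommMonoid F] [Module ℝ F] {B : E → F → α → ℝ}
    (hB : ∀ x, IsBilinearMap ℝ fun v w => B v w x) (hi : ∀ v w, Integrable (B v w) μ) :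
    IsBilinearMap ℝ fun v w => ∫ x, B v w x ∂μ where
  add_left v v' w := by
    rw [← integral_add (hi v w) (hi v' w)]
    exact integral_congr_ae (Eventually.of_forall fun x => (hB x).add_left v v' w)
  smul_left c v w := by
    rw [← integral_smul]
    exact integral_congr_ae (Eventually.of_forall fun x => (hB x).smul_left c v w)
  add_right v w w' := by
    rw [← integral_add (hi v w) (hi v w')]
    exact integral_congr_ae (Eventually.of_forall fun x => (hB x).add_right v w w')
  smul_right c v w := by
    rw [← integral_smul]
    exact integral_congr_ae (Eventually.of_forall fun x => (hB x).smul_right c v w)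

section Bilinear

variable {E F : Type*} [AddCommGroup E] [Module ℝ E] [AddCommGroup F] [Module ℝ F]

theorem isBilinearMap_add {B B' : E → F → ℝ} (hB : IsBilinearMap ℝ B) (hB' : IsBilinearMap ℝ B') :
    IsBilinearMap ℝ fun v w => B v w + B' v w where
  add_left v v' w := by rw [hB.add_left, hB'.add_left]; ring
  smul_left c v w := by rw [hB.smul_left, hB'.smul_left, smul_add]
  add_right v w w' := by rw [hB.add_right, hB'.add_right]; ring
  smul_right c v w := by rw [hB.smul_right, hB'.smul_right, smul_add]

theorem isBilinearMap_neg {B : E → F → ℝ} (hB : IsBilinearMap ℝ B) :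
    IsBilinearMap ℝ fun v w => -B v w where
  add_left v v' w := by rw [hB.add_left]; ring
  smul_left c v w := by rw [hB.smul_left, smul_neg]
  add_right v w w' := by rw [hB.add_right]; ring
  smul_right c v w := by rw [hB.smul_right, smul_neg]

theorem isBilinearMap_sub {B B' : E → F → ℝ} (hB : IsBilinearMap ℝ B) (hB' : IsBilinearMap ℝ B') :
    IsBilinearMap ℝ fun v w => B v w - B' v w := by
  simpa only [sub_eq_add_neg] using isBilinearMap_add hB (isBilinearMap_neg hB')

theorem isBilinearMap_sum {ι : Type*} (s : Finset ι) {B : ι → E → F → ℝ}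
    (hB : ∀ i, IsBilinearMap ℝ (B i)) : IsBilinearMap ℝ fun v w => ∑ i ∈ s, B i v w where
  add_left v v' w := by simp only [(hB _).add_left, Finset.sum_add_distrib]
  smul_left c v w := by simp only [(hB _).smul_left, Finset.smul_sum]
  add_right v w w' := by simp only [(hB _).add_right, Finset.sum_add_distrib]
  smul_right c v w := by simp only [(hB _).smul_right, Finset.smul_sum]

theorem isBilinearMap_mul {a : E → ℝ} {b : F → ℝ} (ha : IsLinearMap ℝ a) (hb : IsLinearMap ℝ b) :
    IsBilinearMap ℝ fun v w => a v * b w where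
  add_left v v' w := by rw [ha.map_add, add_mul]
  smul_left c v w := by rw [ha.map_smul, smul_mul_assoc]
  add_right v w w' := by rw [hb.map_add, mul_add]
  smul_right c v w := by rw [hb.map_smul, mul_smul_comm]

end Bilinear

section Linear

variable {E : Type*} [AddCommGroup E] [Module ℝ E]

theorem isLinearMap_integral {α : Type*} [MeasurableSpace α] {μ : Measure α} {a : E → α → ℝ}
    (ha : ∀ x, IsLinearMap ℝ fun v => a v x) (hi : ∀ v, Integrable (a v) μ) :
    IsLinearMap ℝ fun v => ∫ x, a v x ∂μ where
  map_add v w := by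
    rw [← integral_add (hi v) (hi w)]
    exact integral_congr_ae (Eventually.of_forall fun x => (ha x).map_add v w)
  map_smul c v := by
    rw [← integral_smul]
    exact integral_congr_ae (Eventually.of_forall fun x => (ha x).map_smul c v)

theorem isLinearMap_add {a b : E → ℝ} (ha : IsLinearMap ℝ a) (hb : IsLinearMap ℝ b) :
    IsLinearMap ℝ fun v => a v + b v := (ha.mk' a + hb.mk' b).isLinear

theorem isLinearMap_sub {a b : E → ℝ} (ha : IsLinearMap ℝ a) (hb : IsLinearMap ℝ b) :
    IsLinearMap ℝ fun v => a v - b v := (ha.mk' a - hb.mk' b).isLinear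

theorem isLinearMap_const_mul (c : ℝ) {a : E → ℝ} (ha : IsLinearMap ℝ a) :
    IsLinearMap ℝ fun v => c * a v := (c • ha.mk' a).isLinear

theorem isLinearMap_sum_of_mem {ι : Type*} (s : Finset ι) {a : ι → E → ℝ}
    (ha : ∀ i ∈ s, IsLinearMap ℝ (a i)) : IsLinearMap ℝ fun v => ∑ i ∈ s, a i v where
  map_add v w := by
    rw [← Finset.sum_add_distrib]
    exact Finset.sum_congr rfl fun i hi => (ha i hi).map_add v w
  map_smul c v := by
    rw [Finset.smul_sum]
    exact Finset.sum_congr rfl fun i hi => (ha i hi).map_smul c v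

theorem isLinearMap_sum {ι : Type*} (s : Finset ι) {a : ι → E → ℝ}
    (ha : ∀ i, IsLinearMap ℝ (a i)) : IsLinearMap ℝ fun v => ∑ i ∈ s, a i v :=
  isLinearMap_sum_of_mem s fun i _ => ha i

end Linear

variable {n k : ℕ}

@[simp] theorem polyVal_add (p q : MvPolynomial (Fin n) ℝ) (x : Pt n) :
    polyVal (p + q) x = polyVal p x + polyVal q x := by simp [polyVal]

@[simp] theorem polyVal_smul (c : ℝ) (p : MvPolynomial (Fin n) ℝ) (x : Pt n) :
    polyVal (c • p) x = c * polyVal p x := by simp [polyVal]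

@[simp] theorem polyVal_zero (x : Pt n) : polyVal (0 : MvPolynomial (Fin n) ℝ) x = 0 := by
  simp [polyVal]

@[simp] theorem vecVal_add (u v : Fin n → Poly n k) (x : Pt n) :
    vecVal (u + v) x = vecVal u x + vecVal v x := by
  ext i; simp [vecVal]

@[simp] theorem vecVal_smul (c : ℝ) (u : Fin n → Poly n k) (x : Pt n) :
    vecVal (c • u) x = c • vecVal u x := by
  ext i; simp [vecVal]

@[simp] theorem vecVal_zero (x : Pt n) : vecVal (0 : Fin n → Poly n k) x = 0 := by
  ext i; simp [vecVal]

@[simp] theorem polyGrad_add (p q : MvPolynomial (Fin n) ℝ) (x : Pt n) :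
    polyGrad (p + q) x = polyGrad p x + polyGrad q x := by
  ext i; simp [polyGrad]

@[simp] theorem polyGrad_smul (c : ℝ) (p : MvPolynomial (Fin n) ℝ) (x : Pt n) :
    polyGrad (c • p) x = c • polyGrad p x := by
  ext i; simp [polyGrad]

@[simp] theorem polyGrad_zero (x : Pt n) : polyGrad (0 : MvPolynomial (Fin n) ℝ) x = 0 := by
  ext i; simp [polyGrad]

@[simp] theorem vecDiv_add (u v : Fin n → Poly n k) (x : Pt n) :
    vecDiv (u + v) x = vecDiv u x + vecDiv v x := by
  simp [vecDiv, Finset.sum_add_distrib]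

@[simp] theorem vecDiv_smul (c : ℝ) (u : Fin n → Poly n k) (x : Pt n) :
    vecDiv (c • u) x = c * vecDiv u x := by
  simp [vecDiv, Finset.mul_sum]

@[simp] theorem vecDiv_zero (x : Pt n) : vecDiv (0 : Fin n → Poly n k) x = 0 := by
  simp [vecDiv]

variable {Ω : Set (Pt n)} {φ d τ : Pt n → ℝ} (T : Mesh n Ω) {C₁ C₂ : ℝ}

/-- The discrete space as a product of vector spaces. -/
abbrev TripleSpace (k : ℕ) : Type := VecSpace T k × ScalSpace T k × TraceSpace T k

/-- The triple with given components. -/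
def toTriple (w : TripleSpace T k) : Triple T k := ⟨w.1, w.2.1, w.2.2⟩

theorem toTriple_surjective : Function.Surjective (toTriple T (k := k)) :=
  fun X => ⟨(X.u, X.p, X.phat), rfl⟩

section PointwiseLinear

variable (K : T.Elem) (e : T.Face) (x c : Pt n)

theorem isLinearMap_p : IsLinearMap ℝ fun w : TripleSpace T k => polyVal ((toTriple T w).p K) x :=
  ⟨by simp [toTriple], by simp [toTriple]⟩

theorem isLinearMap_u :
    IsLinearMap ℝ fun w : TripleSpace T k => inner ℝ (vecVal ((toTriple T w).u K) x) c :=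
  ⟨by simp [toTriple, inner_add_left], by simp [toTriple, real_inner_smul_left]⟩

theorem isLinearMap_u' :
    IsLinearMap ℝ fun w : TripleSpace T k => inner ℝ c (vecVal ((toTriple T w).u K) x) :=
  ⟨by simp [toTriple, inner_add_right], by simp [toTriple, real_inner_smul_right]⟩

theorem isLinearMap_div :
    IsLinearMap ℝ fun w : TripleSpace T k => vecDiv ((toTriple T w).u K) x :=
  ⟨by simp [toTriple], by simp [toTriple]⟩

theorem isLinearMap_phat :
    IsLinearMap ℝ fun w : TripleSpace T k => ((toTriple T w).phat e : Pt n → ℝ) x :=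
  ⟨by simp [toTriple], by simp [toTriple]⟩

theorem isLinearMap_flux :
    IsLinearMap ℝ fun w : TripleSpace T k => flux T φ d τ (toTriple T w) K e x :=
  isLinearMap_add (isLinearMap_const_mul _ (isLinearMap_u T K x _))
    (isLinearMap_const_mul _ (isLinearMap_sub (isLinearMap_p T K x) (isLinearMap_phat T e x)))

end PointwiseLinear

theorem isBilinearMap_bilin (hn : 2 ≤ n) (hΩ : IsOpen Ω) (hreg : interior (closure Ω) = Ω)
    (h : IsAdmissible Ω φ d) (hC₁ : 0 < C₁) (hτ : IsStabilization T C₁ C₂ τ) :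
    IsBilinearMap ℝ fun v w : TripleSpace T k => bilin T φ d τ (toTriple T v) (toTriple T w) := by
  unfold bilin
  refine isBilinearMap_add (isBilinearMap_add ?_ ?_) ?_
  · unfold lhs1
    refine isBilinearMap_add (isBilinearMap_sub (isBilinearMap_sub ?_ ?_) ?_) ?_
    · refine isBilinearMap_sum _ fun K => isBilinearMap_integral (fun x => ?_) fun v w =>
        integrable_elem T (memLp_elem_inner T K _ _)
      exact ⟨fun v v' w => (isLinearMap_u T K x _).map_add v v',
        fun a v w => (isLinearMap_u T K x _).map_smul a v,
        fun v w w' => (isLinearMap_u' T K x _).map_add w w',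
        fun a v w => (isLinearMap_u' T K x _).map_smul a w⟩
    · exact isBilinearMap_sum _ fun K => isBilinearMap_integral (fun x =>
        isBilinearMap_mul (isLinearMap_p T K x) (isLinearMap_u' T K x _)) fun v w =>
        integrable_elem T (memLp_elem_coefD_mul T hreg h K _ _)
    · exact isBilinearMap_sum _ fun K => isBilinearMap_integral (fun x =>
        isBilinearMap_mul (isLinearMap_const_mul _ (isLinearMap_p T K x))
          (isLinearMap_div T K x)) fun v w =>
        integrable_elem T (memLp_elem_coefB_div T hΩ hreg h K _ _)
    · exact isBilinearMap_sum _ fun K => isBilinearMap_sum _ fun e => isBilinearMap_integral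
        (fun x => isBilinearMap_mul (isLinearMap_const_mul _ (isLinearMap_phat T e x))
          (isLinearMap_u T K x _)) fun v w =>
        integrable_face T hn hΩ hreg (memLp_face_coefB_trace T hΩ hreg h e _ _ _)
  · unfold lhs2
    refine isBilinearMap_add (isBilinearMap_add (isBilinearMap_sub (isBilinearMap_add
      ?_ ?_) ?_) ?_) ?_
    · exact isBilinearMap_sum _ fun K => isBilinearMap_integral (fun x =>
        isBilinearMap_mul (isLinearMap_p T K x) (isLinearMap_p T K x)) fun v w =>
        integrable_elem T (memLp_elem_mul T K _ _)
    · exact isBilinearMap_sum _ fun K => isBilinearMap_integral (fun x =>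
        isBilinearMap_mul (isLinearMap_const_mul _ (isLinearMap_u' T K x _))
          (isLinearMap_p T K x)) fun v w =>
        integrable_elem T (memLp_elem_coefP_mul T hreg h K _ _)
    · refine isBilinearMap_sum _ fun K => isBilinearMap_integral (fun x => ?_) fun v w =>
        integrable_elem T (memLp_elem_coefB_grad T hΩ hreg h K _ _)
      refine ⟨?_, ?_, ?_, ?_⟩ <;> intros <;>
        simp only [toTriple, Prod.fst_add, Prod.snd_add, Prod.smul_fst, Prod.smul_snd,
          Pi.add_apply, Pi.smul_apply, vecVal_add, vecVal_smul, inner_add_left, inner_add_right,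
          real_inner_smul_left, real_inner_smul_right, Submodule.coe_add, Submodule.coe_smul,
          polyGrad_add, polyGrad_smul, smul_eq_mul] <;> ring
    · exact isBilinearMap_sum _ fun K => isBilinearMap_sum _ fun e => isBilinearMap_integral
        (fun x => isBilinearMap_mul (isLinearMap_flux T K e x) (isLinearMap_p T K x)) fun v w =>
        integrable_face T hn hΩ hreg (memLp_top_mul (memLp_flux T hn hΩ hreg h hC₁ hτ _ K e)
          (T.memLp_face e (continuous_polyVal _)))
    · refine isBilinearMap_sum _ fun K => isBilinearMap_sum _ fun e => isBilinearMap_integral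
        (fun x => isBilinearMap_mul (isLinearMap_add
          (isLinearMap_const_mul _ (isLinearMap_u T K x _))
          (isLinearMap_const_mul _ (isLinearMap_p T K x))) (isLinearMap_p T K x)) fun v w =>
        integrable_face T hn hΩ hreg ?_
      have hp (w : TripleSpace T k) := T.memLp_face e
        (continuous_polyVal ((toTriple T w).p K : MvPolynomial (Fin n) ℝ))
      exact memLp_top_mul ((memLp_face_coefB_normal T hΩ hreg h e _ _).add
        (memLp_top_mul (hτ.memLp_face hn hC₁ e) (hp v))) (hp w)
  · unfold lhs3
    refine isBilinearMap_add (isBilinearMap_neg ?_) ?_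
    · refine isBilinearMap_sum _ fun e => isBilinearMap_integral
        (fun x => isBilinearMap_mul (isLinearMap_sum _ fun K => isLinearMap_flux T K e x)
          (isLinearMap_phat T e x)) fun v w =>
        integrable_face T hn hΩ hreg (memLp_top_mul (memLp_finsetSum _ fun K _ =>
          memLp_flux T hn hΩ hreg h hC₁ hτ _ K e) (memLp_facePoly e _))
    · exact isBilinearMap_sum _ fun e => isBilinearMap_integral
        (fun x => isBilinearMap_mul (isLinearMap_const_mul _ (isLinearMap_phat T e x))
          (isLinearMap_phat T e x)) fun v w =>
        integrable_face T hn hΩ hreg (memLp_top_mul (memLp_top_mul (hτ.memLp_face hn hC₁ e)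
          (memLp_facePoly e _)) (memLp_facePoly e _))

section Data

variable {gD f : Pt n → ℝ} {g : Pt n → Pt n}

theorem integrable_inner_data (hreg : interior (closure Ω) = Ω)
    (hg : MemLp g 2 (volume.restrict Ω)) (K : T.Elem) (v : Fin n → Poly n k) :
    Integrable (fun x => inner ℝ (g x) (vecVal v x)) (T.elemMeasure K) := by
  have hg' := hg.mono_measure (T.elemMeasure_le hreg K)
  have hv := T.memLp_elem K (continuous_vecVal v)
  obtain ⟨C, -, hC⟩ := memLp_top_exists_bound hv
  refine ((hg'.integrable one_le_two).norm.mul_const C).mono' (hg'.1.inner hv.1) ?_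
  filter_upwards [hC] with x hx
  exact (norm_inner_le_norm _ _).trans (mul_le_mul_of_nonneg_left hx (norm_nonneg _))

theorem integrable_mul_data (hreg : interior (closure Ω) = Ω)
    (hf : MemLp f 2 (volume.restrict Ω)) (K : T.Elem) (q : Poly n k) :
    Integrable (fun x => f x * polyVal q x) (T.elemMeasure K) := by
  simp only [mul_comm (f _)]
  exact (memLp_two_mul (T.memLp_elem K (continuous_polyVal _))
    (hf.mono_measure (T.elemMeasure_le hreg K))).integrable one_le_two

theorem memLp_bdry_data
    (hgD : MemLp gD 2 ((μHE[n - 1] : Measure (Pt n)).restrict (frontier Ω))) {e : T.Face}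
    (he : e ∈ T.outer) : MemLp gD 2 (T.faceMeasure e) := by
  have he' : (e : Set (Pt n)) ∈ T.boundaryFaces := by simpa [Mesh.outer] using he
  obtain ⟨K, hK, h1, h2⟩ := (T.mem_boundaryFaces _).mp he'
  exact hgD.mono_measure (Measure.restrict_mono h2 le_rfl)

theorem Mesh.outerOf_subset (K : T.Elem) : T.outerOf K ⊆ T.outer := by
  classical exact Finset.filter_subset _ _

theorem integrable_face_two (hn : 2 ≤ n) (hΩ : IsOpen Ω) (hreg : interior (closure Ω) = Ω)
    {e : T.Face} {f : Pt n → ℝ} (hf : MemLp f 2 (T.faceMeasure e)) :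
    Integrable f (T.faceMeasure e) :=
  have := T.isFiniteMeasure_faceMeasure hn hΩ hreg e
  hf.integrable one_le_two

/-- The sum of the three right-hand sides. -/
def load (φ d τ gD f : Pt n → ℝ) (g : Pt n → Pt n) (Y : Triple T k) : ℝ :=
  rhs1 T φ d gD g Y.u + rhs2 T τ gD f Y.p + rhs3 T τ gD Y.phat

theorem isLinearMap_load (hn : 2 ≤ n) (hΩ : IsOpen Ω) (hreg : interior (closure Ω) = Ω)
    (h : IsAdmissible Ω φ d) (hC₁ : 0 < C₁) (hτ : IsStabilization T C₁ C₂ τ)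
    (hgD : MemLp gD 2 ((μHE[n - 1] : Measure (Pt n)).restrict (frontier Ω)))
    (hf : MemLp f 2 (volume.restrict Ω)) (hg : MemLp (fun x => d x • g x) 2 (volume.restrict Ω)) :
    IsLinearMap ℝ fun w : TripleSpace T k => load T φ d τ gD f g (toTriple T w) := by
  have hp (w : TripleSpace T k) (K : T.Elem) (e : T.Face) := T.memLp_face e
    (continuous_polyVal ((toTriple T w).p K : MvPolynomial (Fin n) ℝ))
  have hτg (e : T.Face) (he : e ∈ T.outer) : MemLp (fun x => τ x * gD x) 2 (T.faceMeasure e) :=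
    memLp_two_mul (hτ.memLp_face hn hC₁ e) (memLp_bdry_data T hgD he)
  unfold load
  refine isLinearMap_add (isLinearMap_add (isLinearMap_sub ?_ ?_) (isLinearMap_add ?_ ?_)) ?_
  · exact isLinearMap_sum _ fun K => isLinearMap_integral (fun x => isLinearMap_u' T K x _)
      fun w => integrable_inner_data T hreg hg K _
  · refine isLinearMap_sum _ fun K => isLinearMap_sum_of_mem _ fun e he => isLinearMap_integral
      (fun x => isLinearMap_const_mul _ (isLinearMap_const_mul _ (isLinearMap_u T K x _)))
      fun w => integrable_face_two T hn hΩ hreg ?_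
    simp only [mul_comm (gD _)]
    exact memLp_two_mul (memLp_face_coefB_normal T hΩ hreg h e _ _)
      (memLp_bdry_data T hgD (T.outerOf_subset K he))
  · exact isLinearMap_sum _ fun K => isLinearMap_integral
      (fun x => isLinearMap_const_mul _ (isLinearMap_p T K x))
      fun w => integrable_mul_data T hreg hf K _
  · refine isLinearMap_sum _ fun K => isLinearMap_sum_of_mem _ fun e he => isLinearMap_integral
      (fun x => isLinearMap_const_mul _ (isLinearMap_p T K x))
      fun w => integrable_face_two T hn hΩ hreg ?_
    simp only [mul_comm (τ _ * gD _)]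
    exact memLp_two_mul (hp w K e) (hτg e (T.outerOf_subset K he))
  · refine isLinearMap_sum_of_mem _ fun e he => isLinearMap_integral
      (fun x => isLinearMap_const_mul _ (isLinearMap_phat T e x))
      fun w => integrable_face_two T hn hΩ hreg ?_
    simp only [mul_comm (τ _ * gD _)]
    exact memLp_two_mul (memLp_facePoly e _) (hτg e he)

/-- The system is equivalent to the single variational equation for the sum. -/
theorem isSolution_iff (X : Triple T k) : IsSolution T φ d τ gD f g X ↔
    ∀ Y : Triple T k, bilin T φ d τ X Y = load T φ d τ gD f g Y := by
  have h1 : lhs1 T φ d X 0 = 0 := by simp [lhs1, faceIntegral]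
  have h2 : lhs2 T φ d τ X 0 = 0 := by simp [lhs2, faceIntegral]
  have h3 : lhs3 T φ d τ X 0 = 0 := by simp [lhs3, faceIntegral]
  have r1 : rhs1 T φ d gD g (0 : VecSpace T k) = 0 := by simp [rhs1, faceIntegral]
  have r2 : rhs2 T τ gD f (0 : ScalSpace T k) = 0 := by simp [rhs2, faceIntegral]
  have r3 : rhs3 T τ gD (0 : TraceSpace T k) = 0 := by simp [rhs3, faceIntegral]
  constructor
  · rintro ⟨e1, e2, e3⟩ Y
    simp only [bilin, load, e1, e2, e3]
  · intro H
    refine ⟨fun v => ?_, fun q => ?_, fun μ => ?_⟩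
    · simpa [bilin, load, h2, h3, r2, r3] using H ⟨v, 0, 0⟩
    · simpa [bilin, load, h1, h3, r1, r3] using H ⟨0, q, 0⟩
    · simpa [bilin, load, h1, h2, r1, r2] using H ⟨0, 0, μ⟩

end Data

end

/-! ### Definiteness of the energy and unique solvability -/

section
open Set Filter Topology

variable {n k : ℕ}

/-- A polynomial that vanishes on a nonempty open set is zero. -/
theorem eq_zero_of_polyVal_eq_zero {U : Set (Pt n)} (hU : IsOpen U) (hne : U.Nonempty)
    {p : MvPolynomial (Fin n) ℝ} (hp : ∀ x ∈ U, polyVal p x = 0) : p = 0 := by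
  obtain ⟨c, hc⟩ := hne
  have hV : IsOpen ((WithLp.toLp 2 : (Fin n → ℝ) → Pt n) ⁻¹' U) :=
    hU.preimage (PiLp.continuous_toLp 2 _)
  have hmem : (WithLp.toLp 2 : (Fin n → ℝ) → Pt n) ⁻¹' U ∈ 𝓝 (WithLp.ofLp c) := hV.mem_nhds hc
  rw [nhds_pi, Filter.mem_pi] at hmem
  obtain ⟨I, -, t, ht, htU⟩ := hmem
  refine MvPolynomial.funext_set t (fun i => infinite_of_mem_nhds _ (ht i)) fun y hy => ?_
  rw [map_zero]
  exact hp (WithLp.toLp 2 y) (htU fun i _ => hy i (mem_univ i))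

theorem eq_zero_of_setIntegral_sq_eq_zero {K : Set (Pt n)} (hK : (interior K).Nonempty)
    {p : MvPolynomial (Fin n) ℝ}
    (hi : Integrable (fun x => polyVal p x ^ 2) (volume.restrict K))
    (h : ∫ x in K, polyVal p x ^ 2 = 0) : p = 0 := by
  refine eq_zero_of_polyVal_eq_zero isOpen_interior hK ?_
  have h1 := (integral_eq_zero_iff_of_nonneg (fun x => sq_nonneg _) hi).mp h
  have h2 := Measure.eqOn_open_of_ae_eq (ae_restrict_of_ae_restrict_of_subset
    (interior_subset (s := K)) h1) isOpen_interior
    ((continuous_polyVal p).pow 2).continuousOn continuousOn_const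
  exact fun x hx => by simpa using h2 hx

theorem norm_vecVal_sq (u : Fin n → Poly n k) (x : Pt n) :
    ‖vecVal u x‖ ^ 2 = ∑ i, polyVal (u i : MvPolynomial (Fin n) ℝ) x ^ 2 := by
  simp [EuclideanSpace.norm_sq_eq, vecVal]

variable {Ω : Set (Pt n)} {φ d τ : Pt n → ℝ} (T : Mesh n Ω) {C₁ C₂ : ℝ}

theorem integrable_polyVal_sq (K : T.Elem) (p : MvPolynomial (Fin n) ℝ) :
    Integrable (fun x => polyVal p x ^ 2) (T.elemMeasure K) :=
  integrable_elem T (T.memLp_elem K ((continuous_polyVal p).pow 2))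

theorem integral_norm_vecVal_sq (K : T.Elem) (u : Fin n → Poly n k) :
    ∫ x in (K : Set (Pt n)), ‖vecVal u x‖ ^ 2 =
      ∑ i, ∫ x in (K : Set (Pt n)), polyVal (u i : MvPolynomial (Fin n) ℝ) x ^ 2 := by
  simp only [norm_vecVal_sq]
  exact integral_finsetSum _ fun i _ => integrable_polyVal_sq T K _

theorem memLp_face_energy (hn : 2 ≤ n) (hC₁ : 0 < C₁) (hτ : IsStabilization T C₁ C₂ τ)
    (e : T.Face) {w : Pt n → ℝ} (hw : MemLp w ⊤ (T.faceMeasure e)) :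
    MemLp (fun x => |τ x| * w x ^ 2) ⊤ (T.faceMeasure e) := by
  simp only [sq]
  exact memLp_top_mul (hτ.memLp_face hn hC₁ e).norm (memLp_top_mul hw hw)

theorem ae_eq_zero_of_faceIntegral (hn : 2 ≤ n) (hΩ : IsOpen Ω)
    (hreg : interior (closure Ω) = Ω) (hC₁ : 0 < C₁) (hτ : IsStabilization T C₁ C₂ τ)
    (e : T.Face) {w : Pt n → ℝ} (hw : MemLp w ⊤ (T.faceMeasure e))
    (h : faceIntegral (e : Set (Pt n)) (fun x => |τ x| * w x ^ 2) = 0) :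
    ∀ᵐ x ∂(μHE[n - 1] : Measure (Pt n)).restrict e, w x = 0 := by
  have h1 := (integral_eq_zero_iff_of_nonneg
    (fun x => mul_nonneg (abs_nonneg (τ x)) (sq_nonneg (w x)))
    (integrable_face T hn hΩ hreg (memLp_face_energy T hn hC₁ hτ e hw))).mp h
  filter_upwards [h1, ae_restrict_mem (T.isCompact_face e).measurableSet] with x hx hxe
  simpa [(hτ.pos hn hC₁ e hxe).ne'] using hx

/-- The trace is represented by a polynomial on the face and by zero elsewhere. The polynomial
vanishes on the whole face by continuity, although it need not be the zero polynomial. -/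
theorem facePoly_eq_zero_of_ae (hn : 2 ≤ n) (hΩ : IsOpen Ω) (hreg : interior (closure Ω) = Ω)
    (e : T.Face) (μ : facePoly k (e : Set (Pt n)))
    (h : ∀ᵐ x ∂(μHE[n - 1] : Measure (Pt n)).restrict e, (μ : Pt n → ℝ) x = 0) : μ = 0 := by
  obtain ⟨p, -, hpe⟩ := μ.2
  have hp : ∀ x ∈ (e : Set (Pt n)), (μ : Pt n → ℝ) x = polyVal p x := by
    intro x hx
    rw [← hpe]
    simp [restrictTo, hx]
  have h0 := T.eq_zero_of_ae_face hn hΩ hreg (T.face_cases e) (continuous_polyVal p) (by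
    filter_upwards [h, ae_restrict_mem (T.isCompact_face e).measurableSet] with x hx hxe
    rw [← hp x hxe, hx])
  ext x
  by_cases hx : x ∈ (e : Set (Pt n))
  · simp [hp x hx, h0 x hx]
  · rw [← hpe]
    simp [restrictTo, hx]

/-- All five contributions are nonnegative, so each vanishes. The volume terms kill the polynomials
`u` and `p`. Then `p̂` vanishes on a boundary face by its own term, and on an interior face by `p -
p̂ = 0` seen from an adjacent element. -/
theorem eq_zero_of_energy_eq_zero (hn : 2 ≤ n) (hΩ : IsOpen Ω)
    (hreg : interior (closure Ω) = Ω) (hC₁ : 0 < C₁) (hτ : IsStabilization T C₁ C₂ τ)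
    {X : Triple T k} (hX : energy T τ X = 0) : X = ⟨0, 0, 0⟩ := by
  have n1 : ∀ K : T.Elem, 0 ≤ ∫ x in (K : Set (Pt n)), ‖vecVal (X.u K) x‖ ^ 2 :=
    fun K => integral_nonneg fun x => sq_nonneg _
  have n2 : ∀ K : T.Elem, 0 ≤ ∫ x in (K : Set (Pt n)), polyVal (X.p K) x ^ 2 :=
    fun K => integral_nonneg fun x => sq_nonneg _
  have n3 : ∀ (e : T.Face) (w : Pt n → ℝ),
      0 ≤ faceIntegral (e : Set (Pt n)) fun x => |τ x| * w x ^ 2 :=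
    fun e w => integral_nonneg fun x => mul_nonneg (abs_nonneg _) (sq_nonneg _)
  have s1 := Finset.sum_nonneg fun K (_ : K ∈ Finset.univ) => n1 K
  have s2 := Finset.sum_nonneg fun K (_ : K ∈ Finset.univ) => n2 K
  have s3 := Finset.sum_nonneg fun e (_ : e ∈ T.outer) => n3 e (X.phat e)
  have m4 := fun K : T.Elem => Finset.sum_nonneg fun e (_ : e ∈ T.outerOf K) =>
    n3 e (polyVal (X.p K))
  have s4 := Finset.sum_nonneg fun K (_ : K ∈ Finset.univ) => m4 K
  have m5 := fun K : T.Elem => Finset.sum_nonneg fun e (_ : e ∈ T.innerOf K) =>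
    n3 e fun x => polyVal (X.p K) x - (X.phat e : Pt n → ℝ) x
  have s5 := Finset.sum_nonneg fun K (_ : K ∈ Finset.univ) => m5 K
  rw [energy] at hX
  have z1 := (Finset.sum_eq_zero_iff_of_nonneg fun K _ => n1 K).mp
    (le_antisymm (by linarith) s1)
  have z2 := (Finset.sum_eq_zero_iff_of_nonneg fun K _ => n2 K).mp
    (le_antisymm (by linarith) s2)
  have z3 := (Finset.sum_eq_zero_iff_of_nonneg fun e _ => n3 e (X.phat e)).mp
    (le_antisymm (by linarith) s3)
  have z5 := (Finset.sum_eq_zero_iff_of_nonneg fun K _ => m5 K).mp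
    (le_antisymm (by linarith) s5)
  have hu : X.u = 0 := by
    funext K i
    have h1 := z1 K (Finset.mem_univ K)
    rw [integral_norm_vecVal_sq] at h1
    exact Subtype.ext (eq_zero_of_setIntegral_sq_eq_zero (T.interior_nonempty K.2)
      (integrable_polyVal_sq T K _) ((Finset.sum_eq_zero_iff_of_nonneg fun i _ =>
        integral_nonneg fun x => sq_nonneg _).mp h1 i (Finset.mem_univ i)))
  have hp : X.p = 0 := by
    funext K
    exact Subtype.ext (eq_zero_of_setIntegral_sq_eq_zero (T.interior_nonempty K.2)
      (integrable_polyVal_sq T K _) (z2 K (Finset.mem_univ K)))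
  have hphat : X.phat = 0 := by
    funext e
    refine facePoly_eq_zero_of_ae T hn hΩ hreg e _ ?_
    rcases T.face_cases e with he | he
    · obtain ⟨K, hK, L, hL, hKL, heq, -⟩ := (T.mem_interiorFaces _).mp he
      have heK : e ∈ T.innerOf ⟨K, hK⟩ :=
        T.mem_innerOf.mpr ⟨he, by rw [heq]; exact inter_subset_left⟩
      have h5 := (Finset.sum_eq_zero_iff_of_nonneg fun e _ =>
        n3 e fun x => polyVal (X.p ⟨K, hK⟩) x - (X.phat e : Pt n → ℝ) x).mp
          (z5 ⟨K, hK⟩ (Finset.mem_univ _)) e heK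
      have h6 := ae_eq_zero_of_faceIntegral T hn hΩ hreg hC₁ hτ e
        ((T.memLp_face e (continuous_polyVal _)).sub (memLp_facePoly e (X.phat e))) h5
      filter_upwards [h6] with x hx
      simpa [hp] using hx
    · exact ae_eq_zero_of_faceIntegral T hn hΩ hreg hC₁ hτ e (memLp_facePoly e _)
        (z3 e (by simpa [Mesh.outer] using he))
  exact Triple.ext hu hp hphat

instance (e : Set (Pt n)) : FiniteDimensional ℝ (facePoly k e) := by
  unfold facePoly; infer_instance

/-- The form defines a linear map from the discrete space to its dual. It is injective since an
element of the kernel has zero energy, and it is bijective since both spaces have the same finite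
dimension. -/
theorem existsUnique_isSolution {gD f : Pt n → ℝ} {g : Pt n → Pt n} (hn : 2 ≤ n) (hΩ : IsOpen Ω)
    (hreg : interior (closure Ω) = Ω)
    (h : IsAdmissible Ω φ d) (hC₁ : 0 < C₁) (hτ : IsStabilization T C₁ C₂ τ)
    (hgD : MemLp gD 2 ((μHE[n - 1] : Measure (Pt n)).restrict (frontier Ω)))
    (hf : MemLp f 2 (volume.restrict Ω)) (hg : MemLp (fun x => d x • g x) 2 (volume.restrict Ω)) :
    ∃! X : Triple T k, IsSolution T φ d τ gD f g X := by
  let A : TripleSpace T k →ₗ[ℝ] Module.Dual ℝ (TripleSpace T k) :=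
    (isBilinearMap_bilin T hn hΩ hreg h hC₁ hτ).toLinearMap
  have hA : ∀ v w, A v w = bilin T φ d τ (toTriple T v) (toTriple T w) := fun v w => rfl
  let ℓ : Module.Dual ℝ (TripleSpace T k) :=
    (isLinearMap_load T hn hΩ hreg h hC₁ hτ hgD hf hg).mk' _
  have hℓ : ∀ w, ℓ w = load T φ d τ gD f g (toTriple T w) := fun w => rfl
  have hinj : Function.Injective A := by
    refine (injective_iff_map_eq_zero A).mpr fun v hv => ?_
    have h0 : energy T τ (toTriple T v) = 0 := by
      rw [← bilin_self T hn hΩ hreg h hC₁ hτ, ← hA, hv, LinearMap.zero_apply]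
    have h1 := eq_zero_of_energy_eq_zero T hn hΩ hreg hC₁ hτ h0
    simp only [toTriple, Triple.mk.injEq] at h1
    exact Prod.ext h1.1 (Prod.ext h1.2.1 h1.2.2)
  have hsurj : Function.Surjective A :=
    (LinearMap.injective_iff_surjective_of_finrank_eq_finrank
      (Subspace.dual_finrank_eq).symm).mp hinj
  have key : ∀ w, IsSolution T φ d τ gD f g (toTriple T w) ↔ A w = ℓ := by
    intro w
    rw [isSolution_iff, LinearMap.ext_iff]
    exact ⟨fun H v => H _, fun H Y => by obtain ⟨v, rfl⟩ := toTriple_surjective T Y; exact H v⟩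
  obtain ⟨w, hw⟩ := hsurj ℓ
  refine ⟨toTriple T w, (key w).mpr hw, fun Y hY => ?_⟩
  obtain ⟨v, rfl⟩ := toTriple_surjective T Y
  rw [hinj (((key v).mp hY).trans hw.symm)]

end

/-! ### The a priori estimate -/

section
open Set Filter Topology

variable {n k : ℕ} {Ω : Set (Pt n)} {φ d τ : Pt n → ℝ} (T : Mesh n Ω) {C₁ C₂ : ℝ}

/-- The restriction of polynomials to an element as elements of `L²`. -/
def polyToL2 (k : ℕ) (K : T.Elem) : Poly n k →ₗ[ℝ] Lp ℝ 2 (T.elemMeasure K) where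
  toFun p := MemLp.toLp _ ((T.memLp_elem K
    (continuous_polyVal (p : MvPolynomial (Fin n) ℝ))).mono_exponent (le_top (a := 2)))
  map_add' p q := by
    rw [← MemLp.toLp_add]
    congr 1
    funext x
    simp
  map_smul' c p := by
    rw [RingHom.id_apply, ← MemLp.toLp_const_smul]
    congr 1
    funext x
    simp

theorem norm_polyToL2_sq (K : T.Elem) (p : Poly n k) :
    ‖polyToL2 T k K p‖ ^ 2 = ∫ x in (K : Set (Pt n)), polyVal p x ^ 2 := by
  rw [← real_inner_self_eq_norm_sq, L2.inner_def]
  refine integral_congr_ae ?_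
  filter_upwards [MemLp.coeFn_toLp ((T.memLp_elem K
    (continuous_polyVal (p : MvPolynomial (Fin n) ℝ))).mono_exponent (le_top (a := 2)))] with x hx
  rw [polyToL2, LinearMap.coe_mk, AddHom.coe_mk, hx, real_inner_self_eq_norm_sq, Real.norm_eq_abs,
    sq_abs]

/-- The restriction of polynomials to an element as continuous functions. -/
def polyToC (k : ℕ) (K : T.Elem) : Poly n k →ₗ[ℝ] C((K : Set (Pt n)), ℝ) where
  toFun p := ⟨fun x => polyVal (p : MvPolynomial (Fin n) ℝ) x,
    (continuous_polyVal (p : MvPolynomial (Fin n) ℝ)).comp continuous_subtype_val⟩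
  map_add' p q := ContinuousMap.ext fun x => polyVal_add (p : MvPolynomial (Fin n) ℝ) q x
  map_smul' c p := ContinuousMap.ext fun x => polyVal_smul c (p : MvPolynomial (Fin n) ℝ) x

/-- On a polynomial space of finite dimension the maximum norm is bounded by the `L²` norm. -/
theorem exists_polyVal_sq_le (K : T.Elem) : ∃ C : ℝ, 0 ≤ C ∧ ∀ p : Poly n k,
    ∀ x ∈ (K : Set (Pt n)), polyVal p x ^ 2 ≤ C * ∫ x in (K : Set (Pt n)), polyVal p x ^ 2 := by
  have : CompactSpace (K : Set (Pt n)) := isCompact_iff_compactSpace.mp (T.isCompact_elem K.2)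
  have hinj : Function.Injective (polyToL2 T k K) := by
    refine (injective_iff_map_eq_zero _).mpr fun p hp => ?_
    have h0 := norm_polyToL2_sq T K p
    rw [hp, norm_zero, zero_pow two_ne_zero] at h0
    exact Subtype.ext (eq_zero_of_setIntegral_sq_eq_zero (T.interior_nonempty K.2)
      (integrable_polyVal_sq T K _) h0.symm)
  -- Restriction to continuous functions, composed with the inverse of the injection into `L²`, is a
  -- linear map on a finite-dimensional normed space and hence bounded. The square of its norm is
  -- the constant.
  let e := LinearEquiv.ofInjective (polyToL2 T k K) hinj
  let M := LinearMap.toContinuousLinearMap ((polyToC T k K).comp e.symm.toLinearMap)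
  refine ⟨‖M‖ ^ 2, sq_nonneg _, fun p x hx => ?_⟩
  have h1 : ‖polyToC T k K p‖ ≤ ‖M‖ * ‖polyToL2 T k K p‖ := by
    have h2 := M.le_opNorm (e p)
    have h3 : M (e p) = polyToC T k K p := by simp [M]
    rwa [h3] at h2
  have h4 : |polyVal p x| ≤ ‖polyToC T k K p‖ := (polyToC T k K p).norm_coe_le_norm ⟨x, hx⟩
  rw [← norm_polyToL2_sq, ← mul_pow, ← sq_abs]
  exact pow_le_pow_left₀ (abs_nonneg _) (h4.trans h1) 2

theorem exists_norm_vecVal_sq_le (k : ℕ) : ∃ C : ℝ, 0 ≤ C ∧ ∀ (K : T.Elem) (u : Fin n → Poly n k),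
    ∀ x ∈ (K : Set (Pt n)), ‖vecVal u x‖ ^ 2 ≤ C * ∫ x in (K : Set (Pt n)), ‖vecVal u x‖ ^ 2 := by
  choose C hC0 hC using fun K : T.Elem => exists_polyVal_sq_le T (k := k) K
  refine ⟨∑ K, C K, Finset.sum_nonneg fun K _ => hC0 K, fun K u x hx => ?_⟩
  refine le_trans ?_ (mul_le_mul_of_nonneg_right (Finset.single_le_sum (fun K _ => hC0 K)
    (Finset.mem_univ K)) (integral_nonneg fun x => sq_nonneg _))
  rw [norm_vecVal_sq, integral_norm_vecVal_sq, Finset.mul_sum]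
  exact Finset.sum_le_sum fun i _ => hC K (u i) x hx

theorem exists_coefB_bound (hΩ : IsOpen Ω) (hreg : interior (closure Ω) = Ω)
    (h : IsAdmissible Ω φ d) : ∃ β : ℝ, 0 ≤ β ∧ ∀ (K : T.Elem),
      ∀ x ∈ (K : Set (Pt n)), |coefB φ d x| ≤ β := by
  obtain ⟨L, hL⟩ := T.lipschitz_coefB_elem hΩ hreg h
  choose b hb using fun K : T.Elem =>
    (T.isCompact_elem K.2).exists_bound_of_continuousOn (hL K).continuousOn
  refine ⟨∑ K, |b K|, Finset.sum_nonneg fun K _ => abs_nonneg _, fun K x hx => ?_⟩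
  exact (hb K x hx).trans ((le_abs_self _).trans
    (Finset.single_le_sum (fun K _ => abs_nonneg (b K)) (Finset.mem_univ K)))

theorem Mesh.h_nonneg : 0 ≤ T.h := Real.iSup_nonneg fun _ => Metric.diam_nonneg

section Estimate

variable {gD f : Pt n → ℝ} {g : Pt n → Pt n}

theorem integrable_sq_data (hreg : interior (closure Ω) = Ω) {F : Type*} [NormedAddCommGroup F]
    {w : Pt n → F} (hw : MemLp w 2 (volume.restrict Ω)) (K : T.Elem) :
    Integrable (fun x => ‖w x‖ ^ 2) (T.elemMeasure K) :=
  (hw.mono_measure (T.elemMeasure_le hreg K)).integrable_norm_pow two_ne_zero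

theorem integrable_bdry_sq (hn : 2 ≤ n) (hC₁ : 0 < C₁) (hτ : IsStabilization T C₁ C₂ τ)
    (hgD : MemLp gD 2 ((μHE[n - 1] : Measure (Pt n)).restrict (frontier Ω))) {e : T.Face}
    (he : e ∈ T.outer) : Integrable (fun x => |τ x| * gD x ^ 2) (T.faceMeasure e) := by
  obtain ⟨C, -, hC⟩ := memLp_top_exists_bound (hτ.memLp_face hn hC₁ e)
  have h1 := (memLp_bdry_data T hgD he).integrable_sq
  refine (h1.const_mul C).mono' (((hτ.memLp_face hn hC₁ e).1.norm).mul h1.1) ?_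
  filter_upwards [hC] with x hx
  rw [norm_mul, Real.norm_of_nonneg (sq_nonneg (gD x)), Real.norm_eq_abs, abs_abs]
  exact mul_le_mul_of_nonneg_right hx (sq_nonneg _)

/-- Young's inequality, from `(‖g‖ - ‖v‖ / 2)² ≥ 0`. The factor one quarter lets two such terms be
absorbed into half of the energy. -/
theorem integral_inner_le (hreg : interior (closure Ω) = Ω)
    (hg : MemLp g 2 (volume.restrict Ω)) (K : T.Elem) (v : Fin n → Poly n k) :
    ∫ x in (K : Set (Pt n)), inner ℝ (g x) (vecVal v x) ≤
      (∫ x in (K : Set (Pt n)), ‖g x‖ ^ 2) +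
      (1 / 4) * ∫ x in (K : Set (Pt n)), ‖vecVal v x‖ ^ 2 := by
  have i1 : Integrable _ (volume.restrict (K : Set (Pt n))) := integrable_sq_data T hreg hg K
  have i2 : Integrable (fun x => ‖vecVal v x‖ ^ 2) (volume.restrict (K : Set (Pt n))) :=
    integrable_elem T (T.memLp_elem K ((continuous_vecVal v).norm.pow 2))
  rw [← integral_const_mul, ← integral_add i1 (i2.const_mul _)]
  refine integral_mono (integrable_inner_data T hreg hg K v) (i1.add (i2.const_mul _)) fun x => ?_
  have h1 := real_inner_le_norm (g x) (vecVal v x)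
  nlinarith [sq_nonneg (‖g x‖ - ‖vecVal v x‖ / 2)]

theorem integral_mul_le (hreg : interior (closure Ω) = Ω)
    (hf : MemLp f 2 (volume.restrict Ω)) (K : T.Elem) (q : Poly n k) :
    ∫ x in (K : Set (Pt n)), f x * polyVal q x ≤
      (∫ x in (K : Set (Pt n)), ‖f x‖ ^ 2) +
      (1 / 4) * ∫ x in (K : Set (Pt n)), polyVal q x ^ 2 := by
  have i1 : Integrable _ (volume.restrict (K : Set (Pt n))) := integrable_sq_data T hreg hf K
  have i2 : Integrable _ (volume.restrict (K : Set (Pt n))) := integrable_polyVal_sq T K q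
  rw [← integral_const_mul, ← integral_add i1 (i2.const_mul _)]
  refine integral_mono (integrable_mul_data T hreg hf K q) (i1.add (i2.const_mul _)) fun x => ?_
  simp only [Real.norm_eq_abs, sq_abs]
  nlinarith [sq_nonneg (f x - polyVal q x / 2)]

theorem faceIntegral_data_mul_le (hn : 2 ≤ n) (hΩ : IsOpen Ω) (hreg : interior (closure Ω) = Ω)
    (hC₁ : 0 < C₁) (hτ : IsStabilization T C₁ C₂ τ)
    (hgD : MemLp gD 2 ((μHE[n - 1] : Measure (Pt n)).restrict (frontier Ω))) {e : T.Face}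
    (he : e ∈ T.outer) {w : Pt n → ℝ} (hw : MemLp w ⊤ (T.faceMeasure e)) :
    faceIntegral (e : Set (Pt n)) (fun x => τ x * gD x * w x) ≤
      faceIntegral (e : Set (Pt n)) (fun x => |τ x| * gD x ^ 2) +
      (1 / 4) * faceIntegral (e : Set (Pt n)) (fun x => |τ x| * w x ^ 2) := by
  have i1 := integrable_bdry_sq T hn hC₁ hτ hgD he
  have i2 := integrable_face T hn hΩ hreg (memLp_face_energy T hn hC₁ hτ e hw)
  have i3 : Integrable (fun x => τ x * gD x * w x) (T.faceMeasure e) := by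
    simp only [mul_comm (τ _ * gD _)]
    exact integrable_face_two T hn hΩ hreg (memLp_two_mul hw
      (memLp_two_mul (hτ.memLp_face hn hC₁ e) (memLp_bdry_data T hgD he)))
  have e1 := integral_add i1 (i2.const_mul (1 / 4))
  simp only [Mesh.faceMeasure] at e1 i3
  simp only [faceIntegral]
  rw [← integral_const_mul, ← e1]
  refine integral_mono_ae i3 (i1.add (i2.const_mul _)) ?_
  filter_upwards [ae_restrict_mem (T.isCompact_face e).measurableSet] with x hx
  have h0 := hτ.pos hn hC₁ e hx
  simp only [abs_of_pos h0]
  nlinarith [mul_nonneg h0.le (sq_nonneg (gD x - w x / 2))]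

/-- The energy contains no trace of `u`, so its values on the face are controlled by a bound `S` on
the element. The lower bound on `τ` turns `g_D²` into `(h / C₁) τ g_D²`, and the free weight `M`
permits the `u` term to be made as small as needed. -/
theorem neg_faceIntegral_data_normal_le (hn : 2 ≤ n) (hΩ : IsOpen Ω)
    (hreg : interior (closure Ω) = Ω) (h : IsAdmissible Ω φ d)
    (hC₁ : 0 < C₁) (hτ : IsStabilization T C₁ C₂ τ)
    (hgD : MemLp gD 2 ((μHE[n - 1] : Measure (Pt n)).restrict (frontier Ω))) {K : T.Elem}
    {e : T.Face} (he : e ∈ T.outerOf K) (u : Fin n → Poly n k) {β S M : ℝ}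
    (hβ : ∀ x ∈ (K : Set (Pt n)), |coefB φ d x| ≤ β)
    (hS : ∀ x ∈ (K : Set (Pt n)), ‖vecVal u x‖ ^ 2 ≤ S) (hM : 0 < M) :
    -faceIntegral (e : Set (Pt n)) (fun x =>
        gD x * (coefB φ d x * inner ℝ (vecVal u x) (outwardNormal K e))) ≤
      M * faceIntegral (e : Set (Pt n)) (fun x => |τ x| * gD x ^ 2) +
      (1 / (4 * M)) * (β ^ 2 * (T.h / C₁) * S * (T.faceMeasure e).real univ) := by
  have := T.isFiniteMeasure_faceMeasure hn hΩ hreg e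
  have heo := T.outerOf_subset K he
  have heK : (e : Set (Pt n)) ⊆ K := (T.mem_outerOf.mp he).2
  have i1 := integrable_bdry_sq T hn hC₁ hτ hgD heo
  have i3 : Integrable (fun x => gD x * (coefB φ d x *
      inner ℝ (vecVal u x) (outwardNormal K e))) (T.faceMeasure e) := by
    simp only [mul_comm (gD _)]
    exact integrable_face_two T hn hΩ hreg (memLp_two_mul
      (memLp_face_coefB_normal T hΩ hreg h e _ _) (memLp_bdry_data T hgD heo))
  have i2 : Integrable (fun _ : Pt n => (1 / (4 * M)) * (β ^ 2 * (T.h / C₁) * S))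
    (T.faceMeasure e) := integrable_const _
  have e1 := integral_add (i1.const_mul M) i2
  rw [integral_const, smul_eq_mul, integral_const_mul] at e1
  have e2 : M * faceIntegral (e : Set (Pt n)) (fun x => |τ x| * gD x ^ 2) +
      (1 / (4 * M)) * (β ^ 2 * (T.h / C₁) * S * (T.faceMeasure e).real univ) =
      ∫ x, M * (|τ x| * gD x ^ 2) + (1 / (4 * M)) * (β ^ 2 * (T.h / C₁) * S)
        ∂(T.faceMeasure e) := by
    rw [e1, faceIntegral, Mesh.faceMeasure]
    ring
  rw [e2, faceIntegral, ← integral_neg]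
  refine integral_mono_ae i3.neg ((i1.const_mul M).add i2) ?_
  filter_upwards [ae_restrict_mem (T.isCompact_face e).measurableSet] with x hx
  have h0 := hτ.pos hn hC₁ e hx
  have hh := T.h_pos hn K
  have hν : ‖outwardNormal (K : Set (Pt n)) e‖ = 1 :=
    (T.isOutwardNormal hn hΩ hreg (T.face_cases e) K.2).1
  set b := coefB φ d x * inner ℝ (vecVal u x) (outwardNormal K e) with hb
  have hb2 : b ^ 2 ≤ β ^ 2 * S := by
    rw [hb, mul_pow]
    refine mul_le_mul ?_ ?_ (sq_nonneg _) (sq_nonneg _)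
    · exact sq_le_sq' (abs_le.mp (hβ x (heK hx))).1 (abs_le.mp (hβ x (heK hx))).2
    · refine le_trans ?_ (hS x (heK hx))
      rw [← sq_abs]
      refine pow_le_pow_left₀ (abs_nonneg _) ?_ 2
      simpa [hν] using abs_real_inner_le_norm (vecVal u x) (outwardNormal (K : Set (Pt n)) e)
  have hτ1 : 1 ≤ τ x * (T.h / C₁) := by
    have h2 := hτ.lower x (T.subset_skeleton e hx)
    have h3 : C₁ / T.h * (T.h / C₁) = 1 := by field_simp
    rw [← h3]
    exact mul_le_mul_of_nonneg_right h2 (by positivity)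
  set r := T.h / C₁ with hr
  have hr0 : 0 < r := div_pos hh hC₁
  have hSb : 0 ≤ β ^ 2 * S := (sq_nonneg b).trans hb2
  have hy : (1 / (4 * M)) * b ^ 2 * r ≤ (1 / (4 * M)) * (β ^ 2 * r * S) := by
    have : b ^ 2 * r ≤ β ^ 2 * S * r := mul_le_mul_of_nonneg_right hb2 hr0.le
    rw [mul_assoc]
    refine mul_le_mul_of_nonneg_left (by linarith) (by positivity)
  -- This is the square of `gD + r b / (2 M)` with weight `M / r`, followed by `1 ≤ τ r`.
  have hz : -(gD x * b) ≤ M * (τ x * gD x ^ 2) + (1 / (4 * M)) * b ^ 2 * r := by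
    have h5 : gD x ^ 2 ≤ τ x * r * gD x ^ 2 := le_mul_of_one_le_left (sq_nonneg _) hτ1
    have h6 : 0 ≤ M / r * (gD x + r * b / (2 * M)) ^ 2 := by positivity
    have h7 : M / r * (gD x + r * b / (2 * M)) ^ 2 =
        M / r * gD x ^ 2 + gD x * b + (1 / (4 * M)) * b ^ 2 * r := by
      field_simp
      ring
    have h8 : M / r * gD x ^ 2 ≤ M * (τ x * gD x ^ 2) := by
      calc M / r * gD x ^ 2 ≤ M / r * (τ x * r * gD x ^ 2) :=
            mul_le_mul_of_nonneg_left h5 (by positivity)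
        _ = M * (τ x * gD x ^ 2) := by field_simp
    linarith
  simp only [abs_of_pos h0]
  linarith

theorem bdryNormSq_nonneg (τ gD : Pt n → ℝ) : 0 ≤ bdryNormSq T τ gD :=
  Finset.sum_nonneg fun _ _ => integral_nonneg fun _ => mul_nonneg (abs_nonneg _) (sq_nonneg _)

theorem volNormSq_nonneg {F : Type*} [NormedAddCommGroup F] (w : Pt n → F) : 0 ≤ volNormSq T w :=
  Finset.sum_nonneg fun _ _ => integral_nonneg fun _ => sq_nonneg _

/-- Each term of the load is split by Young's inequality so that every part of the energy is used at
most with factor one half; `‖u‖²` occurs twice with one quarter. The constant is fixed before `τ`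
and the data. -/
theorem exists_load_le (k : ℕ) (hn : 2 ≤ n) (hΩ : IsOpen Ω) (hreg : interior (closure Ω) = Ω)
    (h : IsAdmissible Ω φ d) (hC₁ : 0 < C₁) (C₂ : ℝ) :
    ∃ c : ℝ, 0 < c ∧ ∀ τ : Pt n → ℝ, IsStabilization T C₁ C₂ τ →
      ∀ (gD f : Pt n → ℝ) (g : Pt n → Pt n),
        MemLp gD 2 ((μHE[n - 1] : Measure (Pt n)).restrict (frontier Ω)) →
        MemLp f 2 (volume.restrict Ω) →
        MemLp (fun x => d x • g x) 2 (volume.restrict Ω) →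
        ∀ X : Triple T k, load T φ d τ gD f g X ≤ (1 / 2) * energy T τ X +
          c * (bdryNormSq T τ gD + volNormSq T (fun x => d x • g x) + volNormSq T f) := by
  obtain ⟨β, hβ0, hβ⟩ := exists_coefB_bound T hΩ hreg h
  obtain ⟨C, hC0, hC⟩ := exists_norm_vecVal_sq_le T k
  set m : T.Face → ℝ := fun e => (T.faceMeasure e).real univ with hm
  set r := β ^ 2 * (T.h / C₁) * C with hr
  have hr0 : 0 ≤ r := by have := T.h_nonneg; positivity
  set A := ∑ e, r * m e with hA
  have hA0 : 0 ≤ A := Finset.sum_nonneg fun e _ => mul_nonneg hr0 measureReal_nonneg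
  set N : ℝ := (Fintype.card T.Elem : ℝ) with hN
  have hN0 : 0 ≤ N := Nat.cast_nonneg _
  -- The boundary data enter with `N (A + 1)` from the first equation, `N` from the second and `1`
  -- from the third. The number `N` of elements arises because the boundary sum of each element is
  -- bounded by the whole boundary norm.
  refine ⟨N * (A + 1) + N + 1, by positivity, fun τ hτ gD f g hgD hf hg X => ?_⟩
  have nn : ∀ (e : T.Face) (w : Pt n → ℝ),
      0 ≤ faceIntegral (e : Set (Pt n)) fun x => |τ x| * w x ^ 2 :=
    fun e w => integral_nonneg fun x => mul_nonneg (abs_nonneg _) (sq_nonneg _)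
  have hB0 := bdryNormSq_nonneg T τ gD
  have hBK : ∀ K : T.Elem, ∑ e ∈ T.outerOf K,
      faceIntegral (e : Set (Pt n)) (fun x => |τ x| * gD x ^ 2) ≤ bdryNormSq T τ gD := fun K =>
    Finset.sum_le_sum_of_subset_of_nonneg (T.outerOf_subset K) fun e _ _ => nn e gD
  have t1 : ∑ K : T.Elem, ∫ x in (K : Set (Pt n)), inner ℝ (d x • g x) (vecVal (X.u K) x) ≤
      volNormSq T (fun x => d x • g x) +
      (1 / 4) * ∑ K : T.Elem, ∫ x in (K : Set (Pt n)), ‖vecVal (X.u K) x‖ ^ 2 := by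
    rw [volNormSq, Finset.mul_sum, ← Finset.sum_add_distrib]
    exact Finset.sum_le_sum fun K _ => integral_inner_le T hreg hg K (X.u K)
  have t3 : ∑ K : T.Elem, ∫ x in (K : Set (Pt n)), f x * polyVal (X.p K) x ≤ volNormSq T f +
      (1 / 4) * ∑ K : T.Elem, ∫ x in (K : Set (Pt n)), polyVal (X.p K) x ^ 2 := by
    rw [volNormSq, Finset.mul_sum, ← Finset.sum_add_distrib]
    exact Finset.sum_le_sum fun K _ => integral_mul_le T hreg hf K (X.p K)
  have t5 : rhs3 T τ gD X.phat ≤ bdryNormSq T τ gD + (1 / 4) * ∑ e ∈ T.outer,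
      faceIntegral (e : Set (Pt n)) fun x => |τ x| * (X.phat e : Pt n → ℝ) x ^ 2 := by
    rw [rhs3, bdryNormSq, Finset.mul_sum, ← Finset.sum_add_distrib]
    exact Finset.sum_le_sum fun e he => faceIntegral_data_mul_le T hn hΩ hreg hC₁ hτ hgD he
      (memLp_facePoly e _)
  have t4 : ∑ K : T.Elem, ∑ e ∈ T.outerOf K, faceIntegral (e : Set (Pt n)) (fun x =>
      τ x * gD x * polyVal (X.p K) x) ≤ N * bdryNormSq T τ gD +
      (1 / 4) * ∑ K : T.Elem, ∑ e ∈ T.outerOf K, faceIntegral (e : Set (Pt n)) fun x =>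
        |τ x| * polyVal (X.p K) x ^ 2 := by
    have hsum : N * bdryNormSq T τ gD = ∑ _K : T.Elem, bdryNormSq T τ gD := by
      simp [hN]
    rw [hsum, Finset.mul_sum, ← Finset.sum_add_distrib]
    refine Finset.sum_le_sum fun K _ => ?_
    refine le_trans ?_ (add_le_add_left (hBK K) _)
    rw [Finset.mul_sum, ← Finset.sum_add_distrib]
    exact Finset.sum_le_sum fun e he => faceIntegral_data_mul_le T hn hΩ hreg hC₁ hτ hgD
      (T.outerOf_subset K he) (T.memLp_face e (continuous_polyVal _))
  have t2 : -(∑ K : T.Elem, ∑ e ∈ T.outerOf K, faceIntegral (e : Set (Pt n)) fun x =>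
      gD x * (coefB φ d x * inner ℝ (vecVal (X.u K) x) (outwardNormal K e))) ≤
      N * ((A + 1) * bdryNormSq T τ gD) +
      (1 / 4) * ∑ K : T.Elem, ∫ x in (K : Set (Pt n)), ‖vecVal (X.u K) x‖ ^ 2 := by
    have hsum : N * ((A + 1) * bdryNormSq T τ gD) =
        ∑ _K : T.Elem, (A + 1) * bdryNormSq T τ gD := by
      simp [hN]
    rw [hsum, Finset.mul_sum, ← Finset.sum_add_distrib, ← Finset.sum_neg_distrib]
    refine Finset.sum_le_sum fun K _ => ?_
    set U := ∫ x in (K : Set (Pt n)), ‖vecVal (X.u K) x‖ ^ 2 with hU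
    have hU0 : 0 ≤ U := integral_nonneg fun x => sq_nonneg _
    have hle : ∑ e ∈ T.outerOf K, r * m e ≤ A :=
      Finset.sum_le_sum_of_subset_of_nonneg (Finset.subset_univ _) fun e _ _ =>
        mul_nonneg hr0 measureReal_nonneg
    -- The weight `M = A + 1` is positive and dominates the sum over the boundary faces, which
    -- limits the coefficient of `‖u‖²` to one quarter.
    have h4 : (1 / (4 * (A + 1))) * ∑ e ∈ T.outerOf K, r * m e ≤ 1 / 4 := by
      rw [one_div_mul_eq_div, div_le_div_iff₀ (by positivity) (by norm_num)]
      linarith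
    have h5 := mul_le_mul_of_nonneg_right h4 hU0
    have h6 := mul_le_mul_of_nonneg_left (hBK K) (by positivity : 0 ≤ A + 1)
    rw [← Finset.sum_neg_distrib]
    refine le_trans (Finset.sum_le_sum fun e he => neg_faceIntegral_data_normal_le T hn hΩ hreg h
      hC₁ hτ hgD he (X.u K) (hβ K) (hC K (X.u K)) (by positivity : 0 < A + 1)) ?_
    refine le_trans (le_of_eq ?_) (add_le_add h6 h5)
    rw [Finset.sum_add_distrib, Finset.mul_sum, Finset.mul_sum, Finset.sum_mul]
    congr 1
    refine Finset.sum_congr rfl fun e _ => ?_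
    simp only [hr, hm]
    ring
  have s5 : 0 ≤ ∑ K : T.Elem, ∑ e ∈ T.innerOf K, faceIntegral (e : Set (Pt n)) fun x =>
      |τ x| * (polyVal (X.p K) x - (X.phat e : Pt n → ℝ) x) ^ 2 :=
    Finset.sum_nonneg fun K _ => Finset.sum_nonneg fun e _ => nn e _
  have s1 : 0 ≤ ∑ K : T.Elem, ∫ x in (K : Set (Pt n)), polyVal (X.p K) x ^ 2 :=
    Finset.sum_nonneg fun K _ => integral_nonneg fun x => sq_nonneg _
  have s3 : 0 ≤ ∑ e ∈ T.outer, faceIntegral (e : Set (Pt n)) fun x =>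
      |τ x| * (X.phat e : Pt n → ℝ) x ^ 2 := Finset.sum_nonneg fun e _ => nn e _
  have s4 : 0 ≤ ∑ K : T.Elem, ∑ e ∈ T.outerOf K, faceIntegral (e : Set (Pt n)) fun x =>
      |τ x| * polyVal (X.p K) x ^ 2 :=
    Finset.sum_nonneg fun K _ => Finset.sum_nonneg fun e _ => nn e _
  have v1 := volNormSq_nonneg T fun x => d x • g x
  have v2 := volNormSq_nonneg T f
  have v3 : 0 ≤ (N * (A + 1) + N) * (volNormSq T (fun x => d x • g x) + volNormSq T f) := by
    positivity
  rw [load, rhs1, rhs2, energy]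
  linarith

theorem exists_volNormSq_smul_le (hreg : interior (closure Ω) = Ω)
    (h : IsAdmissible Ω φ d) :
    ∃ D : ℝ, 0 ≤ D ∧ ∀ g : Pt n → Pt n, MemLp g 2 (volume.restrict Ω) →
      volNormSq T (fun x => d x • g x) ≤ D * volNormSq T g := by
  choose b hb using fun K : T.Elem => (T.isCompact_elem K.2).exists_bound_of_continuousOn
    (h.d_cont.mono (T.subset_closure K.2))
  refine ⟨∑ K, b K ^ 2, Finset.sum_nonneg fun K _ => sq_nonneg _, fun g hg => ?_⟩
  rw [volNormSq, volNormSq, Finset.mul_sum]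
  refine Finset.sum_le_sum fun K _ => ?_
  have i1 : Integrable _ (volume.restrict (K : Set (Pt n))) := integrable_sq_data T hreg hg K
  rw [← integral_const_mul]
  refine integral_mono_of_nonneg (Eventually.of_forall fun x => sq_nonneg _) (i1.const_mul _) ?_
  filter_upwards [ae_restrict_mem (T.isCompact_elem K.2).measurableSet] with x hx
  simp only [norm_smul, mul_pow]
  refine mul_le_mul_of_nonneg_right ?_ (sq_nonneg _)
  exact (pow_le_pow_left₀ (norm_nonneg _) (hb K x hx) 2).trans
    (Finset.single_le_sum (fun K _ => sq_nonneg (b K)) (Finset.mem_univ K))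

/-- Tested with the solution itself, the load equals the energy, so half of it can be absorbed on
the left. -/
theorem energy_le_of_isSolution {c : ℝ} (hn : 2 ≤ n) (hΩ : IsOpen Ω)
    (hreg : interior (closure Ω) = Ω)
    (h : IsAdmissible Ω φ d) (hC₁ : 0 < C₁) (hτ : IsStabilization T C₁ C₂ τ) {X : Triple T k}
    (hX : IsSolution T φ d τ gD f g X) {R : ℝ}
    (hl : load T φ d τ gD f g X ≤ (1 / 2) * energy T τ X + c * R) :
    energy T τ X ≤ 2 * c * R := by
  rw [← (isSolution_iff T X).mp hX X, bilin_self T hn hΩ hreg h hC₁ hτ] at hl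
  linarith

end Estimate

end

end HDG

end

theorem mainTheorem1 {n : ℕ} (hn : n = 2 ∨ n = 3) {Ω : Set (HDG.Pt n)}
    (hΩ : IsOpen Ω) (hΩreg : interior (closure Ω) = Ω) (T : HDG.Mesh n Ω) (k : ℕ)
    (φ d : HDG.Pt n → ℝ) (hφd : HDG.IsAdmissible Ω φ d)
    (C₁ C₂ : ℝ) (hC₁ : 0 < C₁) (hC₂ : C₁ ≤ C₂) :
    ∃ c : ℝ, 0 < c ∧ ∀ τ : HDG.Pt n → ℝ, HDG.IsStabilization T C₁ C₂ τ →
      (∀ X : HDG.Triple T k, HDG.bilin T φ d τ X X = HDG.energy T τ X) ∧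
      ∀ (gD f : HDG.Pt n → ℝ) (g : HDG.Pt n → HDG.Pt n),
        MemLp gD 2 ((μHE[n - 1] : Measure (HDG.Pt n)).restrict (frontier Ω)) →
        MemLp f 2 (volume.restrict Ω) →
        MemLp (fun x => d x • g x) 2 (volume.restrict Ω) →
        (∃! X : HDG.Triple T k, HDG.IsSolution T φ d τ gD f g X) ∧
        ∀ X : HDG.Triple T k, HDG.IsSolution T φ d τ gD f g X →
          HDG.energy T τ X ≤ c * (HDG.bdryNormSq T τ gD
            + HDG.volNormSq T (fun x => d x • g x) + HDG.volNormSq T f) ∧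
          (MemLp g 2 (volume.restrict Ω) →
            HDG.energy T τ X ≤ c * (HDG.bdryNormSq T τ gD
              + HDG.volNormSq T g + HDG.volNormSq T f)) := by
  have hn2 : 2 ≤ n := by omega
  obtain ⟨c, hc, hload⟩ := HDG.exists_load_le T k hn2 hΩ hΩreg hφd hC₁ C₂
  obtain ⟨D, hD, hvol⟩ := HDG.exists_volNormSq_smul_le T hΩreg hφd
  -- The factor `2` comes from the absorption of half the energy. The factor `1 + D` serves both
  -- estimates at once, `D` being the bound for multiplication by `d` in `L²`.
  refine ⟨2 * c * (1 + D), by positivity, fun τ hτ =>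
    ⟨HDG.bilin_self T hn2 hΩ hΩreg hφd hC₁ hτ, fun gD f g hgD hf hg =>
      ⟨HDG.existsUnique_isSolution T hn2 hΩ hΩreg hφd hC₁ hτ hgD hf hg, fun X hX => ?_⟩⟩⟩
  have hE := HDG.energy_le_of_isSolution T hn2 hΩ hΩreg hφd hC₁ hτ hX
    (hload τ hτ gD f g hgD hf hg X)
  have hB := HDG.bdryNormSq_nonneg T τ gD
  have hG := HDG.volNormSq_nonneg T fun x => d x • g x
  have hG' := HDG.volNormSq_nonneg T g
  have hF := HDG.volNormSq_nonneg T f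
  refine ⟨hE.trans ?_, fun hg2 => hE.trans ?_⟩
  · exact mul_le_mul_of_nonneg_right (le_mul_of_one_le_right (by positivity) (by linarith))
      (by positivity)
  · rw [mul_assoc (2 * c)]
    refine mul_le_mul_of_nonneg_left ?_ (by positivity)
    nlinarith [hvol g hg2, mul_nonneg hD hB, mul_nonneg hD hF]
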